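/- Let $\Bbbk$ be a field of characteristic $0$. Let $\mathrm{DerCom}$ be the symmetric operad over $\Bbbk$ on the two colours $c,l$ generated by a commutative product $\alpha$ (inputs $c,c$, output $c$), an antisymmetric bracket $\beta$ (inputs $l,l$, output $l$), an operation $d$ (inputs $c,l$, output $c$; $d(f,X)=X(f)$) and an operation $m$ (inputs $c,l$, output $l$; $m(f,X)=fX$), subject to $$\alpha(\alpha(1,2),3)=\alpha(1,\alpha(2,3)),\qquad \beta(\beta(1,2),3)-\beta(\beta(1,3),2)-\beta(1,\beta(2,3))=0,$$ $$d(\alpha(1,2),3)=\alpha(1,d(2,3))+\alpha(d(1,3),2),\qquad d(1,\beta(2,3))=d(d(1,3),2)-d(d(1,2),3),\qquad m(\alpha(1,2),3)=m(1,m(2,3)).$$ The Lie–Rinehart operad $\mathrm{LieR}$ has the same generators and, in addition, the two relations $$d(1,m(2,3))=\alpha(d(1,3),2),\qquad \beta(m(1,3),2)=-m(1,\beta(2,3))-m(d(1,2),3).$$ Pass to coloured shuffle operads: the generators are $\alpha,\beta,d,m$ and $e(1,2)=d(2,1)$, $n(1,2)=m(2,1)$, and the defining relations are the $\Sigma_3$-orbits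 of the relations above, written in shuffle tree monomials. An ordering of the tree monomials of the free coloured shuffle operad on $\alpha,\beta,d,e,m,n$ is called admissible if it is total, monomials of smaller arity are smaller, and it is compatible with all shuffle compositions: if $s\le s'$ have the same arity, $t\le t'$ have the same arity, and both compositions are possible, then $s\circ_{i,\omega}t\le s'\circ_{i,\omega}t'$. Let $L$ be the set of the monomials $$\alpha(\alpha(1,3),2),\ \alpha(1,\alpha(2,3)),\ \beta(\beta(1,2),3),\ e(1,\alpha(2,3)),\ d(\alpha(1,3),2),\ d(\alpha(1,2),3),$$ $$m(1,m(2,3)),\ n(m(1,3),2),\ m(1,n(2,3)),\ n(n(1,2),3),\ n(n(1,3),2),\ n(m(1,2),3),$$ $$d(1,\beta(2,3)),\ e(\beta(1,3),2),\ e(\beta(1,2),3),$$ and let $L'$ be the union of $L$ with the monomials $$e(m(1,2),3),\ e(n(1,2),3),\ d(1,n(2,3)),\ e(m(1,3),2),\ d(1,m(2,3)),\ e(n(1,3),2),$$ $$\beta(1,m(2,3)),\ \beta(m(1,3),2),\ \beta(n(1,2),3),\ \beta(1,n(2,3)),\ \beta(n(1,3),2),\ \beta(m(1,2),3).$$ **Theorem.**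 (1) There is an admissible ordering for which the set of leading terms of the defining relations of $\mathrm{LieR}$ is $L'$ and the set of leading terms of the defining relations of $\mathrm{DerCom}$ is $L$. (2) The defining relations of the shuffle operad $\mathrm{DerCom}$ are nonzero and quadratic (all their monomials have two vertices). For every admissible ordering for which the set of their leading terms is $L$ (in particular for every ordering as in (1)), they form a Gröbner basis of the operadic ideal they generate: the leading term of every nonzero element of the ideal is divisible by the leading term of a defining relation. -/

import Mathlib

/-! Free coloured shuffle operads generated by binary operations, their operadic ideals and
Gröbner bases; the operads `LieR` and `DerCom`. -/

namespace ColouredOperad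

/-- A set `O` of binary operations with inputs and output coloured by `I`. -/
structure Signature (I O : Type) where
  in₁ : O → I
  in₂ : O → I
  out : O → I

/-- Planar rooted trees whose vertices carry binary operations and whose leaves carry a colour
and a label. The tree `leaf c i` is the degenerate tree (the identity) of colour `c`. -/
inductive Tree (I O : Type) : Type
  | leaf (c : I) (i : ℕ) : Tree I O
  | node (g : O) (s t : Tree I O) : Tree I O
  deriving DecidableEq

namespace Tree

variable {I O : Type}

/-- The coloured leaves, read from left to right. -/
def leaves : Tree I O → List (I × ℕ)
  | leaf c i => [(c, i)]
  | node _ s t => s.leaves ++ t.leaves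

/-- The leaf labels, read from left to right. -/
def labels (t : Tree I O) : List ℕ := t.leaves.map Prod.snd

/-- The number of leaves. -/
def arity (t : Tree I O) : ℕ := t.leaves.length

/-- The number of inner vertices. -/
def vertices : Tree I O → ℕ
  | leaf _ _ => 0
  | node _ s t => s.vertices + t.vertices + 1

/-- The smallest leaf label. -/
def minLabel : Tree I O → ℕ
  | leaf _ i => i
  | node _ s t => min s.minLabel t.minLabel

/-- Apply `f` to all leaf labels. -/
def relabel (f : ℕ → ℕ) : Tree I O → Tree I O
  | leaf c i => leaf c (f i)
  | node g s t => node g (s.relabel f) (t.relabel f)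

/-- The colour of the output edge. -/
def outColour (S : Signature I O) : Tree I O → I
  | leaf c _ => c
  | node g _ _ => S.out g

/-- At every inner edge the two colours agree. -/
def WellColoured (S : Signature I O) : Tree I O → Prop
  | leaf _ _ => True
  | node g s t => s.outColour S = S.in₁ g ∧ t.outColour S = S.in₂ g ∧
      s.WellColoured S ∧ t.WellColoured S

/-- The shuffle condition: at every vertex the smallest descendants of the inputs increase. -/
def IsShuffle : Tree I O → Prop
  | leaf _ _ => True
  | node _ s t => s.minLabel < t.minLabel ∧ s.IsShuffle ∧ t.IsShuffle

/-- Graft the tree `u` on the leaf with label `i`. -/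
def graft (i : ℕ) (u : Tree I O) : Tree I O → Tree I O
  | leaf c j => if j = i then u else leaf c j
  | node g s t => node g (graft i u s) (graft i u t)

/-- The tree monomials of the free coloured shuffle operad: well-coloured shuffle trees whose
leaves are labelled bijectively by `1, …, n`. -/
structure IsMonomial (S : Signature I O) (t : Tree I O) : Prop where
  wellColoured : t.WellColoured S
  isShuffle : t.IsShuffle
  labels_perm : t.labels.Perm (List.range' 1 t.arity)

/-- `IsSubtree s t`: `s` consists of all descendants of some edge of `t`. -/
inductive IsSubtree : Tree I O → Tree I O → Prop
  | refl (t : Tree I O) : IsSubtree t t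
  | left (g : O) {r s : Tree I O} (t : Tree I O) : IsSubtree r s → IsSubtree r (node g s t)
  | right (g : O) {r t : Tree I O} (s : Tree I O) : IsSubtree r t → IsSubtree r (node g s t)

/-- `IsTruncation S u t`: `u` is obtained from `t` by cutting some edges, each new leaf being
labelled by the smallest label among its former descendants. -/
inductive IsTruncation (S : Signature I O) : Tree I O → Tree I O → Prop
  | cut (t : Tree I O) : IsTruncation S (leaf (t.outColour S) t.minLabel) t
  | node (g : O) {u s v t : Tree I O} : IsTruncation S u s → IsTruncation S v t →
      IsTruncation S (node g u v) (node g s t)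

/-! ### Grafting produces tree monomials -/

section Lemmas

variable {S : Signature I O}

theorem labels_leaf (c : I) (i : ℕ) : (leaf c i : Tree I O).labels = [i] := rfl

theorem labels_node (g : O) (s t : Tree I O) : (node g s t).labels = s.labels ++ t.labels := by
  simp [labels, leaves]

theorem length_labels (t : Tree I O) : t.labels.length = t.arity := by
  simp [labels, arity]

theorem arity_node (g : O) (s t : Tree I O) : (node g s t).arity = s.arity + t.arity := by
  simp [arity, leaves]

theorem leaves_relabel (f : ℕ → ℕ) (t : Tree I O) :
    (t.relabel f).leaves = t.leaves.map (fun p => (p.1, f p.2)) := by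
  induction t with
  | leaf c i => rfl
  | node g s t hs ht => simp [relabel, leaves, hs, ht]

theorem labels_relabel (f : ℕ → ℕ) (t : Tree I O) :
    (t.relabel f).labels = t.labels.map f := by
  simp [labels, leaves_relabel]

theorem arity_relabel (f : ℕ → ℕ) (t : Tree I O) : (t.relabel f).arity = t.arity := by
  simp [arity, leaves_relabel]

theorem outColour_relabel (f : ℕ → ℕ) (t : Tree I O) :
    (t.relabel f).outColour S = t.outColour S := by
  cases t <;> rfl

theorem wellColoured_relabel (f : ℕ → ℕ) {t : Tree I O} (h : t.WellColoured S) :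
    (t.relabel f).WellColoured S := by
  induction t with
  | leaf c i => trivial
  | node g s t hs ht =>
    obtain ⟨h1, h2, h3, h4⟩ := h
    exact ⟨by rw [outColour_relabel, h1], by rw [outColour_relabel, h2], hs h3, ht h4⟩

theorem minLabel_mem (t : Tree I O) : t.minLabel ∈ t.labels := by
  induction t with
  | leaf c i => simp [minLabel, labels_leaf]
  | node g s t hs ht =>
    rw [labels_node, minLabel, List.mem_append]
    rcases min_choice s.minLabel t.minLabel with h | h <;> rw [h]
    · exact Or.inl hs
    · exact Or.inr ht

theorem minLabel_le (t : Tree I O) : ∀ i ∈ t.labels, t.minLabel ≤ i := by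
  induction t with
  | leaf c i => simp [minLabel, labels_leaf]
  | node g s t hs ht =>
    intro i hi
    rw [labels_node, List.mem_append] at hi
    rcases hi with h | h
    · exact (min_le_left _ _).trans (hs i h)
    · exact (min_le_right _ _).trans (ht i h)

theorem minLabel_relabel {f : ℕ → ℕ} (t : Tree I O)
    (hf : StrictMonoOn f {i | i ∈ t.labels}) : (t.relabel f).minLabel = f t.minLabel := by
  apply le_antisymm
  · apply minLabel_le
    rw [labels_relabel]
    exact List.mem_map_of_mem (minLabel_mem t)
  · have h := minLabel_mem (t.relabel f)
    rw [labels_relabel, List.mem_map] at h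
    obtain ⟨i, hi, h⟩ := h
    rw [← h]
    exact hf.monotoneOn (minLabel_mem t) hi (minLabel_le t i hi)

theorem isShuffle_relabel {f : ℕ → ℕ} {t : Tree I O}
    (hf : StrictMonoOn f {i | i ∈ t.labels}) (h : t.IsShuffle) : (t.relabel f).IsShuffle := by
  induction t with
  | leaf c i => trivial
  | node g s t hs ht =>
    obtain ⟨h1, h2, h3⟩ := h
    have fs : StrictMonoOn f {i | i ∈ s.labels} := hf.mono fun i hi => by
      simp only [Set.mem_ofPred_eq, labels_node, List.mem_append] at hi ⊢
      exact Or.inl hi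
    have ft : StrictMonoOn f {i | i ∈ t.labels} := hf.mono fun i hi => by
      simp only [Set.mem_ofPred_eq, labels_node, List.mem_append] at hi ⊢
      exact Or.inr hi
    refine ⟨?_, hs fs h2, ht ft h3⟩
    rw [minLabel_relabel s fs, minLabel_relabel t ft]
    refine hf ?_ ?_ h1 <;> simp only [Set.mem_ofPred_eq, labels_node, List.mem_append]
    · exact Or.inl (minLabel_mem s)
    · exact Or.inr (minLabel_mem t)

theorem outColour_graft {i : ℕ} {u t : Tree I O}
    (hc : ∀ c, (c, i) ∈ t.leaves → c = u.outColour S) :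
    (graft i u t).outColour S = t.outColour S := by
  cases t with
  | leaf c j =>
    by_cases hj : j = i
    · subst hj
      simp [graft, outColour, hc c (by simp [leaves])]
    · simp [graft, hj]
  | node g s t => rfl

theorem wellColoured_graft {i : ℕ} {u t : Tree I O} (hu : u.WellColoured S)
    (ht : t.WellColoured S) (hc : ∀ c, (c, i) ∈ t.leaves → c = u.outColour S) :
    (graft i u t).WellColoured S := by
  induction t with
  | leaf c j =>
    by_cases hj : j = i
    · simpa [graft, hj] using hu
    · simp [graft, hj, WellColoured]
  | node g s t hs ht' =>
    obtain ⟨h1, h2, h3, h4⟩ := ht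
    have cs : ∀ c, (c, i) ∈ s.leaves → c = u.outColour S := fun c h =>
      hc c (by simp [leaves, h])
    have ct : ∀ c, (c, i) ∈ t.leaves → c = u.outColour S := fun c h =>
      hc c (by simp [leaves, h])
    exact ⟨by rw [outColour_graft cs, h1], by rw [outColour_graft ct, h2], hs h3 cs, ht' h4 ct⟩

theorem minLabel_graft (u t : Tree I O) : (graft u.minLabel u t).minLabel = t.minLabel := by
  induction t with
  | leaf c j =>
    by_cases hj : j = u.minLabel
    · simp [graft, hj, minLabel]
    · simp [graft, hj]
  | node g s t hs ht => simp [graft, minLabel, hs, ht]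

theorem isShuffle_graft {u t : Tree I O} (hu : u.IsShuffle) (ht : t.IsShuffle) :
    (graft u.minLabel u t).IsShuffle := by
  induction t with
  | leaf c j =>
    by_cases hj : j = u.minLabel
    · simpa [graft, hj] using hu
    · simp [graft, hj, IsShuffle]
  | node g s t hs ht' =>
    obtain ⟨h1, h2, h3⟩ := ht
    exact ⟨by rw [minLabel_graft, minLabel_graft]; exact h1, hs h2, ht' h3⟩

theorem arity_graft_add (i : ℕ) (u t : Tree I O) :
    (graft i u t).arity + t.labels.count i = t.arity + t.labels.count i * u.arity := by
  induction t with
  | leaf c j =>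
    by_cases hj : j = i
    · subst hj
      simp [graft, labels_leaf, arity, leaves]
      omega
    · simp [graft, hj, labels_leaf, arity, leaves]
  | node g s t hs ht =>
    simp only [graft, arity_node, labels_node, List.count_append, add_mul]
    omega

theorem mem_labels_graft {i j : ℕ} {u t : Tree I O} :
    j ∈ (graft i u t).labels ↔ (j ∈ t.labels ∧ j ≠ i) ∨ (i ∈ t.labels ∧ j ∈ u.labels) := by
  induction t with
  | leaf c k =>
    by_cases hk : k = i
    · subst hk
      simp [graft, labels_leaf]
    · have hk' : ¬ i = k := fun h => hk h.symm
      simp only [graft, hk, if_false, labels_leaf, List.mem_singleton, hk', false_and, or_false]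
      exact ⟨fun h => ⟨h, by rw [h]; exact hk⟩, fun h => h.1⟩
  | node g s t hs ht =>
    simp only [graft, labels_node, List.mem_append, hs, ht]
    tauto

theorem IsMonomial.nodup {t : Tree I O} (h : t.IsMonomial S) : t.labels.Nodup :=
  h.labels_perm.nodup_iff.mpr List.nodup_range'

theorem IsMonomial.mem_labels {t : Tree I O} (h : t.IsMonomial S) {i : ℕ} :
    i ∈ t.labels ↔ i ∈ Set.Icc 1 t.arity := by
  rw [h.labels_perm.mem_iff, List.mem_range'_1, Set.mem_Icc]
  omega

theorem arity_pos (t : Tree I O) : 0 < t.arity := by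
  induction t with
  | leaf c i => simp [arity, leaves]
  | node g s t hs ht => rw [arity_node]; omega

theorem IsMonomial.minLabel_eq {t : Tree I O} (h : t.IsMonomial S) : t.minLabel = 1 := by
  apply le_antisymm
  · exact minLabel_le t 1 (h.mem_labels.mpr ⟨le_rfl, arity_pos t⟩)
  · exact (h.mem_labels.mp (minLabel_mem t)).1

end Lemmas

end Tree

variable {I O : Type}

/-- The tree monomials of the free coloured shuffle operad on the signature `S`. -/
def Monomial (S : Signature I O) : Type := {t : Tree I O // t.IsMonomial S}

/-- The datum `(i, ω)` of a shuffle composition `- ∘_{i,ω} -` of an operation of arity `n` with an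
operation of arity `m`: the input `pos = i` at which one grafts, and the shuffle `ω`, given by the
increasing relabellings `outer` of the labels of the lower tree and `inner` of the labels of the
upper tree, whose images together are `1, …, n + m - 1`. The grafting edge is the lower input
`pos`, and it is compared with other edges through the smallest label above it. -/
structure ShuffleDatum (n m : ℕ) where
  pos : ℕ
  outer : ℕ → ℕ
  inner : ℕ → ℕ
  pos_mem : pos ∈ Set.Icc 1 n
  outer_mono : StrictMonoOn outer (Set.Icc 1 n)
  inner_mono : StrictMonoOn inner (Set.Icc 1 m)
  glue : outer pos = inner 1
  cover : outer '' Set.Icc 1 n ∪ inner '' Set.Icc 1 m = Set.Icc 1 (n + m - 1)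

/-- The composition `s ∘_{i,ω} t` is possible: arities and colours match. -/
def Composable {S : Signature I O} {n m : ℕ} (ω : ShuffleDatum n m) (s t : Monomial S) : Prop :=
  s.1.arity = n ∧ t.1.arity = m ∧ (t.1.outColour S, ω.pos) ∈ s.1.leaves

/-- The tree underlying the composition `s ∘_{i,ω} t`. -/
def compTree {n m : ℕ} (ω : ShuffleDatum n m) (s t : Tree I O) : Tree I O :=
  Tree.graft (ω.outer ω.pos) (t.relabel ω.inner) (s.relabel ω.outer)

theorem isMonomial_compTree {S : Signature I O} {n m : ℕ} (ω : ShuffleDatum n m)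
    (s t : Monomial S) (h : Composable ω s t) : (compTree ω s.1 t.1).IsMonomial S := by
  obtain ⟨s, hs⟩ := s
  obtain ⟨t, ht⟩ := t
  obtain ⟨hn, hm, hc⟩ := h
  simp only at hn hm hc ⊢
  have ms : {i | i ∈ s.labels} = Set.Icc 1 n := by
    ext i; rw [Set.mem_ofPred_eq, hs.mem_labels, hn]
  have mt : {i | i ∈ t.labels} = Set.Icc 1 m := by
    ext i; rw [Set.mem_ofPred_eq, ht.mem_labels, hm]
  have hmin : (t.relabel ω.inner).minLabel = ω.outer ω.pos := by
    rw [Tree.minLabel_relabel t (by rw [mt]; exact ω.inner_mono), ht.minLabel_eq, ω.glue]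
  have hposs : ω.pos ∈ s.labels := by
    rw [hs.mem_labels, hn]; exact ω.pos_mem
  have hpos : ω.outer ω.pos ∈ (s.relabel ω.outer).labels := by
    rw [Tree.labels_relabel]; exact List.mem_map_of_mem hposs
  have hnd : (s.relabel ω.outer).labels.Nodup := by
    rw [Tree.labels_relabel]
    apply List.Nodup.map_on _ hs.nodup
    intro x hx y hy hxy
    exact ω.outer_mono.injOn (ms ▸ hx) (ms ▸ hy) hxy
  have hcnt : (s.relabel ω.outer).labels.count (ω.outer ω.pos) = 1 :=
    List.count_eq_one_of_mem hnd hpos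
  have har : (compTree ω s t).arity + 1 = n + m := by
    have := Tree.arity_graft_add (ω.outer ω.pos) (t.relabel ω.inner) (s.relabel ω.outer)
    rw [hcnt, Tree.arity_relabel, Tree.arity_relabel, hn, hm, one_mul] at this
    exact this
  refine ⟨?_, ?_, ?_⟩
  · apply Tree.wellColoured_graft (Tree.wellColoured_relabel _ ht.wellColoured)
      (Tree.wellColoured_relabel _ hs.wellColoured)
    intro c hcmem
    rw [Tree.outColour_relabel]
    rw [Tree.leaves_relabel, List.mem_map] at hcmem
    obtain ⟨⟨c', j⟩, hj, hjc⟩ := hcmem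
    simp only [Prod.mk.injEq] at hjc
    obtain ⟨rfl, hjc⟩ := hjc
    have hjs : j ∈ s.labels := List.mem_map_of_mem (f := Prod.snd) hj
    have hjp : j = ω.pos :=
      ω.outer_mono.injOn (ms ▸ hjs) ω.pos_mem hjc
    subst hjp
    have := List.inj_on_of_nodup_map hs.nodup hj hc rfl
    exact congrArg Prod.fst this
  · rw [compTree, ← hmin]
    apply Tree.isShuffle_graft
    · exact Tree.isShuffle_relabel (by rw [mt]; exact ω.inner_mono) ht.isShuffle
    · exact Tree.isShuffle_relabel (by rw [ms]; exact ω.outer_mono) hs.isShuffle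
  · symm
    apply List.Subperm.perm_of_length_le
    · apply List.Nodup.subperm List.nodup_range'
      intro j hj
      rw [List.mem_range'_1] at hj
      have hj' : j ∈ Set.Icc 1 (n + m - 1) := by
        rw [Set.mem_Icc]; omega
      rw [← ω.cover] at hj'
      rw [compTree, Tree.mem_labels_graft]
      rw [Tree.labels_relabel, Tree.labels_relabel] at *
      by_cases hji : j = ω.outer ω.pos
      · right
        refine ⟨hpos, ?_⟩
        rw [hji, ω.glue]
        exact List.mem_map_of_mem (ht.mem_labels.mpr ⟨le_rfl, Tree.arity_pos t⟩)
      · rcases hj' with ⟨k, hk, rfl⟩ | ⟨k, hk, rfl⟩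
        · left
          exact ⟨List.mem_map_of_mem (by rw [hs.mem_labels, hn]; exact hk), hji⟩
        · right
          exact ⟨hpos, List.mem_map_of_mem (by rw [ht.mem_labels, hm]; exact hk)⟩
    · rw [Tree.length_labels, List.length_range']

/-- The shuffle composition `s ∘_{i,ω} t` of tree monomials. -/
def Monomial.comp {S : Signature I O} {n m : ℕ} (ω : ShuffleDatum n m) (s t : Monomial S)
    (h : Composable ω s t) : Monomial S :=
  ⟨compTree ω s.1 t.1, isMonomial_compTree ω s t h⟩

/-- `s` is divisible by `t`: there is a subtree of `s` which, with the leaf labels determined by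
the smallest descendants and made standard, is `t`. -/
def Divisible {S : Signature I O} (s t : Monomial S) : Prop :=
  ∃ (r : Tree I O) (f : ℕ → ℕ), r.IsSubtree s.1 ∧ StrictMonoOn f (Set.Icc 1 t.1.arity) ∧
    (t.1.relabel f).IsTruncation S r

/-- The free coloured shuffle operad over `𝕜`: the direct sum over all arities, colourings of
inputs and output colours of its components; the tree monomials are a basis. -/
abbrev Free (𝕜 : Type*) [Field 𝕜] (S : Signature I O) : Type _ := Monomial S →₀ 𝕜

open Classical in
/-- The bilinear shuffle composition `x ∘_{i,ω} y`; the compositions of monomials whose arities or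
colours do not match are zero. -/
noncomputable def comp {𝕜 : Type*} [Field 𝕜] {S : Signature I O} {n m : ℕ}
    (ω : ShuffleDatum n m) (x y : Free 𝕜 S) : Free 𝕜 S :=
  x.sum fun s a => y.sum fun t b =>
    if h : Composable ω s t then Finsupp.single (Monomial.comp ω s t h) (a * b) else 0

/-- Operadic ideals of the free coloured shuffle operad. -/
def IsOperadicIdeal {𝕜 : Type*} [Field 𝕜] {S : Signature I O}
    (M : Submodule 𝕜 (Free 𝕜 S)) : Prop :=
  ∀ (n m : ℕ) (ω : ShuffleDatum n m) (x y : Free 𝕜 S),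
    (x ∈ M → comp ω x y ∈ M) ∧ (y ∈ M → comp ω x y ∈ M)

/-- The operadic ideal generated by `G`. -/
noncomputable def operadicIdeal {𝕜 : Type*} [Field 𝕜] {S : Signature I O} (G : Set (Free 𝕜 S)) :
    Submodule 𝕜 (Free 𝕜 S) :=
  sInf {M | IsOperadicIdeal M ∧ G ⊆ (M : Set (Free 𝕜 S))}

/-- Admissible orderings of the tree monomials: total orders for which smaller arity means smaller,
and which are compatible with all possible shuffle compositions. -/
structure IsAdmissible {S : Signature I O} (le : Monomial S → Monomial S → Prop) : Prop where
  refl : ∀ s, le s s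
  trans : ∀ s t u, le s t → le t u → le s u
  antisymm : ∀ s t, le s t → le t s → s = t
  total : ∀ s t, le s t ∨ le t s
  arity : ∀ s t, s.1.arity < t.1.arity → le s t
  comp : ∀ (n m : ℕ) (ω : ShuffleDatum n m) (s s' t t' : Monomial S)
    (h : Composable ω s t) (h' : Composable ω s' t'), le s s' → le t t' →
    le (Monomial.comp ω s t h) (Monomial.comp ω s' t' h')

/-- `t` is the leading term of `x`, that is the largest monomial in its expansion. -/
def IsLeadingTerm {𝕜 : Type*} [Field 𝕜] {S : Signature I O}
    (le : Monomial S → Monomial S → Prop) (x : Free 𝕜 S) (t : Monomial S) : Prop :=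
  t ∈ x.support ∧ ∀ s ∈ x.support, le s t

/-- The trees that are leading terms of elements of `G`. -/
def leadingTrees {𝕜 : Type*} [Field 𝕜] {S : Signature I O}
    (le : Monomial S → Monomial S → Prop) (G : Set (Free 𝕜 S)) : Set (Tree I O) :=
  {r | ∃ x ∈ G, ∃ t : Monomial S, IsLeadingTerm le x t ∧ t.1 = r}

/-- `G` is a Gröbner basis of the operadic ideal `M`: it generates `M`, and the leading term of
any element of `M` is divisible by the leading term of an element of `G`. -/
def IsGroebnerBasis {𝕜 : Type*} [Field 𝕜] {S : Signature I O}
    (le : Monomial S → Monomial S → Prop) (M : Submodule 𝕜 (Free 𝕜 S))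
    (G : Set (Free 𝕜 S)) : Prop :=
  operadicIdeal G = M ∧
    ∀ x ∈ M, ∀ t, IsLeadingTerm le x t → ∃ g ∈ G, ∃ u, IsLeadingTerm le g u ∧ Divisible t u

/-- All monomials of `x` have exactly two vertices. -/
def IsQuadratic {𝕜 : Type*} [Field 𝕜] {S : Signature I O} (x : Free 𝕜 S) : Prop :=
  ∀ t ∈ x.support, t.1.vertices = 2

/-! ### The operads `LieR` and `DerCom` -/

/-- The colours: `c` for the commutative algebra and `l` for the Lie algebra. -/
inductive Colour : Type
  | c | l
  deriving DecidableEq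

/-- The generators of the symmetric operads `LieR` and `DerCom`: the commutative product, the Lie
bracket, the action `d(f, X) = X(f)` and the module structure `m(f, X) = f X`. -/
inductive SymOp : Type
  | alpha | beta | d | m
  deriving DecidableEq

/-- The generators of the associated shuffle operads; `e` and `n` are `d` and `m` with the two
arguments exchanged. -/
inductive ShOp : Type
  | alpha | beta | d | e | m | n
  deriving DecidableEq

/-- The colours of the generators of the symmetric operads. -/
def symSig : Signature Colour SymOp where
  in₁ | .alpha => .c | .beta => .l | .d => .c | .m => .c
  in₂ | .alpha => .c | .beta => .l | .d => .l | .m => .l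
  out | .alpha => .c | .beta => .l | .d => .c | .m => .l

/-- The colours of the generators of the shuffle operads. -/
def shSig : Signature Colour ShOp where
  in₁ | .alpha => .c | .beta => .l | .d => .c | .e => .l | .m => .c | .n => .l
  in₂ | .alpha => .c | .beta => .l | .d => .l | .e => .c | .m => .l | .n => .c
  out | .alpha => .c | .beta => .l | .d => .c | .e => .c | .m => .l | .n => .l

/-- The shuffle generator `g`. -/
def SymOp.toShOp : SymOp → ShOp
  | .alpha => .alpha | .beta => .beta | .d => .d | .m => .m

/-- The shuffle generator `g'` with `g(y, x) = sign * g'(x, y)`. -/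
def SymOp.flip : SymOp → ShOp
  | .alpha => .alpha | .beta => .beta | .d => .e | .m => .n

/-- The sign in `g(y, x) = sign * g'(x, y)`: the bracket is antisymmetric. -/
def SymOp.flipSign : SymOp → ℤ
  | .alpha => 1 | .beta => -1 | .d => 1 | .m => 1

/-- The planar representation of a tree on the symmetric generators: up to the sign, a tree on the
shuffle generators in which the inputs of each vertex are ordered by the smallest descendant. -/
def planarize : Tree Colour SymOp → ℤ × Tree Colour ShOp
  | .leaf a i => (1, .leaf a i)
  | .node g s t =>
    if s.minLabel < t.minLabel then
      ((planarize s).1 * (planarize t).1, .node g.toShOp (planarize s).2 (planarize t).2)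
    else
      ((planarize s).1 * (planarize t).1 * g.flipSign,
        .node g.flip (planarize t).2 (planarize s).2)

/-- The tree `g(h(i, j), k)`. -/
def leftTree {O : Type} (S : Signature Colour O) (g h : O) (i j k : ℕ) : Tree Colour O :=
  .node g (.node h (.leaf (S.in₁ h) i) (.leaf (S.in₂ h) j)) (.leaf (S.in₂ g) k)

/-- The tree `g(i, h(j, k))`. -/
def rightTree {O : Type} (S : Signature Colour O) (g h : O) (i j k : ℕ) : Tree Colour O :=
  .node g (.leaf (S.in₁ g) i) (.node h (.leaf (S.in₁ h) j) (.leaf (S.in₂ h) k))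

/-- The relations of the symmetric operad `DerCom`, each a linear combination of trees that is set
to zero: associativity, the Jacobi identity, the Leibniz rule, compatibility of the action with the
bracket, and the module axiom. -/
def derComSymRelations : List (List (ℤ × Tree Colour SymOp)) :=
  [ [(1, leftTree symSig .alpha .alpha 1 2 3), (-1, rightTree symSig .alpha .alpha 1 2 3)],
    [(1, leftTree symSig .beta .beta 1 2 3), (-1, leftTree symSig .beta .beta 1 3 2),
      (-1, rightTree symSig .beta .beta 1 2 3)],
    [(1, leftTree symSig .d .alpha 1 2 3), (-1, rightTree symSig .alpha .d 1 2 3),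
      (-1, leftTree symSig .alpha .d 1 3 2)],
    [(1, rightTree symSig .d .beta 1 2 3), (-1, leftTree symSig .d .d 1 3 2),
      (1, leftTree symSig .d .d 1 2 3)],
    [(1, leftTree symSig .m .alpha 1 2 3), (-1, rightTree symSig .m .m 1 2 3)] ]

/-- The relations of the symmetric operad `LieR`: those of `DerCom` and the two Lie–Rinehart
relations `(s X)(t) = s X(t)` and `[s X, Y] = s [X, Y] - Y(s) X`. -/
def lieRSymRelations : List (List (ℤ × Tree Colour SymOp)) :=
  derComSymRelations ++
  [ [(1, rightTree symSig .d .m 1 2 3), (-1, leftTree symSig .alpha .d 1 3 2)],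
    [(1, leftTree symSig .beta .m 1 3 2), (1, rightTree symSig .m .beta 1 2 3),
      (1, leftTree symSig .m .d 1 2 3)] ]

open Classical in
/-- A tree monomial as an element of the free shuffle operad. -/
noncomputable def ofTree (𝕜 : Type*) [Field 𝕜] {S : Signature I O} (t : Tree I O) : Free 𝕜 S :=
  if h : t.IsMonomial S then Finsupp.single ⟨t, h⟩ 1 else 0

/-- The element of the free shuffle operad that corresponds to the result of the action of the
permutation `σ` of the labels on a linear combination of trees on the symmetric generators. -/
noncomputable def shuffleRelation (𝕜 : Type*) [Field 𝕜] (σ : Equiv.Perm ℕ)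
    (r : List (ℤ × Tree Colour SymOp)) : Free 𝕜 shSig :=
  (r.map fun p =>
    (((p.1 * (planarize (p.2.relabel σ)).1 : ℤ) : 𝕜) • ofTree 𝕜 (planarize (p.2.relabel σ)).2)).sum

/-- The relations of the shuffle operad: the orbits, under the permutations of the three labels, of
the relations of the symmetric operad. -/
def shuffleRelations (𝕜 : Type*) [Field 𝕜] (R : List (List (ℤ × Tree Colour SymOp))) :
    Set (Free 𝕜 shSig) :=
  {x | ∃ r ∈ R, ∃ σ : Equiv.Perm ℕ, (∀ i, i ∉ Set.Icc 1 3 → σ i = i) ∧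
    x = shuffleRelation 𝕜 σ r}

/-- The defining relations of the shuffle operad `DerCom`. -/
def derComRelations (𝕜 : Type*) [Field 𝕜] : Set (Free 𝕜 shSig) :=
  shuffleRelations 𝕜 derComSymRelations

/-- The defining relations of the shuffle operad `LieR`. -/
def lieRRelations (𝕜 : Type*) [Field 𝕜] : Set (Free 𝕜 shSig) :=
  shuffleRelations 𝕜 lieRSymRelations

/-- The chosen leading terms of the relations of `DerCom`. -/
def derComLeadingTrees : List (Tree Colour ShOp) :=
  [ leftTree shSig .alpha .alpha 1 3 2, rightTree shSig .alpha .alpha 1 2 3,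
    leftTree shSig .beta .beta 1 2 3,
    rightTree shSig .e .alpha 1 2 3, leftTree shSig .d .alpha 1 3 2,
    leftTree shSig .d .alpha 1 2 3,
    rightTree shSig .m .m 1 2 3, leftTree shSig .n .m 1 3 2, rightTree shSig .m .n 1 2 3,
    leftTree shSig .n .n 1 2 3, leftTree shSig .n .n 1 3 2, leftTree shSig .n .m 1 2 3,
    rightTree shSig .d .beta 1 2 3, leftTree shSig .e .beta 1 3 2,
    leftTree shSig .e .beta 1 2 3 ]

/-- The chosen leading terms of the relations of `LieR`. -/
def lieRLeadingTrees : List (Tree Colour ShOp) :=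
  derComLeadingTrees ++
  [ leftTree shSig .e .m 1 2 3, leftTree shSig .e .n 1 2 3, rightTree shSig .d .n 1 2 3,
    leftTree shSig .e .m 1 3 2, rightTree shSig .d .m 1 2 3, leftTree shSig .e .n 1 3 2,
    rightTree shSig .beta .m 1 2 3, leftTree shSig .beta .m 1 3 2,
    leftTree shSig .beta .n 1 2 3, rightTree shSig .beta .n 1 2 3,
    leftTree shSig .beta .n 1 3 2, leftTree shSig .beta .m 1 2 3 ]

end ColouredOperad

/-! Part (1) is a finite check once a suitable ordering is available. Monomials are compared by
arity, by the number of vertices `β`, `m`, `n`, by the sequence of paths from the root to the leaves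
`1, 2, …`, and finally by output colour. In a shuffle composition the path to a leaf is either a
path of the lower tree or the path to the grafting input followed by a path of the upper tree. An
order on words that is strictly compatible with concatenation (`wordKey_append_lt`) therefore gives
an admissible ordering of trees (`pathKey_comp`, `isAdmissible_pathOrder`).

Part (2) is proved without resolving any ambiguities. Call a monomial normal if no element of `L`
divides it. Leading terms of homogeneous elements of the ideal are stable under composition, so
every monomial that is not normal is such a leading term (`hasLead_of_not_isNormal`), and everything
reduces to normal monomials modulo the ideal (`exists_reduction`). If some element of the ideal had
a normal leading term, reducing its smaller terms would leave a nonzero combination of normal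
monomials in the ideal (`not_isNormal_of_isLeadingTerm`). It remains to see that normal monomials
are independent modulo the ideal.

Elements of the ideal vanish in every `DerCom`-algebra (`evalLin_eq_zero_of_mem_operadicIdeal`), so
one algebra that separates normal monomials suffices. In the model, the Lie algebra is a free
associative algebra with its commutator. The commutative algebra is the polynomial ring on pairs
(word, label), on which the Lie algebra acts by the derivations that prepend words. The module
structure is as free as possible: a nontrivial monomial `f` acting on a word `w` creates a new
letter for `f • w`, and if `w` is already a letter of this kind the monomials are multiplied.

Words carry keys counting inversions of their labels. In the commutator for `β(s, t)` the product in
the order `s`, `t` has the smaller key, because the shuffle condition puts the smallest label into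
`s`. Hence the value of a normal tree is one basis element plus terms of larger key
(`Model.hasLead`), and the tree can be read off from that basis element
(`Model.leadTerm_injective`). Distinct leading basis elements give independence
(`Model.eq_zero_of_evalLin_eq_zero`). -/

namespace ColouredOperad

/-! ### Paths and grafting -/

namespace Tree

variable {I O : Type}

/-- The path from the root to the leaf labelled `i`, empty if there is no such leaf. -/
def path (i : ℕ) : Tree I O → List (O × Bool)
  | leaf _ _ => []
  | node g s t =>
    if i ∈ s.labels then (g, false) :: path i s
    else if i ∈ t.labels then (g, true) :: path i t else []

theorem path_of_notMem {i : ℕ} {t : Tree I O} (h : i ∉ t.labels) : path i t = [] := by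
  cases t with
  | leaf c j => rfl
  | node g s t =>
    rw [labels_node, List.mem_append, not_or] at h
    simp [path, h.1, h.2]

theorem labels_node_nodup {g : O} {s t : Tree I O} :
    (node g s t).labels.Nodup ↔
      s.labels.Nodup ∧ t.labels.Nodup ∧ ∀ i ∈ s.labels, i ∉ t.labels := by
  rw [labels_node, List.nodup_append']
  rfl

theorem path_relabel {f : ℕ → ℕ} {t : Tree I O} (hf : Set.InjOn f {i | i ∈ t.labels}) {i : ℕ}
    (hi : i ∈ t.labels) : path (f i) (t.relabel f) = path i t := by
  induction t with
  | leaf c j => rfl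
  | node g s t hs ht =>
    have fs : Set.InjOn f {i | i ∈ s.labels} := hf.mono fun i hi => by
      simp only [Set.mem_ofPred_eq, labels_node, List.mem_append] at hi ⊢
      exact Or.inl hi
    have ft : Set.InjOn f {i | i ∈ t.labels} := hf.mono fun i hi => by
      simp only [Set.mem_ofPred_eq, labels_node, List.mem_append] at hi ⊢
      exact Or.inr hi
    have key : ∀ u : Tree I O, (∀ j ∈ u.labels, j ∈ (node g s t).labels) →
        (f i ∈ (u.relabel f).labels ↔ i ∈ u.labels) := by
      intro u hu
      rw [labels_relabel, List.mem_map]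
      constructor
      · rintro ⟨j, hj, hji⟩
        rwa [← hf (hu j hj) hi hji]
      · exact fun h => ⟨i, h, rfl⟩
    have ks := key s (fun j hj => by rw [labels_node]; simp [hj])
    have kt := key t (fun j hj => by rw [labels_node]; simp [hj])
    simp only [relabel, path, ks, kt]
    by_cases h1 : i ∈ s.labels
    · simp [h1, hs fs h1]
    · have h2 : i ∈ t.labels := by
        rw [labels_node, List.mem_append] at hi
        exact hi.resolve_left h1
      simp [h1, h2, ht ft h2]

theorem graft_of_notMem {i : ℕ} {u t : Tree I O} (h : i ∉ t.labels) : graft i u t = t := by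
  induction t with
  | leaf c j =>
    rw [labels_leaf, List.mem_singleton] at h
    simp [graft, Ne.symm h]
  | node g s t hs ht =>
    rw [labels_node, List.mem_append, not_or] at h
    simp [graft, hs h.1, ht h.2]

theorem path_graft_outer {i j : ℕ} {u t : Tree I O} (hj : j ≠ i) (hu : j ∉ u.labels) :
    path j (graft i u t) = path j t := by
  induction t with
  | leaf c k =>
    by_cases hk : k = i
    · simp [graft, hk, path, path_of_notMem hu]
    · simp [graft, hk]
  | node g s t hs ht =>
    simp [graft, path, mem_labels_graft, hj, hu, hs, ht]

/-- Only the label `i` may be shared by `u` and `t`. Otherwise a leaf of `t` with label `j` could be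
met before the grafted copy of `u`. -/
theorem path_graft_inner {i j : ℕ} {u t : Tree I O} (ht : t.labels.Nodup) (hi : i ∈ t.labels)
    (hd : ∀ k ∈ t.labels, k ∈ u.labels → k = i) (hj : j ∈ u.labels) :
    path j (graft i u t) = path i t ++ path j u := by
  induction t with
  | leaf c k =>
    rw [labels_leaf, List.mem_singleton] at hi
    simp [graft, hi, path]
  | node g s t hs ht' =>
    obtain ⟨n1, n2, n3⟩ := labels_node_nodup.mp ht
    rw [labels_node, List.mem_append] at hi
    have ds : ∀ k ∈ s.labels, k ∈ u.labels → k = i := fun k hk =>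
      hd k (by rw [labels_node]; simp [hk])
    have dt : ∀ k ∈ t.labels, k ∈ u.labels → k = i := fun k hk =>
      hd k (by rw [labels_node]; simp [hk])
    by_cases h1 : i ∈ s.labels
    · simp [graft, path, mem_labels_graft, h1, hj, hs n1 h1 ds]
    · have h2 := hi.resolve_left h1
      have h3 : j ∉ s.labels := fun h => h1 (ds j h hj ▸ h)
      simp [graft, path, mem_labels_graft, h1, h2, h3, hj, ht' n2 h2 dt]

/-- A well-coloured tree is determined by its paths and its output colour. -/
theorem eq_of_path_eq {S : Signature I O} {s t : Tree I O} (hs : s.WellColoured S)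
    (ht : t.WellColoured S) (ns : s.labels.Nodup) (nt : t.labels.Nodup)
    (hl : ∀ i, i ∈ s.labels ↔ i ∈ t.labels) (hp : ∀ i, path i s = path i t)
    (ho : s.outColour S = t.outColour S) : s = t := by
  induction s generalizing t with
  | leaf c i =>
    cases t with
    | leaf c' j =>
      have := (hl i).mp (by simp [labels_leaf])
      rw [labels_leaf, List.mem_singleton] at this
      subst this
      simp only [outColour] at ho
      rw [ho]
    | node g a b =>
      have h1 := hp (minLabel a)
      simp [path, minLabel_mem] at h1
  | node g a b ha hb =>
    cases t with
    | leaf c i =>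
      have h1 := hp (minLabel a)
      simp [path, minLabel_mem] at h1
    | node g' a' b' =>
      obtain ⟨n1, n2, n3⟩ := labels_node_nodup.mp ns
      obtain ⟨m1, m2, m3⟩ := labels_node_nodup.mp nt
      obtain ⟨s1, s2, s3, s4⟩ := hs
      obtain ⟨t1, t2, t3, t4⟩ := ht
      simp only [labels_node, List.mem_append] at hl
      have hg : g = g' := by
        have h1 := hp (minLabel a)
        have h2 := (hl (minLabel a)).mp (Or.inl (minLabel_mem a))
        by_cases h3 : a.minLabel ∈ a'.labels
        · simp [path, minLabel_mem, h3] at h1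
          exact h1.1
        · simp [path, minLabel_mem, h3, h2.resolve_left h3] at h1
      subst hg
      -- The Boolean in the first letter of a path tells on which side of the root the leaf lies, so
      -- equal paths force the same partition of the labels.
      have hla : ∀ i, i ∈ a.labels ↔ i ∈ a'.labels := by
        intro i
        have h1 := hp i
        have h2 := hl i
        by_cases h3 : i ∈ a.labels <;> by_cases h4 : i ∈ a'.labels
        · simp [h3, h4]
        · have h5 : i ∈ b'.labels := (h2.mp (Or.inl h3)).resolve_left h4
          simp [path, h3, h4, h5] at h1
        · have h5 : i ∈ b.labels := (h2.mpr (Or.inl h4)).resolve_left h3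
          simp [path, h3, h4, h5] at h1
        · simp [h3, h4]
      have hlb : ∀ i, i ∈ b.labels ↔ i ∈ b'.labels := by
        intro i
        have h2 := hl i
        have h3 := hla i
        have h4 := n3 i
        have h5 := m3 i
        tauto
      congr 1
      · refine ha s3 t3 n1 m1 hla (fun i => ?_) (s1.trans t1.symm)
        by_cases h : i ∈ a.labels
        · have h1 := hp i
          have h' := (hla i).mp h
          simpa [path, h, h'] using h1
        · rw [path_of_notMem h, path_of_notMem (fun h' => h ((hla i).mpr h'))]
      · refine hb s4 t4 n2 m2 hlb (fun i => ?_) (s2.trans t2.symm)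
        by_cases h : i ∈ b.labels
        · have h1 := hp i
          have h' := (hlb i).mp h
          have h2 : i ∉ a.labels := fun h2 => n3 i h2 h
          have h3 : i ∉ a'.labels := fun h2 => m3 i h2 h'
          simpa [path, h, h', h2, h3] using h1
        · rw [path_of_notMem h, path_of_notMem (fun h' => h ((hlb i).mpr h'))]

/-- The sum of the weights of all vertices. -/
def weight (w : O → ℕ) : Tree I O → ℕ
  | leaf _ _ => 0
  | node g s t => w g + s.weight w + t.weight w

theorem weight_relabel (w : O → ℕ) (f : ℕ → ℕ) (t : Tree I O) :
    (t.relabel f).weight w = t.weight w := by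
  induction t with
  | leaf c i => rfl
  | node g s t hs ht => simp [relabel, weight, hs, ht]

theorem weight_graft (w : O → ℕ) {i : ℕ} (u t : Tree I O) :
    (graft i u t).weight w = t.weight w + t.labels.count i * u.weight w := by
  induction t with
  | leaf c j =>
    by_cases hj : j = i
    · simp [graft, hj, weight, labels_leaf]
    · simp [graft, hj, weight, labels_leaf]
  | node g s t hs ht =>
    simp only [graft, weight, hs, ht, labels_node, List.count_append]
    ring

end Tree

/-! ### Paths in shuffle compositions -/

section Compositions

variable {I O : Type} {S : Signature I O}

theorem IsMonomial_labels_set {t : Tree I O} (h : t.IsMonomial S) :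
    {i | i ∈ t.labels} = Set.Icc 1 t.arity := by
  ext i; rw [Set.mem_ofPred_eq, h.mem_labels]

namespace ShuffleDatum

variable {n m : ℕ} (ω : ShuffleDatum n m)

theorem inner_ge {j : ℕ} (hj : j ∈ Set.Icc 1 m) : ω.outer ω.pos ≤ ω.inner j := by
  rw [ω.glue]
  exact ω.inner_mono.monotoneOn ⟨le_rfl, hj.1.trans hj.2⟩ hj hj.1

/-- The images of the two relabellings overlap only in the grafting edge. -/
theorem outer_eq_inner (hm : 1 ≤ m) {i j : ℕ} (hi : i ∈ Set.Icc 1 n) (hj : j ∈ Set.Icc 1 m)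
    (h : ω.outer i = ω.inner j) : i = ω.pos := by
  classical
  have cA : ((Finset.Icc 1 n).image ω.outer).card = n := by
    rw [Finset.card_image_of_injOn (by simpa using ω.outer_mono.injOn)]; simp
  have cB : ((Finset.Icc 1 m).image ω.inner).card = m := by
    rw [Finset.card_image_of_injOn (by simpa using ω.inner_mono.injOn)]; simp
  have cU : ((Finset.Icc 1 n).image ω.outer ∪ (Finset.Icc 1 m).image ω.inner).card
      = n + m - 1 := by
    have : (Finset.Icc 1 n).image ω.outer ∪ (Finset.Icc 1 m).image ω.inner
        = Finset.Icc 1 (n + m - 1) := by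
      apply Finset.coe_injective
      push_cast
      exact ω.cover
    rw [this]; simp
  have cI := Finset.card_union_add_card_inter
    ((Finset.Icc 1 n).image ω.outer) ((Finset.Icc 1 m).image ω.inner)
  rw [cA, cB, cU] at cI
  have h1 : ((Finset.Icc 1 n).image ω.outer ∩ (Finset.Icc 1 m).image ω.inner).card ≤ 1 := by
    omega
  have hp := ω.pos_mem
  have m1 : ω.outer i ∈ (Finset.Icc 1 n).image ω.outer ∩ (Finset.Icc 1 m).image ω.inner := by
    rw [Finset.mem_inter]
    refine ⟨Finset.mem_image_of_mem _ (by simpa using hi), ?_⟩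
    rw [h]; exact Finset.mem_image_of_mem _ (by simpa using hj)
  have m2 : ω.outer ω.pos ∈
      (Finset.Icc 1 n).image ω.outer ∩ (Finset.Icc 1 m).image ω.inner := by
    rw [Finset.mem_inter]
    refine ⟨Finset.mem_image_of_mem _ (by simpa using hp), ?_⟩
    rw [ω.glue]; exact Finset.mem_image_of_mem _ (by simpa using hm)
  exact ω.outer_mono.injOn hi hp (Finset.card_le_one.mp h1 _ m1 _ m2)

end ShuffleDatum

variable {n m : ℕ} {ω : ShuffleDatum n m} {s t : Monomial S}

theorem Composable.pos_mem (h : Composable ω s t) : ω.pos ∈ s.1.labels :=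
  List.mem_map_of_mem (f := Prod.snd) h.2.2

theorem Composable.one_le (h : Composable ω s t) : 1 ≤ m := by
  rw [← h.2.1]; exact Tree.arity_pos _

theorem Composable.outer_injOn (h : Composable ω s t) :
    Set.InjOn ω.outer {i | i ∈ s.1.labels} := by
  rw [IsMonomial_labels_set s.2, h.1]; exact ω.outer_mono.injOn

theorem Composable.inner_injOn (h : Composable ω s t) :
    Set.InjOn ω.inner {i | i ∈ t.1.labels} := by
  rw [IsMonomial_labels_set t.2, h.2.1]; exact ω.inner_mono.injOn

theorem Composable.mem_left (h : Composable ω s t) {i : ℕ} :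
    i ∈ s.1.labels ↔ i ∈ Set.Icc 1 n := by rw [s.2.mem_labels, h.1]

theorem Composable.mem_right (h : Composable ω s t) {i : ℕ} :
    i ∈ t.1.labels ↔ i ∈ Set.Icc 1 m := by rw [t.2.mem_labels, h.2.1]

theorem Composable.nodup_relabel (h : Composable ω s t) :
    (s.1.relabel ω.outer).labels.Nodup := by
  rw [Tree.labels_relabel]
  exact List.Nodup.map_on (fun x hx y hy => h.outer_injOn hx hy) s.2.nodup

theorem path_comp_outer (h : Composable ω s t) {i : ℕ} (hi : i ∈ Set.Icc 1 n) (hp : i ≠ ω.pos) :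
    Tree.path (ω.outer i) (compTree ω s.1 t.1) = Tree.path i s.1 := by
  rw [compTree, Tree.path_graft_outer, Tree.path_relabel h.outer_injOn (h.mem_left.mpr hi)]
  · exact fun he => hp (ω.outer_mono.injOn hi ω.pos_mem he)
  · rw [Tree.labels_relabel, List.mem_map]
    rintro ⟨j, hj, hji⟩
    exact hp (ω.outer_eq_inner h.one_le hi (h.mem_right.mp hj) hji.symm)

theorem path_comp_inner (h : Composable ω s t) {j : ℕ} (hj : j ∈ Set.Icc 1 m) :
    Tree.path (ω.inner j) (compTree ω s.1 t.1) = Tree.path ω.pos s.1 ++ Tree.path j t.1 := by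
  have hj' := h.mem_right.mpr hj
  rw [compTree, Tree.path_graft_inner h.nodup_relabel,
    Tree.path_relabel h.outer_injOn h.pos_mem, Tree.path_relabel h.inner_injOn hj']
  · rw [Tree.labels_relabel]; exact List.mem_map_of_mem h.pos_mem
  · intro k hk hk'
    rw [Tree.labels_relabel, List.mem_map] at hk hk'
    obtain ⟨a, ha, rfl⟩ := hk
    obtain ⟨b, hb, hba⟩ := hk'
    rw [ω.outer_eq_inner h.one_le (h.mem_left.mp ha) (h.mem_right.mp hb) hba.symm]
  · rw [Tree.labels_relabel]; exact List.mem_map_of_mem hj'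

theorem arity_comp (h : Composable ω s t) : (compTree ω s.1 t.1).arity + 1 = n + m := by
  have := Tree.arity_graft_add (ω.outer ω.pos) (t.1.relabel ω.inner) (s.1.relabel ω.outer)
  rw [List.count_eq_one_of_mem h.nodup_relabel
    (by rw [Tree.labels_relabel]; exact List.mem_map_of_mem h.pos_mem),
    Tree.arity_relabel, Tree.arity_relabel, h.1, h.2.1, one_mul] at this
  exact this

theorem weight_comp (w : O → ℕ) (h : Composable ω s t) :
    (compTree ω s.1 t.1).weight w = s.1.weight w + t.1.weight w := by
  rw [compTree, Tree.weight_graft, Tree.weight_relabel, Tree.weight_relabel,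
    List.count_eq_one_of_mem h.nodup_relabel
    (by rw [Tree.labels_relabel]; exact List.mem_map_of_mem h.pos_mem), one_mul]

theorem outColour_comp (h : Composable ω s t) :
    (compTree ω s.1 t.1).outColour S = s.1.outColour S := by
  rw [compTree, Tree.outColour_graft, Tree.outColour_relabel]
  intro c hc
  rw [Tree.outColour_relabel]
  rw [Tree.leaves_relabel, List.mem_map] at hc
  obtain ⟨⟨c', j⟩, hj, hjc⟩ := hc
  simp only [Prod.mk.injEq] at hjc
  obtain ⟨rfl, hjc⟩ := hjc
  have hjs : j ∈ s.1.labels := List.mem_map_of_mem (f := Prod.snd) hj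
  have : j = ω.pos := h.outer_injOn hjs h.pos_mem hjc
  subst this
  exact congrArg Prod.fst (List.inj_on_of_nodup_map s.2.nodup hj h.2.2 rfl)

end Compositions

/-! ### An admissible ordering -/

/-- The contribution of a vertex to the weight of a path. -/
def ShOp.pathWeight : ShOp → ℤ
  -- A negative weight makes deep products small, so `α(1,α(2,3))` and `α(α(1,3),2)` beat
  -- `α(α(1,2),3)`; a positive one makes `β(β(1,2),3)` win at leaf 2. Having `α` below `e`, and `n`
  -- negative, makes `e(1,α(2,3))` and `β(1,m(2,3))` win at leaf 1.
  | .alpha => -1 | .beta => 1 | .d => 1 | .e => 0 | .m => 0 | .n => -1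

/-- The contribution of a vertex to the weight of a tree. -/
def ShOp.treeWeight : ShOp → ℕ
  -- This weight alone settles the module axiom, the action of a bracket and the relation for
  -- `d(1,m(2,3))`. Associativity, Jacobi and Leibniz are homogeneous for it, and in the last
  -- Lie–Rinehart relation the two terms with a bracket tie.
  | .alpha => 0 | .beta => 1 | .d => 0 | .e => 0 | .m => 1 | .n => 1

/-- A numbering of the letters of paths, compatible with the names of the operations. -/
def letterIndex : ShOp × Bool → ℕ
  -- The numbering matters only for ties: `d` above `α` selects `d(α(1,2),3)` over `α(d(1,3),2)`,
  -- and `β` above `n` selects `β(n(1,2),3)` over `n(β(1,3),2)`.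
  | (.alpha, false) => 0 | (.alpha, true) => 1 | (.m, false) => 2 | (.m, true) => 3
  | (.n, false) => 4 | (.n, true) => 5 | (.beta, false) => 6 | (.beta, true) => 7
  | (.d, false) => 8 | (.d, true) => 9 | (.e, false) => 10 | (.e, true) => 11

theorem letterIndex_injective : Function.Injective letterIndex := by
  rintro ⟨g, b⟩ ⟨g', b'⟩
  cases g <;> cases b <;> cases g' <;> cases b' <;> simp [letterIndex]

theorem letterIndex_lt (x : ShOp × Bool) : letterIndex x < 12 := by
  obtain ⟨g, b⟩ := x
  cases g <;> cases b <;> simp [letterIndex]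

/-- The total weight of a path. -/
def wordWeight (u : List (ShOp × Bool)) : ℤ := (u.map fun x => x.1.pathWeight).sum

/-- The number whose digits in base 12 are the letters of a path. -/
def wordNumber (u : List (ShOp × Bool)) : ℕ := Nat.ofDigits 12 (u.reverse.map letterIndex)

/-- Paths are compared by weight, then by length, then lexicographically. -/
def wordKey (u : List (ShOp × Bool)) : ℤ ×ₗ ℕ ×ₗ ℕ :=
  toLex (wordWeight u, toLex (u.length, wordNumber u))

theorem wordKey_injective : Function.Injective wordKey := by
  intro u v h
  simp only [wordKey, EmbeddingLike.apply_eq_iff_eq, Prod.mk.injEq] at h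
  obtain ⟨-, h1, h2⟩ := h
  -- The letter numbered 0 could hide as a leading zero; comparing lengths first rules this out.
  have h3 := Nat.ofDigits_inj_of_len_eq (b := 12) (by norm_num)
    (L1 := u.reverse.map letterIndex) (L2 := v.reverse.map letterIndex) (by simp [h1])
    (by intro l hl; rw [List.mem_map] at hl; obtain ⟨x, -, rfl⟩ := hl; exact letterIndex_lt x)
    (by intro l hl; rw [List.mem_map] at hl; obtain ⟨x, -, rfl⟩ := hl; exact letterIndex_lt x) h2
  exact List.reverse_injective (letterIndex_injective.list_map h3)

theorem wordNumber_append (u v : List (ShOp × Bool)) :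
    wordNumber (u ++ v) = wordNumber v + 12 ^ v.length * wordNumber u := by
  simp [wordNumber, Nat.ofDigits_append]

/-- Weight and length are additive, and the number is compared only when both tie. In that case the
two right factors have equal length, so both left numbers are shifted by the same power of 12.
Strictness is what later allows equality of composites to be traced back to the factors. -/
theorem wordKey_append_lt {u u' v v' : List (ShOp × Bool)} (hu : wordKey u ≤ wordKey u')
    (hv : wordKey v ≤ wordKey v') (h : wordKey u < wordKey u' ∨ wordKey v < wordKey v') :
    wordKey (u ++ v) < wordKey (u' ++ v') := by
  have e : ∀ a b : List (ShOp × Bool), wordWeight (a ++ b) = wordWeight a + wordWeight b := by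
    intro a b; simp [wordWeight]
  simp only [wordKey, Prod.Lex.lt_iff, Prod.Lex.le_iff, ofLex_toLex, e, List.length_append,
    wordNumber_append] at *
  have key : v.length = v'.length → wordNumber u ≤ wordNumber u' →
      12 ^ v.length * wordNumber u ≤ 12 ^ v'.length * wordNumber u' := by
    intro h1 h2; rw [h1]; gcongr
  have key' : v.length = v'.length → wordNumber u < wordNumber u' →
      12 ^ v.length * wordNumber u < 12 ^ v'.length * wordNumber u' := by
    intro h1 h2; rw [h1]; gcongr
  generalize 12 ^ v.length * wordNumber u = A at *
  generalize 12 ^ v'.length * wordNumber u' = B at *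
  rcases lt_trichotomy (wordWeight u) (wordWeight u') with h1 | h1 | h1 <;>
  rcases lt_trichotomy (wordWeight v) (wordWeight v') with h2 | h2 | h2 <;>
  first
  | (left; omega)
  | skip
  right
  refine ⟨by omega, ?_⟩
  rcases lt_trichotomy u.length u'.length with h3 | h3 | h3 <;>
  rcases lt_trichotomy v.length v'.length with h4 | h4 | h4 <;>
  first
  | (left; omega)
  | skip
  right
  refine ⟨by omega, ?_⟩
  rcases lt_trichotomy (wordNumber u) (wordNumber u') with h5 | h5 | h5
  · have := key' h4 h5
    omega
  · have := key h4 h5.le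
    omega
  · omega

theorem wordKey_append_le {u u' v v' : List (ShOp × Bool)} (hu : wordKey u ≤ wordKey u')
    (hv : wordKey v ≤ wordKey v') : wordKey (u ++ v) ≤ wordKey (u' ++ v') := by
  by_cases h : wordKey u < wordKey u' ∨ wordKey v < wordKey v'
  · exact (wordKey_append_lt hu hv h).le
  · push Not at h
    rw [wordKey_injective (hu.antisymm h.1), wordKey_injective (hv.antisymm h.2)]

/-- The sequence of the paths to the leaves, compared lexicographically. -/
def pathKey {I : Type} (t : Tree I ShOp) : Lex (ℕ → ℤ ×ₗ ℕ ×ₗ ℕ) :=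
  toLex fun i => wordKey (t.path i)

theorem pathKey_lt_iff {I : Type} {s t : Tree I ShOp} :
    pathKey s < pathKey t ↔ ∃ i, (∀ j < i, s.path j = t.path j) ∧
      wordKey (s.path i) < wordKey (t.path i) := by
  constructor
  · rintro ⟨i, h1, h2⟩
    exact ⟨i, fun j hj => wordKey_injective (h1 j hj), h2⟩
  · rintro ⟨i, h1, h2⟩
    exact ⟨i, fun j hj => congrArg wordKey (h1 j hj), h2⟩

theorem pathKey_le_apply {I : Type} {s t : Tree I ShOp} (h : pathKey s ≤ pathKey t) {i : ℕ}
    (hi : ∀ j < i, s.path j = t.path j) : wordKey (s.path i) ≤ wordKey (t.path i) := by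
  rcases h.lt_or_eq with h | h
  · obtain ⟨k, h1, h2⟩ := pathKey_lt_iff.mp h
    rcases lt_trichotomy i k with h3 | h3 | h3
    · rw [h1 i h3]
    · rw [h3]; exact h2.le
    · rw [hi k h3] at h2
      exact absurd h2 (lt_irrefl _)
  · exact (congrFun (congrArg ofLex h) i).le

theorem pathKey_eq_iff {I : Type} {s t : Tree I ShOp} :
    pathKey s = pathKey t ↔ ∀ i, s.path i = t.path i := by
  constructor
  · intro h i
    exact wordKey_injective (congrFun (congrArg ofLex h) i)
  · intro h
    simp [pathKey, h]

/-! ### Compatibility of path sequences with shuffle compositions -/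

section PathOrder

variable {I : Type} {S : Signature I ShOp} {n m : ℕ} {ω : ShuffleDatum n m}
  {s s' t t' : Monomial S}

theorem path_zero (t : Monomial S) : t.1.path 0 = [] :=
  Tree.path_of_notMem fun h => by simpa using (t.2.mem_labels.mp h).1

/-- The grafting label carries the concatenation of the path to the input `pos` and the path to leaf
1 of the upper tree. Both factors are weakly ordered, so if the concatenations agree, strict
compatibility forces both factors to agree. -/
theorem path_pos_of_agree (h : Composable ω s t) (h' : Composable ω s' t')
    (hs : pathKey s.1 ≤ pathKey s'.1) (ht : pathKey t.1 ≤ pathKey t'.1) {k : ℕ}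
    (hk : ω.outer ω.pos < k) (ha : ∀ j < k, (compTree ω s.1 t.1).path j =
      (compTree ω s'.1 t'.1).path j) :
    s.1.path ω.pos = s'.1.path ω.pos ∧ t.1.path 1 = t'.1.path 1 := by
  have hm := h.one_le
  have hp : wordKey (s.1.path ω.pos) ≤ wordKey (s'.1.path ω.pos) := by
    refine pathKey_le_apply hs fun j hj => ?_
    rcases Nat.eq_zero_or_pos j with rfl | hj0
    · rw [path_zero, path_zero]
    · have hjn : j ∈ Set.Icc 1 n := ⟨hj0, hj.le.trans ω.pos_mem.2⟩
      have := ha _ ((ω.outer_mono hjn ω.pos_mem hj).trans hk)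
      rwa [path_comp_outer h hjn hj.ne, path_comp_outer h' hjn hj.ne] at this
  have h1 : wordKey (t.1.path 1) ≤ wordKey (t'.1.path 1) := by
    refine pathKey_le_apply ht fun j hj => ?_
    rw [Nat.lt_one_iff.mp hj, path_zero, path_zero]
  have h2 := ha _ hk
  rw [ω.glue, path_comp_inner h ⟨le_rfl, hm⟩, path_comp_inner h' ⟨le_rfl, hm⟩] at h2
  by_contra hne
  have : wordKey (s.1.path ω.pos) < wordKey (s'.1.path ω.pos) ∨
      wordKey (t.1.path 1) < wordKey (t'.1.path 1) := by
    by_contra hc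
    push Not at hc
    exact hne ⟨wordKey_injective (hp.antisymm hc.1), wordKey_injective (h1.antisymm hc.2)⟩
  have := wordKey_append_lt hp h1 this
  rw [h2] at this
  exact lt_irrefl _ this

theorem path_outer_of_agree (h : Composable ω s t) (h' : Composable ω s' t')
    (hs : pathKey s.1 ≤ pathKey s'.1) (ht : pathKey t.1 ≤ pathKey t'.1) {k : ℕ}
    (ha : ∀ j < k, (compTree ω s.1 t.1).path j = (compTree ω s'.1 t'.1).path j) {i : ℕ}
    (hi : i ≤ n) (hik : ω.outer i < k) : s.1.path i = s'.1.path i := by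
  rcases Nat.eq_zero_or_pos i with rfl | hi0
  · rw [path_zero, path_zero]
  by_cases hip : i = ω.pos
  · subst hip
    exact (path_pos_of_agree h h' hs ht hik ha).1
  · have := ha _ hik
    rwa [path_comp_outer h ⟨hi0, hi⟩ hip, path_comp_outer h' ⟨hi0, hi⟩ hip] at this

theorem path_inner_of_agree (h : Composable ω s t) (h' : Composable ω s' t')
    (hs : pathKey s.1 ≤ pathKey s'.1) (ht : pathKey t.1 ≤ pathKey t'.1) {k : ℕ}
    (ha : ∀ j < k, (compTree ω s.1 t.1).path j = (compTree ω s'.1 t'.1).path j) {i : ℕ}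
    (hi : i ∈ Set.Icc 1 m) (hik : ω.inner i < k) : t.1.path i = t'.1.path i := by
  have hp := (path_pos_of_agree h h' hs ht ((ω.inner_ge hi).trans_lt hik) ha).1
  have := ha _ hik
  rw [path_comp_inner h hi, path_comp_inner h' hi, hp] at this
  exact List.append_cancel_left this

theorem outer_lt {i k : ℕ} (hk : k ∈ Set.Icc 1 n) (hi : i < k) (hi0 : 0 < i) :
    ω.outer i < ω.outer k :=
  ω.outer_mono ⟨hi0, hi.le.trans hk.2⟩ hk hi

/-- At the first label where the composites differ, all earlier labels have already forced the
corresponding paths of the factors to agree. The lexicographic hypotheses therefore apply to the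
paths at this very label, and concatenation preserves their order. The equality case also returns
equality of both factors, so that a further criterion may break ties. -/
theorem pathKey_comp (h : Composable ω s t) (h' : Composable ω s' t')
    (hs : pathKey s.1 ≤ pathKey s'.1) (ht : pathKey t.1 ≤ pathKey t'.1) :
    pathKey (compTree ω s.1 t.1) < pathKey (compTree ω s'.1 t'.1) ∨
      (pathKey (compTree ω s.1 t.1) = pathKey (compTree ω s'.1 t'.1) ∧
        pathKey s.1 = pathKey s'.1 ∧ pathKey t.1 = pathKey t'.1) := by
  classical
  have hm := h.one_le
  by_cases hall : ∀ i, (compTree ω s.1 t.1).path i = (compTree ω s'.1 t'.1).path i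
  · refine Or.inr ⟨pathKey_eq_iff.mpr hall, pathKey_eq_iff.mpr fun i => ?_,
      pathKey_eq_iff.mpr fun i => ?_⟩
    · by_cases hi : i ≤ n
      · exact path_outer_of_agree h h' hs ht (fun j _ => hall j) hi (Nat.lt_succ_self _)
      · rw [Tree.path_of_notMem fun hh => hi (h.mem_left.mp hh).2,
          Tree.path_of_notMem fun hh => hi (h'.mem_left.mp hh).2]
    · by_cases hi : i ∈ Set.Icc 1 m
      · exact path_inner_of_agree h h' hs ht (fun j _ => hall j) hi (Nat.lt_succ_self _)
      · rw [Tree.path_of_notMem fun hh => hi (h.mem_right.mp hh),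
          Tree.path_of_notMem fun hh => hi (h'.mem_right.mp hh)]
  · left
    push Not at hall
    have hk := Nat.find_spec hall
    have ha : ∀ j < Nat.find hall, (compTree ω s.1 t.1).path j = (compTree ω s'.1 t'.1).path j :=
      fun j hj => not_not.mp (Nat.find_min hall hj)
    generalize Nat.find hall = k at hk ha
    refine pathKey_lt_iff.mpr ⟨k, ha, lt_of_le_of_ne ?_ fun he => hk (wordKey_injective he)⟩
    -- Outside the set of labels both paths are empty, so a difference can occur only at a label.
    have hkN : k ∈ Set.Icc 1 (n + m - 1) := by
      by_contra hkN
      apply hk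
      have a1 := arity_comp h
      have a2 := arity_comp h'
      rw [Tree.path_of_notMem, Tree.path_of_notMem]
      · intro hh
        have := (isMonomial_compTree ω s' t' h').mem_labels.mp hh
        rw [show (compTree ω s'.1 t'.1).arity = n + m - 1 by omega] at this
        exact hkN this
      · intro hh
        have := (isMonomial_compTree ω s t h).mem_labels.mp hh
        rw [show (compTree ω s.1 t.1).arity = n + m - 1 by omega] at this
        exact hkN this
    have sle : ∀ i ∈ Set.Icc 1 n, ω.outer i ≤ k →
        wordKey (s.1.path i) ≤ wordKey (s'.1.path i) := by
      intro i hi hik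
      refine pathKey_le_apply hs fun j hj => ?_
      rcases Nat.eq_zero_or_pos j with rfl | hj0
      · rw [path_zero, path_zero]
      · exact path_outer_of_agree h h' hs ht ha (hj.le.trans hi.2)
          ((outer_lt hi hj hj0).trans_le hik)
    rw [← ω.cover] at hkN
    -- The grafting label lies in both images and is treated as an inner one; in the remaining case
    -- the outer label differs from `pos`.
    by_cases hin : k ∈ ω.inner '' Set.Icc 1 m
    · obtain ⟨i, hi, rfl⟩ := hin
      rw [path_comp_inner h hi, path_comp_inner h' hi]
      refine wordKey_append_le (sle _ ω.pos_mem (ω.inner_ge hi)) ?_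
      refine pathKey_le_apply ht fun j hj => ?_
      rcases Nat.eq_zero_or_pos j with rfl | hj0
      · rw [path_zero, path_zero]
      · have hjm : j ∈ Set.Icc 1 m := ⟨hj0, hj.le.trans hi.2⟩
        exact path_inner_of_agree h h' hs ht ha hjm (ω.inner_mono hjm hi hj)
    · obtain ⟨i, hi, rfl⟩ := hkN.resolve_right hin
      have hip : i ≠ ω.pos := by
        rintro rfl
        exact hin ⟨1, ⟨le_rfl, hm⟩, ω.glue.symm⟩
      rw [path_comp_outer h hi hip, path_comp_outer h' hi hip]
      exact sle i hi le_rfl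

end PathOrder

/-- The colour `c` is smaller than the colour `l`. -/
def Colour.rank : Colour → ℕ
  | .c => 0 | .l => 1

theorem Colour.rank_injective : Function.Injective Colour.rank := by
  intro a b; cases a <;> cases b <;> simp [Colour.rank]

/-- The key by which tree monomials are compared. -/
def monomialKey (t : Monomial shSig) : ℕ ×ₗ ℕ ×ₗ Lex (ℕ → ℤ ×ₗ ℕ ×ₗ ℕ) ×ₗ ℕ :=
  toLex (t.1.arity, toLex (t.1.weight ShOp.treeWeight,
    toLex (pathKey t.1, (t.1.outColour shSig).rank)))

/-- The ordering of tree monomials by arity, tree weight, path sequence and output colour. -/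
def pathOrder (s t : Monomial shSig) : Prop := monomialKey s ≤ monomialKey t

/-- The output colour is needed only for the trees without vertices: the identities of the two
colours have the same empty paths. -/
theorem monomialKey_injective : Function.Injective monomialKey := by
  intro s t h
  simp only [monomialKey, EmbeddingLike.apply_eq_iff_eq, Prod.mk.injEq] at h
  obtain ⟨h1, -, h2, h3⟩ := h
  refine Subtype.ext (Tree.eq_of_path_eq s.2.wellColoured t.2.wellColoured s.2.nodup t.2.nodup
    (fun i => ?_) (pathKey_eq_iff.mp h2) (Colour.rank_injective h3))
  rw [s.2.mem_labels, t.2.mem_labels, h1]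

theorem isAdmissible_pathOrder : IsAdmissible pathOrder where
  refl s := le_refl _
  trans s t u h1 h2 := le_trans (α := ℕ ×ₗ ℕ ×ₗ Lex (ℕ → ℤ ×ₗ ℕ ×ₗ ℕ) ×ₗ ℕ) h1 h2
  antisymm s t h1 h2 := monomialKey_injective (le_antisymm h1 h2)
  total s t := le_total _ _
  arity s t h := Prod.Lex.le_iff.mpr (Or.inl h)
  comp n m ω s s' t t' h h' hs ht := by
    have a1 := arity_comp h
    have a2 := arity_comp h'
    simp only [pathOrder, monomialKey, Prod.Lex.le_iff, ofLex_toLex, Monomial.comp] at hs ht ⊢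
    rw [h.1, h'.1] at hs
    rw [h.2.1, h'.2.1] at ht
    replace hs := (hs.resolve_left (lt_irrefl _)).2
    replace ht := (ht.resolve_left (lt_irrefl _)).2
    refine Or.inr ⟨by omega, ?_⟩
    rw [weight_comp _ h, weight_comp _ h', outColour_comp h, outColour_comp h']
    -- Tree weights add under composition, so one strict inequality already decides; otherwise the
    -- path sequences are compared.
    by_cases hw : s.1.weight ShOp.treeWeight = s'.1.weight ShOp.treeWeight ∧
        t.1.weight ShOp.treeWeight = t'.1.weight ShOp.treeWeight
    · replace hs := (hs.resolve_left (by omega)).2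
      replace ht := (ht.resolve_left (by omega)).2
      refine Or.inr ⟨by omega, ?_⟩
      have ls : pathKey s.1 ≤ pathKey s'.1 := hs.elim le_of_lt fun h => h.1.le
      have lt : pathKey t.1 ≤ pathKey t'.1 := ht.elim le_of_lt fun h => h.1.le
      -- If the composites tie, the lower trees tie as well. The output colour of a composite is
      -- that of its lower tree, so the last criterion is inherited.
      rcases pathKey_comp h h' ls lt with hc | ⟨hc, hc1, -⟩
      · exact Or.inl hc
      · refine Or.inr ⟨hc, ?_⟩
        rcases hs with hs | hs
        · rw [hc1] at hs; exact absurd hs (lt_irrefl _)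
        · exact hs.2
    · left
      have hs' := hs.imp id And.left
      have ht' := ht.imp id And.left
      omega

/-! ### The defining relations -/

namespace Tree

variable {I O : Type}

instance decidableWellColoured [DecidableEq I] (S : Signature I O) :
    DecidablePred (WellColoured S : Tree I O → Prop)
  | leaf _ _ => isTrue trivial
  | node _ s t =>
    have := decidableWellColoured S s
    have := decidableWellColoured S t
    inferInstanceAs (Decidable (_ ∧ _ ∧ _ ∧ _))

instance decidableIsShuffle : DecidablePred (IsShuffle : Tree I O → Prop)
  | leaf _ _ => isTrue trivial
  | node _ s t =>
    have := decidableIsShuffle s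
    have := decidableIsShuffle t
    inferInstanceAs (Decidable (_ ∧ _ ∧ _))

theorem isMonomial_iff {S : Signature I O} {t : Tree I O} : t.IsMonomial S ↔
    t.WellColoured S ∧ t.IsShuffle ∧ t.labels.Perm (List.range' 1 t.arity) :=
  ⟨fun h => ⟨h.1, h.2, h.3⟩, fun h => ⟨h.1, h.2.1, h.2.2⟩⟩

instance decidableIsMonomial [DecidableEq I] (S : Signature I O) :
    DecidablePred (IsMonomial S : Tree I O → Prop) :=
  fun _ => decidable_of_iff _ isMonomial_iff.symm

end Tree

/-! ### Linear combinations given by lists and their leading terms -/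

section LinComb

variable {I O : Type} {S : Signature I O} (𝕜 : Type*) [Field 𝕜]

/-- The tree monomial with the underlying tree `t`. -/
def Monomial.of (t : Tree I O) (h : t.IsMonomial S) : Monomial S := ⟨t, h⟩

@[simp]
theorem Monomial.val_of (t : Tree I O) (h : t.IsMonomial S) : (Monomial.of t h).1 = t := rfl

/-- The linear combination of tree monomials given by a list of coefficients and trees. -/
noncomputable def linComb (S : Signature I O) (l : List (ℤ × Tree I O)) : Free 𝕜 S :=
  (l.map fun p => ((p.1 : ℤ) : 𝕜) • ofTree 𝕜 p.2).sum

variable {𝕜}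

theorem ofTree_of_isMonomial {t : Tree I O} (h : t.IsMonomial S) :
    (ofTree 𝕜 t : Free 𝕜 S) = Finsupp.single (Monomial.of t h) 1 := by
  simp [ofTree, h, Monomial.of]

theorem linComb_apply_of_notMem {l : List (ℤ × Tree I O)} (hm : ∀ p ∈ l, p.2.IsMonomial S)
    {u : Monomial S} (h : u.1 ∉ l.map Prod.snd) : linComb 𝕜 S l u = 0 := by
  induction l with
  | nil => rfl
  | cons p l ih =>
    simp only [List.map_cons, List.mem_cons, not_or] at h
    have h1 : Monomial.of p.2 (hm p (by simp)) ≠ u := fun he => h.1 (congrArg Subtype.val he).symm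
    have h2 := ih (fun q hq => hm q (by simp [hq])) h.2
    rw [linComb] at h2 ⊢
    rw [List.map_cons, List.sum_cons, Finsupp.add_apply, h2,
      ofTree_of_isMonomial (hm p (by simp)), Finsupp.smul_apply, Finsupp.single_eq_of_ne h1.symm]
    simp

theorem mem_of_mem_support_linComb {l : List (ℤ × Tree I O)} (hm : ∀ p ∈ l, p.2.IsMonomial S)
    {u : Monomial S} (h : u ∈ (linComb 𝕜 S l).support) : u.1 ∈ l.map Prod.snd := by
  by_contra hu
  exact Finsupp.mem_support_iff.mp h (linComb_apply_of_notMem hm hu)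

theorem linComb_apply {l : List (ℤ × Tree I O)} (hm : ∀ p ∈ l, p.2.IsMonomial S)
    (hn : (l.map Prod.snd).Nodup) {p : ℤ × Tree I O} (hp : p ∈ l) (h : p.2.IsMonomial S) :
    linComb 𝕜 S l (Monomial.of p.2 h) = (p.1 : 𝕜) := by
  induction l with
  | nil => simp at hp
  | cons q l ih =>
    rw [List.map_cons, List.nodup_cons] at hn
    have hm' : ∀ q ∈ l, q.2.IsMonomial S := fun q hq => hm q (by simp [hq])
    have e : linComb 𝕜 S (q :: l) (Monomial.of p.2 h) =
        (q.1 : 𝕜) *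
          (Finsupp.single (Monomial.of q.2 (hm q (by simp))) (1 : 𝕜)) (Monomial.of p.2 h) +
          linComb 𝕜 S l (Monomial.of p.2 h) := by
      rw [linComb, List.map_cons, List.sum_cons, Finsupp.add_apply,
        ofTree_of_isMonomial (hm q (by simp)), Finsupp.smul_apply, smul_eq_mul]
      rfl
    rw [e]
    rcases List.mem_cons.mp hp with rfl | hp'
    · rw [Finsupp.single_eq_same, linComb_apply_of_notMem hm' (by exact hn.1)]
      simp
    · have h1 : Monomial.of q.2 (hm q (by simp)) ≠ Monomial.of p.2 h := by
        intro he
        have : q.2 = p.2 := congrArg Subtype.val he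
        exact hn.1 (this ▸ List.mem_map_of_mem hp')
      rw [Finsupp.single_eq_of_ne h1.symm, ih hm' hn.2 hp']
      simp

/-- The leading term of a linear combination in which one tree dominates all others. -/
theorem isLeadingTerm_linComb {le : Monomial S → Monomial S → Prop} (hle : IsAdmissible le)
    {l : List (ℤ × Tree I O)} (hm : ∀ p ∈ l, p.2.IsMonomial S) (hn : (l.map Prod.snd).Nodup)
    {p : ℤ × Tree I O} (hp : p ∈ l) (hc : (p.1 : 𝕜) ≠ 0)
    (hd : ∀ q (hq : q ∈ l), le (.of q.2 (hm q hq)) (.of p.2 (hm p hp))) {t : Monomial S} :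
    IsLeadingTerm le (linComb 𝕜 S l) t ↔ t.1 = p.2 := by
  have h1 : IsLeadingTerm le (linComb 𝕜 S l) (.of p.2 (hm p hp)) := by
    refine ⟨Finsupp.mem_support_iff.mpr ?_, fun s hs => ?_⟩
    · rw [linComb_apply hm hn hp]; exact hc
    · obtain ⟨q, hq, hqs⟩ := List.mem_map.mp (mem_of_mem_support_linComb hm hs)
      have : s = .of q.2 (hm q hq) := Subtype.ext hqs.symm
      rw [this]; exact hd q hq
  constructor
  · intro h
    exact congrArg Subtype.val (hle.antisymm _ _ (h1.2 t h.1) (h.2 _ h1.1))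
  · intro h
    have : t = .of p.2 (hm p hp) := Subtype.ext h
    rw [this]; exact h1

end LinComb

/-- The terms of the relation that corresponds to `r` after a permutation of the labels. -/
def shuffleTerms (f : ℕ → ℕ) (r : List (ℤ × Tree Colour SymOp)) : List (ℤ × Tree Colour ShOp) :=
  r.map fun p => (p.1 * (planarize (p.2.relabel f)).1, (planarize (p.2.relabel f)).2)

theorem shuffleRelation_eq_linComb (𝕜 : Type*) [Field 𝕜] (σ : Equiv.Perm ℕ)
    (r : List (ℤ × Tree Colour SymOp)) :
    shuffleRelation 𝕜 σ r = linComb 𝕜 shSig (shuffleTerms σ r) := by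
  simp [shuffleRelation, linComb, shuffleTerms, Function.comp_def]

/-- The permutations of the labels `1, 2, 3`. -/
def labelPerms : List (Equiv.Perm ℕ) :=
  [1, Equiv.swap 1 2, Equiv.swap 1 3, Equiv.swap 2 3, Equiv.swap 1 2 * Equiv.swap 2 3,
    Equiv.swap 2 3 * Equiv.swap 1 2]

theorem labelPerms_fix : ∀ σ ∈ labelPerms, ∀ i, i ∉ Set.Icc 1 3 → σ i = i := by
  intro σ hσ i hi
  have h1 : i ≠ 1 := by rintro rfl; exact hi (by simp)
  have h2 : i ≠ 2 := by rintro rfl; exact hi (by simp)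
  have h3 : i ≠ 3 := by rintro rfl; exact hi (by simp)
  simp only [labelPerms, List.mem_cons, List.not_mem_nil, or_false] at hσ
  rcases hσ with rfl | rfl | rfl | rfl | rfl | rfl <;>
    simp [Equiv.swap_apply_of_ne_of_ne, h1, h2, h3]

/-- Such a permutation preserves `{1, 2, 3}` and is determined by its values there; this turns the
orbits of the relations into finite lists that can be checked by evaluation. -/
theorem mem_labelPerms {σ : Equiv.Perm ℕ} (h : ∀ i, i ∉ Set.Icc 1 3 → σ i = i) :
    σ ∈ labelPerms := by
  have hm : ∀ i ∈ Set.Icc 1 3, σ i ∈ Set.Icc 1 3 := by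
    intro i hi
    by_contra hc
    apply hc
    rw [σ.injective (h _ hc)]
    exact hi
  have ext : ∀ τ ∈ labelPerms, σ 1 = τ 1 → σ 2 = τ 2 → σ 3 = τ 3 → σ ∈ labelPerms := by
    intro τ hτ h1 h2 h3
    have : σ = τ := by
      ext i
      by_cases hi : i ∈ Set.Icc 1 3
      · obtain ⟨a, b⟩ := hi
        interval_cases i <;> assumption
      · rw [h i hi, labelPerms_fix τ hτ i hi]
    exact this ▸ hτ
  have i12 : σ 1 ≠ σ 2 := fun h => by simpa using σ.injective h
  have i13 : σ 1 ≠ σ 3 := fun h => by simpa using σ.injective h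
  have i23 : σ 2 ≠ σ 3 := fun h => by simpa using σ.injective h
  obtain ⟨a1, b1⟩ := hm 1 (by simp)
  obtain ⟨a2, b2⟩ := hm 2 (by simp)
  obtain ⟨a3, b3⟩ := hm 3 (by simp)
  have key : ∀ a ∈ [1, 2, 3], ∀ b ∈ [1, 2, 3], ∀ c ∈ [1, 2, 3], a ≠ b → a ≠ c → b ≠ c →
      ∃ τ ∈ labelPerms, a = τ 1 ∧ b = τ 2 ∧ c = τ 3 := by
    decide
  have three : ∀ a, 1 ≤ a → a ≤ 3 → a ∈ [1, 2, 3] := by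
    intro a h1 h2
    interval_cases a <;> simp
  obtain ⟨τ, hτ, h1, h2, h3⟩ :=
    key _ (three _ a1 b1) _ (three _ a2 b2) _ (three _ a3 b3) i12 i13 i23
  exact ext τ hτ h1 h2 h3

theorem mem_shuffleRelations {𝕜 : Type*} [Field 𝕜] {R : List (List (ℤ × Tree Colour SymOp))}
    {x : Free 𝕜 shSig} : x ∈ shuffleRelations 𝕜 R ↔
      ∃ r ∈ R, ∃ σ ∈ labelPerms, x = linComb 𝕜 shSig (shuffleTerms σ r) := by
  constructor
  · rintro ⟨r, hr, σ, hσ, rfl⟩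
    exact ⟨r, hr, σ, mem_labelPerms hσ, shuffleRelation_eq_linComb 𝕜 σ r⟩
  · rintro ⟨r, hr, σ, hσ, rfl⟩
    exact ⟨r, hr, σ, labelPerms_fix σ hσ, (shuffleRelation_eq_linComb 𝕜 σ r).symm⟩

/-- A decidable sufficient condition for the order of two paths. -/
def WordLT (u v : List (ShOp × Bool)) : Prop :=
  wordWeight u < wordWeight v ∨ (wordWeight u = wordWeight v ∧
    (u.length < v.length ∨ (u.length = v.length ∧ wordNumber u < wordNumber v)))

instance (u v : List (ShOp × Bool)) : Decidable (WordLT u v) :=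
  inferInstanceAs (Decidable (_ ∨ _))

/-- A decidable sufficient condition for the order of two tree monomials of arity three. -/
def TreeLT (s t : Tree Colour ShOp) : Prop :=
  s.weight ShOp.treeWeight < t.weight ShOp.treeWeight ∨
    (s.weight ShOp.treeWeight = t.weight ShOp.treeWeight ∧
      (WordLT (s.path 1) (t.path 1) ∨
        (s.path 1 = t.path 1 ∧ WordLT (s.path 2) (t.path 2))))

instance (s t : Tree Colour ShOp) : Decidable (TreeLT s t) :=
  inferInstanceAs (Decidable (_ ∨ _))

/-- The path at 0 is empty for every monomial, and the comparison stops at label 1 or 2, so the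
infinite path sequence is replaced by a decidable test. -/
theorem pathOrder_of_treeLT {s t : Monomial shSig} (ha : s.1.arity = t.1.arity)
    (h : TreeLT s.1 t.1) : pathOrder s t := by
  have hw : ∀ u v, WordLT u v → wordKey u < wordKey v := by
    intro u v h
    simp only [wordKey, Prod.Lex.lt_iff, ofLex_toLex]
    exact h
  refine Prod.Lex.le_iff.mpr (Or.inr ⟨ha, Prod.Lex.le_iff.mpr ?_⟩)
  rcases h with h | ⟨h, h'⟩
  · exact Or.inl h
  · refine Or.inr ⟨h, Prod.Lex.le_iff.mpr (Or.inl (pathKey_lt_iff.mpr ?_))⟩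
    rcases h' with h' | ⟨h1, h'⟩
    · refine ⟨1, fun j hj => ?_, hw _ _ h'⟩
      rw [Nat.lt_one_iff.mp hj, path_zero, path_zero]
    · refine ⟨2, fun j hj => ?_, hw _ _ h'⟩
      interval_cases j
      · rw [path_zero, path_zero]
      · exact h1

/-- Properties of the terms of a relation that do not depend on an ordering. -/
structure IsRelationTerms (l : List (ℤ × Tree Colour ShOp)) : Prop where
  isMonomial : ∀ p ∈ l, p.2.IsMonomial shSig
  coeff : ∀ p ∈ l, p.1 = 1 ∨ p.1 = -1
  vertices : ∀ p ∈ l, p.2.vertices = 2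
  arity : ∀ p ∈ l, p.2.arity = 3
  nodup : (l.map Prod.snd).Nodup
  leaves : ∀ p ∈ l, ∀ q ∈ l, p.2.leaves.Perm q.2.leaves
  outColour : ∀ p ∈ l, ∀ q ∈ l, p.2.outColour shSig = q.2.outColour shSig

theorem isRelationTerms_shuffleTerms : ∀ r ∈ lieRSymRelations, ∀ σ ∈ labelPerms,
    IsRelationTerms (shuffleTerms σ r) := by
  intro r hr σ hσ
  -- A finite verification over seven relations and six permutations.
  constructor <;> revert r σ <;> decide +kernel

theorem exists_dominating_lieR : ∀ r ∈ lieRSymRelations, ∀ σ ∈ labelPerms,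
    ∃ p ∈ shuffleTerms σ r, p.2 ∈ lieRLeadingTrees ∧
      ∀ q ∈ shuffleTerms σ r, q = p ∨ TreeLT q.2 p.2 := by
  decide +kernel

theorem exists_dominating_derCom : ∀ r ∈ derComSymRelations, ∀ σ ∈ labelPerms,
    ∃ p ∈ shuffleTerms σ r, p.2 ∈ derComLeadingTrees ∧
      ∀ q ∈ shuffleTerms σ r, q = p ∨ TreeLT q.2 p.2 := by
  decide +kernel

theorem exists_relation_lieR : ∀ t ∈ lieRLeadingTrees, ∃ r ∈ lieRSymRelations,
    ∃ σ ∈ labelPerms, ∃ p ∈ shuffleTerms σ r, p.2 = t ∧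
      ∀ q ∈ shuffleTerms σ r, q = p ∨ TreeLT q.2 p.2 := by
  decide +kernel

theorem exists_relation_derCom : ∀ t ∈ derComLeadingTrees, ∃ r ∈ derComSymRelations,
    ∃ σ ∈ labelPerms, ∃ p ∈ shuffleTerms σ r, p.2 = t ∧
      ∀ q ∈ shuffleTerms σ r, q = p ∨ TreeLT q.2 p.2 := by
  decide +kernel

theorem isLeadingTerm_shuffleTerms {𝕜 : Type*} [Field 𝕜] {l : List (ℤ × Tree Colour ShOp)}
    (hl : IsRelationTerms l) {p : ℤ × Tree Colour ShOp} (hp : p ∈ l)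
    (hd : ∀ q ∈ l, q = p ∨ TreeLT q.2 p.2) {t : Monomial shSig} :
    IsLeadingTerm pathOrder (linComb 𝕜 shSig l) t ↔ t.1 = p.2 := by
  refine isLeadingTerm_linComb isAdmissible_pathOrder hl.isMonomial hl.nodup hp ?_ fun q hq => ?_
  · rcases hl.coeff p hp with h | h <;> rw [h] <;> simp
  · rcases hd q hq with rfl | h
    · exact isAdmissible_pathOrder.refl _
    · exact pathOrder_of_treeLT ((hl.arity q hq).trans (hl.arity p hp).symm) h

theorem leadingTrees_shuffleRelations (𝕜 : Type*) [Field 𝕜]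
    {R : List (List (ℤ × Tree Colour SymOp))} {T : List (Tree Colour ShOp)}
    (hR : ∀ r ∈ R, ∀ σ ∈ labelPerms, IsRelationTerms (shuffleTerms σ r))
    (h1 : ∀ r ∈ R, ∀ σ ∈ labelPerms, ∃ p ∈ shuffleTerms σ r, p.2 ∈ T ∧
      ∀ q ∈ shuffleTerms σ r, q = p ∨ TreeLT q.2 p.2)
    (h2 : ∀ t ∈ T, ∃ r ∈ R, ∃ σ ∈ labelPerms, ∃ p ∈ shuffleTerms σ r, p.2 = t ∧
      ∀ q ∈ shuffleTerms σ r, q = p ∨ TreeLT q.2 p.2) :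
    leadingTrees pathOrder (shuffleRelations 𝕜 R) = {t | t ∈ T} := by
  ext t
  constructor
  · rintro ⟨x, hx, u, hu, rfl⟩
    obtain ⟨r, hr, σ, hσ, rfl⟩ := mem_shuffleRelations.mp hx
    obtain ⟨p, hp, hpT, hd⟩ := h1 r hr σ hσ
    rw [isLeadingTerm_shuffleTerms (hR r hr σ hσ) hp hd] at hu
    rw [Set.mem_ofPred_eq, hu]; exact hpT
  · intro ht
    obtain ⟨r, hr, σ, hσ, p, hp, rfl, hd⟩ := h2 t ht
    exact ⟨_, mem_shuffleRelations.mpr ⟨r, hr, σ, hσ, rfl⟩,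
      Monomial.of p.2 ((hR r hr σ hσ).isMonomial p hp),
      (isLeadingTerm_shuffleTerms (hR r hr σ hσ) hp hd).mpr rfl, rfl⟩

theorem derComSymRelations_subset : ∀ r ∈ derComSymRelations, r ∈ lieRSymRelations :=
  fun _ h => List.mem_append_left _ h

theorem leadingTrees_lieR (𝕜 : Type*) [Field 𝕜] :
    leadingTrees pathOrder (lieRRelations 𝕜) = {t | t ∈ lieRLeadingTrees} :=
  leadingTrees_shuffleRelations 𝕜 isRelationTerms_shuffleTerms exists_dominating_lieR
    exists_relation_lieR

theorem leadingTrees_derCom (𝕜 : Type*) [Field 𝕜] :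
    leadingTrees pathOrder (derComRelations 𝕜) = {t | t ∈ derComLeadingTrees} :=
  leadingTrees_shuffleRelations 𝕜
    (fun r hr => isRelationTerms_shuffleTerms r (derComSymRelations_subset r hr))
    exists_dominating_derCom exists_relation_derCom

/-- An element with a leading term is nonzero; the ordering constructed above supplies one, although
the claim mentions no ordering. -/
theorem derComRelations_ne_zero_and_isQuadratic (𝕜 : Type*) [Field 𝕜] :
    ∀ g ∈ derComRelations 𝕜, g ≠ 0 ∧ IsQuadratic g := by
  intro g hg
  obtain ⟨r, hr, σ, hσ, rfl⟩ := mem_shuffleRelations.mp hg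
  have hl := isRelationTerms_shuffleTerms r (derComSymRelations_subset r hr) σ hσ
  obtain ⟨p, hp, -, hd⟩ := exists_dominating_derCom r hr σ hσ
  constructor
  · intro h0
    have := (isLeadingTerm_shuffleTerms (𝕜 := 𝕜) hl hp hd
      (t := .of p.2 (hl.isMonomial p hp))).mpr rfl
    rw [h0] at this
    exact absurd this.1 (Finset.notMem_empty _)
  · intro t ht
    obtain ⟨q, hq, hqt⟩ := List.mem_map.mp (mem_of_mem_support_linComb hl.isMonomial ht)
    rw [← hqt]; exact hl.vertices q hq

/-! ### Evaluation of trees in an algebra -/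

section Evaluation

variable {I O : Type} {𝕜 : Type*} [Field 𝕜] {V : Type*} [AddCommGroup V] [Module 𝕜 V]

/-- The value of a tree when the vertices act by the bilinear operations `op` and the leaves have
the values `ρ`. -/
def Tree.eval (op : O → V →ₗ[𝕜] V →ₗ[𝕜] V) (ρ : I → ℕ → V) : Tree I O → V
  | .leaf c i => ρ c i
  | .node g s t => op g (s.eval op ρ) (t.eval op ρ)

variable (op : O → V →ₗ[𝕜] V →ₗ[𝕜] V) (ρ : I → ℕ → V)

theorem Tree.eval_relabel (f : ℕ → ℕ) (t : Tree I O) :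
    (t.relabel f).eval op ρ = t.eval op fun c i => ρ c (f i) := by
  induction t with
  | leaf c i => rfl
  | node g s t hs ht => simp [relabel, eval, hs, ht]

theorem Tree.eval_graft (i : ℕ) (u t : Tree I O) :
    (graft i u t).eval op ρ = t.eval op fun c j => if j = i then u.eval op ρ else ρ c j := by
  induction t with
  | leaf c j => by_cases hj : j = i <;> simp [graft, eval, hj]
  | node g s t hs ht => simp [graft, eval, hs, ht]

theorem Tree.eval_update_of_notMem {i : ℕ} {t : Tree I O} (h : i ∉ t.labels) (v : V) :
    t.eval op (fun c j => if j = i then v else ρ c j) = t.eval op ρ := by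
  induction t with
  | leaf c j =>
    rw [labels_leaf, List.mem_singleton] at h
    simp [eval, Ne.symm h]
  | node g s t hs ht =>
    rw [labels_node, List.mem_append, not_or] at h
    simp [eval, hs h.1, ht h.2]

/-- The value of a tree depends linearly on the value of each leaf. -/
theorem Tree.exists_linear_eval {i : ℕ} {t : Tree I O} (hn : t.labels.Nodup)
    (h : i ∈ t.labels) : ∃ Λ : V →ₗ[𝕜] V, ∀ v,
      t.eval op (fun c j => if j = i then v else ρ c j) = Λ v := by
  induction t with
  | leaf c j =>
    rw [labels_leaf, List.mem_singleton] at h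
    exact ⟨LinearMap.id, fun v => by simp [eval, h]⟩
  | node g s t hs ht =>
    obtain ⟨n1, n2, n3⟩ := labels_node_nodup.mp hn
    rw [labels_node, List.mem_append] at h
    by_cases h1 : i ∈ s.labels
    · obtain ⟨Λ, hΛ⟩ := hs n1 h1
      refine ⟨((op g).flip (t.eval op ρ)).comp Λ, fun v => ?_⟩
      simp [eval, hΛ, eval_update_of_notMem op ρ (n3 i h1)]
    · obtain ⟨Λ, hΛ⟩ := ht n2 (h.resolve_left h1)
      refine ⟨(op g (s.eval op ρ)).comp Λ, fun v => ?_⟩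
      simp [eval, hΛ, eval_update_of_notMem op ρ h1]

variable {S : Signature I O}

/-- The linear extension of the evaluation of trees. -/
noncomputable def evalLin : Free 𝕜 S →ₗ[𝕜] V :=
  Finsupp.linearCombination 𝕜 fun t : Monomial S => t.1.eval op ρ

theorem evalLin_apply (x : Free 𝕜 S) :
    evalLin op ρ x = x.sum fun t a => a • t.1.eval op ρ := rfl

/-- All monomials of `x` have the same arity, leaf colours and output colour. -/
def IsHomogeneous (x : Free 𝕜 S) : Prop :=
  ∀ s ∈ x.support, ∀ t ∈ x.support,
    s.1.leaves.Perm t.1.leaves ∧ s.1.outColour S = t.1.outColour S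

theorem composable_congr_left {n m : ℕ} {ω : ShuffleDatum n m} {s s' t : Monomial S}
    (h : s.1.leaves.Perm s'.1.leaves) (hc : Composable ω s t) : Composable ω s' t :=
  ⟨h.length_eq.symm.trans hc.1, hc.2.1, h.mem_iff.mp hc.2.2⟩

theorem composable_congr_right {n m : ℕ} {ω : ShuffleDatum n m} {s t t' : Monomial S}
    (h : t.1.leaves.Perm t'.1.leaves) (ho : t.1.outColour S = t'.1.outColour S)
    (hc : Composable ω s t) : Composable ω s t' :=
  ⟨hc.1, h.length_eq.symm.trans hc.2.1, ho ▸ hc.2.2⟩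

theorem Tree.leaves_graft_perm {i : ℕ} {u u' t t' : Tree I O} (hu : u.leaves.Perm u'.leaves)
    (ht : t.leaves.Perm t'.leaves) : (graft i u t).leaves.Perm (graft i u' t').leaves := by
  have key : ∀ u t : Tree I O, (graft i u t).leaves =
      t.leaves.flatMap fun p => if p.2 = i then u.leaves else [p] := by
    intro u t
    induction t with
    | leaf c j => by_cases hj : j = i <;> simp [graft, leaves, hj]
    | node g s t hs ht => simp [graft, leaves, hs, ht]
  rw [key, key]
  refine ht.flatMap fun p _ => ?_
  by_cases hp : p.2 = i <;> simp [hp, hu]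

theorem leaves_comp_perm {n m : ℕ} (ω : ShuffleDatum n m) {s s' t t' : Tree I O}
    (hs : s.leaves.Perm s'.leaves) (ht : t.leaves.Perm t'.leaves) :
    (compTree ω s t).leaves.Perm (compTree ω s' t').leaves := by
  refine Tree.leaves_graft_perm ?_ ?_ <;> rw [Tree.leaves_relabel, Tree.leaves_relabel]
  exacts [ht.map _, hs.map _]

theorem eval_compTree {n m : ℕ} (ω : ShuffleDatum n m) (s t : Tree I O) :
    (compTree ω s t).eval op ρ = s.eval op fun c i =>
      if ω.outer i = ω.outer ω.pos then t.eval op fun c j => ρ c (ω.inner j)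
      else ρ c (ω.outer i) := by
  rw [compTree, Tree.eval_graft, Tree.eval_relabel, Tree.eval_relabel]

/-! ### Bilinearity and homogeneity of shuffle compositions -/

section Comp

variable {n m : ℕ} (ω : ShuffleDatum n m)

open Classical in
theorem comp_single_right (x : Free 𝕜 S) (t : Monomial S) (b : 𝕜) :
    comp ω x (Finsupp.single t b) = x.sum fun s a =>
      if h : Composable ω s t then Finsupp.single (Monomial.comp ω s t h) (a * b) else 0 := by
  unfold comp
  refine Finsupp.sum_congr fun s _ => ?_
  rw [Finsupp.sum_single_index]
  split <;> simp

open Classical in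
theorem comp_single_left (s : Monomial S) (a : 𝕜) (y : Free 𝕜 S) :
    comp ω (Finsupp.single s a) y = y.sum fun t b =>
      if h : Composable ω s t then Finsupp.single (Monomial.comp ω s t h) (a * b) else 0 := by
  unfold comp
  rw [Finsupp.sum_single_index]
  refine Finset.sum_eq_zero fun t _ => ?_
  dsimp only
  split <;> simp

theorem comp_add_left (x x' y : Free 𝕜 S) : comp ω (x + x') y = comp ω x y + comp ω x' y := by
  classical
  unfold comp
  refine Finsupp.sum_add_index' (fun s => ?_) fun s a a' => ?_
  · refine Finset.sum_eq_zero fun t _ => ?_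
    dsimp only
    split <;> simp
  · rw [← Finsupp.sum_add]
    refine Finsupp.sum_congr fun t _ => ?_
    split <;> simp [add_mul]

theorem comp_add_right (x y y' : Free 𝕜 S) : comp ω x (y + y') = comp ω x y + comp ω x y' := by
  classical
  unfold comp
  rw [← Finsupp.sum_add]
  refine Finsupp.sum_congr fun s _ => ?_
  refine Finsupp.sum_add_index' (fun t => ?_) fun t a a' => ?_
  · split <;> simp
  · split <;> simp [mul_add]

theorem comp_smul_left (c : 𝕜) (x y : Free 𝕜 S) : comp ω (c • x) y = c • comp ω x y := by
  classical
  unfold comp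
  rw [Finsupp.sum_smul_index', Finsupp.smul_sum]
  · refine Finsupp.sum_congr fun s _ => ?_
    rw [Finsupp.smul_sum]
    refine Finsupp.sum_congr fun t _ => ?_
    split
    · rw [Finsupp.smul_single, smul_eq_mul, smul_eq_mul, mul_assoc]
    · rw [smul_zero]
  · intro s
    refine Finset.sum_eq_zero fun t _ => ?_
    dsimp only
    split <;> simp

theorem comp_smul_right (c : 𝕜) (x y : Free 𝕜 S) : comp ω x (c • y) = c • comp ω x y := by
  classical
  unfold comp
  rw [Finsupp.smul_sum]
  refine Finsupp.sum_congr fun s _ => ?_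
  rw [Finsupp.sum_smul_index', Finsupp.smul_sum]
  · refine Finsupp.sum_congr fun t _ => ?_
    split
    · rw [Finsupp.smul_single, smul_eq_mul, smul_eq_mul, mul_left_comm]
    · rw [smul_zero]
  · intro t; split <;> simp

/-- The shuffle composition as a bilinear map. -/
noncomputable def compBilin : Free 𝕜 S →ₗ[𝕜] Free 𝕜 S →ₗ[𝕜] Free 𝕜 S :=
  LinearMap.mk₂ 𝕜 (comp ω) (comp_add_left ω) (comp_smul_left ω) (comp_add_right ω)
    (comp_smul_right ω)

theorem compBilin_apply (x y : Free 𝕜 S) : compBilin ω x y = comp ω x y := rfl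

variable {ω}

open Classical in
theorem comp_left_of_composable {x : Free 𝕜 S} {t : Monomial S} (b : 𝕜)
    (h : ∀ s ∈ x.support, Composable ω s t) : comp ω x (Finsupp.single t b) =
      ∑ s ∈ x.support.attach, Finsupp.single (Monomial.comp ω s.1 t (h s.1 s.2)) (x s.1 * b) := by
  rw [comp_single_right, Finsupp.sum, ← Finset.sum_attach]
  refine Finset.sum_congr rfl fun s _ => ?_
  rw [dif_pos (h s.1 s.2)]

open Classical in
theorem comp_right_of_composable {s : Monomial S} {y : Free 𝕜 S} (a : 𝕜)
    (h : ∀ t ∈ y.support, Composable ω s t) : comp ω (Finsupp.single s a) y =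
      ∑ t ∈ y.support.attach, Finsupp.single (Monomial.comp ω s t.1 (h t.1 t.2)) (a * y t.1) := by
  rw [comp_single_left, Finsupp.sum, ← Finset.sum_attach]
  refine Finset.sum_congr rfl fun t _ => ?_
  rw [dif_pos (h t.1 t.2)]

theorem comp_left_of_not_composable {x : Free 𝕜 S} {t : Monomial S} (b : 𝕜)
    (h : ∀ s ∈ x.support, ¬ Composable ω s t) : comp ω x (Finsupp.single t b) = 0 := by
  classical
  rw [comp_single_right]
  refine Finset.sum_eq_zero fun s hs => ?_
  exact dif_neg (h s hs)

theorem comp_right_of_not_composable {s : Monomial S} {y : Free 𝕜 S} (a : 𝕜)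
    (h : ∀ t ∈ y.support, ¬ Composable ω s t) : comp ω (Finsupp.single s a) y = 0 := by
  classical
  rw [comp_single_left]
  refine Finset.sum_eq_zero fun t ht => ?_
  exact dif_neg (h t ht)

theorem mem_support_comp_left {x : Free 𝕜 S} {t : Monomial S} {b : 𝕜}
    (h : ∀ s ∈ x.support, Composable ω s t) {u : Monomial S}
    (hu : u ∈ (comp ω x (Finsupp.single t b)).support) :
    ∃ s, ∃ hs : s ∈ x.support, u = Monomial.comp ω s t (h s hs) := by
  classical
  rw [comp_left_of_composable b h] at hu
  obtain ⟨s, -, hs⟩ := Finset.mem_biUnion.mp (Finsupp.support_finsetSum hu)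
  exact ⟨s.1, s.2, Finset.mem_singleton.mp (Finsupp.support_single_subset hs)⟩

theorem mem_support_comp_right {s : Monomial S} {y : Free 𝕜 S} {a : 𝕜}
    (h : ∀ t ∈ y.support, Composable ω s t) {u : Monomial S}
    (hu : u ∈ (comp ω (Finsupp.single s a) y).support) :
    ∃ t, ∃ ht : t ∈ y.support, u = Monomial.comp ω s t (h t ht) := by
  classical
  rw [comp_right_of_composable a h] at hu
  obtain ⟨t, -, ht⟩ := Finset.mem_biUnion.mp (Finsupp.support_finsetSum hu)
  exact ⟨t.1, t.2, Finset.mem_singleton.mp (Finsupp.support_single_subset ht)⟩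

/-- Compositions that do not match are zero, so composing an inhomogeneous element may lose some of
its terms. For homogeneous elements the terms survive or vanish together, which is what makes
evaluation and leading terms behave well. -/
theorem composable_or_left {x : Free 𝕜 S} (hx : IsHomogeneous x) (ω : ShuffleDatum n m)
    (t : Monomial S) :
    (∀ s ∈ x.support, Composable ω s t) ∨ ∀ s ∈ x.support, ¬ Composable ω s t := by
  by_contra hc
  push Not at hc
  obtain ⟨⟨s, hs, h1⟩, s', hs', h2⟩ := hc
  exact h1 (composable_congr_left (hx s' hs' s hs).1 h2)

theorem composable_or_right {y : Free 𝕜 S} (hy : IsHomogeneous y) (ω : ShuffleDatum n m)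
    (s : Monomial S) :
    (∀ t ∈ y.support, Composable ω s t) ∨ ∀ t ∈ y.support, ¬ Composable ω s t := by
  by_contra hc
  push Not at hc
  obtain ⟨⟨t, ht, h1⟩, t', ht', h2⟩ := hc
  exact h1 (composable_congr_right (hy t' ht' t ht).1 (hy t' ht' t ht).2 h2)

theorem IsHomogeneous.comp_left {x : Free 𝕜 S} (hx : IsHomogeneous x) (ω : ShuffleDatum n m)
    (t : Monomial S) (b : 𝕜) : IsHomogeneous (comp ω x (Finsupp.single t b)) := by
  rcases composable_or_left hx ω t with h | h
  · intro u hu v hv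
    obtain ⟨s, hs, rfl⟩ := mem_support_comp_left h hu
    obtain ⟨s', hs', rfl⟩ := mem_support_comp_left h hv
    refine ⟨leaves_comp_perm ω (hx s hs s' hs').1 (List.Perm.refl _), ?_⟩
    exact (outColour_comp (h s hs)).trans
      ((hx s hs s' hs').2.trans (outColour_comp (h s' hs')).symm)
  · rw [comp_left_of_not_composable b h]
    intro u hu; simp at hu

theorem IsHomogeneous.comp_right {y : Free 𝕜 S} (hy : IsHomogeneous y) (ω : ShuffleDatum n m)
    (s : Monomial S) (a : 𝕜) : IsHomogeneous (comp ω (Finsupp.single s a) y) := by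
  rcases composable_or_right hy ω s with h | h
  · intro u hu v hv
    obtain ⟨t, ht, rfl⟩ := mem_support_comp_right h hu
    obtain ⟨t', ht', rfl⟩ := mem_support_comp_right h hv
    refine ⟨leaves_comp_perm ω (List.Perm.refl _) (hy t ht t' ht').1, ?_⟩
    exact (outColour_comp (h t ht)).trans (outColour_comp (h t' ht')).symm
  · rw [comp_right_of_not_composable a h]
    intro u hu; simp at hu

end Comp

/-- The homogeneous elements that vanish under all evaluations. -/
def vanishing (op : O → V →ₗ[𝕜] V →ₗ[𝕜] V) (S : Signature I O) : Set (Free 𝕜 S) :=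
  {x | IsHomogeneous x ∧ ∀ ρ : I → ℕ → V, evalLin op ρ x = 0}

variable {op}

/-- Evaluating `s ∘ t` amounts to evaluating `s` with the value of `t` put on the grafting leaf.
This assignment does not depend on `s`, and `x` vanishes under it by hypothesis. -/
theorem vanishing_comp_left {n m : ℕ} {x : Free 𝕜 S} (hx : x ∈ vanishing op S)
    (ω : ShuffleDatum n m) (t : Monomial S) (b : 𝕜) :
    comp ω x (Finsupp.single t b) ∈ vanishing op S := by
  refine ⟨hx.1.comp_left ω t b, fun ρ => ?_⟩
  rcases composable_or_left hx.1 ω t with h | h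
  · have h0 := hx.2 fun c i =>
      if ω.outer i = ω.outer ω.pos then t.1.eval op fun c j => ρ c (ω.inner j)
      else ρ c (ω.outer i)
    rw [evalLin_apply, Finsupp.sum, ← Finset.sum_attach] at h0
    rw [comp_left_of_composable b h, map_sum, ← smul_zero b, ← h0, Finset.smul_sum]
    refine Finset.sum_congr rfl fun s _ => ?_
    rw [evalLin, Finsupp.linearCombination_single, mul_comm, mul_smul]
    congr 2
    exact eval_compTree op ρ ω s.1.1 t.1
  · rw [comp_left_of_not_composable b h, map_zero]

theorem vanishing_comp_right {n m : ℕ} {y : Free 𝕜 S} (hy : y ∈ vanishing op S)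
    (ω : ShuffleDatum n m) (s : Monomial S) (a : 𝕜) :
    comp ω (Finsupp.single s a) y ∈ vanishing op S := by
  refine ⟨hy.1.comp_right ω s a, fun ρ => ?_⟩
  rcases composable_or_right hy.1 ω s with h | h
  · have h0 := hy.2 fun c i => ρ c (ω.inner i)
    rw [evalLin_apply, Finsupp.sum, ← Finset.sum_attach] at h0
    -- A term of `y` is needed to know that the relabelled lower tree has distinct labels; without
    -- terms the claim is trivial.
    rcases y.support.eq_empty_or_nonempty with he | ⟨t0, ht0⟩
    · rw [Finsupp.support_eq_empty.mp he]
      change evalLin op ρ (compBilin ω _ 0) = 0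
      rw [map_zero, map_zero]
    have hc := h t0 ht0
    -- The grafting label occurs once in the lower tree, so the value of the composite is a fixed
    -- linear function of the value of the upper tree.
    obtain ⟨Λ, hΛ⟩ := Tree.exists_linear_eval (t := s.1.relabel ω.outer) op ρ hc.nodup_relabel
      (i := ω.outer ω.pos) (by rw [Tree.labels_relabel]; exact List.mem_map_of_mem hc.pos_mem)
    rw [comp_right_of_composable a h, map_sum, ← smul_zero a, ← map_zero Λ, ← h0, map_sum,
      Finset.smul_sum]
    refine Finset.sum_congr rfl fun t _ => ?_
    rw [evalLin, Finsupp.linearCombination_single, mul_smul, map_smul, ← hΛ]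
    congr 2
    rw [← Tree.eval_relabel op ρ ω.inner, ← Tree.eval_graft]
    rfl
  · rw [comp_right_of_not_composable a h, map_zero]

/-- Homogeneous elements are not closed under addition, hence the span. By bilinearity the other
factor may be taken to be a monomial. -/
theorem isOperadicIdeal_span_vanishing :
    IsOperadicIdeal (Submodule.span 𝕜 (vanishing op S)) := by
  intro n m ω x y
  constructor
  · intro hx
    induction y using Finsupp.induction_linear with
    | zero =>
      rw [← compBilin_apply, map_zero]; exact zero_mem _
    | add y y' h1 h2 => rw [comp_add_right]; exact add_mem h1 h2
    | single t b =>
      induction hx using Submodule.span_induction with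
      | mem x hx => exact Submodule.subset_span (vanishing_comp_left hx ω t b)
      | zero => rw [← compBilin_apply, map_zero]; exact zero_mem _
      | add x x' _ _ h1 h2 => rw [comp_add_left]; exact add_mem h1 h2
      | smul c x _ h1 => rw [comp_smul_left]; exact Submodule.smul_mem _ _ h1
  · intro hy
    induction x using Finsupp.induction_linear with
    | zero =>
      rw [← compBilin_apply, map_zero]; exact zero_mem _
    | add y y' h1 h2 => rw [comp_add_left]; exact add_mem h1 h2
    | single s a =>
      induction hy using Submodule.span_induction with
      | mem x hx => exact Submodule.subset_span (vanishing_comp_right hx ω s a)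
      | zero => rw [← compBilin_apply, map_zero]; exact zero_mem _
      | add x x' _ _ h1 h2 => rw [comp_add_right]; exact add_mem h1 h2
      | smul c x _ h1 => rw [comp_smul_right]; exact Submodule.smul_mem _ _ h1

/-- Elements of the ideal generated by homogeneous relations that hold in an algebra vanish under
evaluation in the algebra. -/
theorem evalLin_eq_zero_of_mem_operadicIdeal {G : Set (Free 𝕜 S)} (hG : G ⊆ vanishing op S)
    {x : Free 𝕜 S} (hx : x ∈ operadicIdeal G) (ρ : I → ℕ → V) : evalLin op ρ x = 0 := by
  have h1 : operadicIdeal G ≤ Submodule.span 𝕜 (vanishing op S) :=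
    sInf_le ⟨isOperadicIdeal_span_vanishing, hG.trans Submodule.subset_span⟩
  have h2 : Submodule.span 𝕜 (vanishing op S) ≤ LinearMap.ker (evalLin op ρ) :=
    Submodule.span_le.mpr fun y hy => hy.2 ρ
  exact h2 (h1 hx)

theorem isOperadicIdeal_operadicIdeal (G : Set (Free 𝕜 S)) :
    IsOperadicIdeal (operadicIdeal G) := by
  intro n m ω x y
  constructor <;> intro h <;> refine Submodule.mem_sInf.mpr fun M hM => ?_
  · exact (hM.1 n m ω x y).1 (Submodule.mem_sInf.mp h M hM)
  · exact (hM.1 n m ω x y).2 (Submodule.mem_sInf.mp h M hM)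

theorem subset_operadicIdeal (G : Set (Free 𝕜 S)) :
    G ⊆ (operadicIdeal G : Set (Free 𝕜 S)) :=
  fun _ hx => Submodule.mem_sInf.mpr fun _ hM => hM.2 hx

end Evaluation

/-! ### Algebras over `DerCom` -/

section Algebras

variable {𝕜 : Type*} [Field 𝕜] {V : Type*} [AddCommGroup V] [Module 𝕜 V]

/-- The operations of the shuffle generators on an algebra over the symmetric operad. -/
def shuffleOp (op : SymOp → V →ₗ[𝕜] V →ₗ[𝕜] V) : ShOp → V →ₗ[𝕜] V →ₗ[𝕜] V
  | .alpha => op .alpha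
  | .beta => op .beta
  | .d => op .d
  | .e => (op .d).flip
  | .m => op .m
  | .n => (op .m).flip

/-- The identities of an algebra over the symmetric operad `DerCom`. -/
structure IsDerComAlgebra (op : SymOp → V →ₗ[𝕜] V →ₗ[𝕜] V) : Prop where
  alpha_comm : ∀ x y, op .alpha x y = op .alpha y x
  beta_neg : ∀ x y, op .beta x y = -op .beta y x
  alpha_assoc : ∀ x y z, op .alpha (op .alpha x y) z = op .alpha x (op .alpha y z)
  jacobi : ∀ x y z, op .beta (op .beta x y) z =
    op .beta (op .beta x z) y + op .beta x (op .beta y z)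
  leibniz : ∀ x y z, op .d (op .alpha x y) z = op .alpha x (op .d y z) + op .alpha (op .d x z) y
  action : ∀ x y z, op .d x (op .beta y z) = op .d (op .d x z) y - op .d (op .d x y) z
  module : ∀ x y z, op .m (op .alpha x y) z = op .m x (op .m y z)

variable {op : SymOp → V →ₗ[𝕜] V →ₗ[𝕜] V}

/-- Exchanging the inputs of a vertex is undone by commutativity of `α`, by antisymmetry of `β`,
which gives the sign, and by the definitions of `e` and `n` as flips. -/
theorem IsDerComAlgebra.eval_planarize (h : IsDerComAlgebra op) (ρ : Colour → ℕ → V)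
    (t : Tree Colour SymOp) :
    (((planarize t).1 : ℤ) : 𝕜) • (planarize t).2.eval (shuffleOp op) ρ = t.eval op ρ := by
  induction t with
  | leaf a i => simp [planarize, Tree.eval]
  | node g s t hs ht =>
    rw [planarize]
    split
    · have e : shuffleOp op g.toShOp = op g := by cases g <;> rfl
      simp only [Tree.eval, ← hs, ← ht, e, map_smul, LinearMap.smul_apply, smul_smul]
      push_cast
      rw [mul_comm]
    · have e : ∀ x y, ((g.flipSign : ℤ) : 𝕜) • shuffleOp op g.flip y x = op g x y := by
        intro x y
        cases g
        · simp [SymOp.flipSign, SymOp.flip, shuffleOp, h.alpha_comm x y]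
        · simp [SymOp.flipSign, SymOp.flip, shuffleOp, h.beta_neg x y]
        · simp [SymOp.flipSign, SymOp.flip, shuffleOp]
        · simp [SymOp.flipSign, SymOp.flip, shuffleOp]
      simp only [Tree.eval, ← hs, ← ht, ← e, map_smul, LinearMap.smul_apply, smul_smul]
      push_cast
      congr 1
      ring

theorem evalLin_linComb {l : List (ℤ × Tree Colour ShOp)} (hm : ∀ p ∈ l, p.2.IsMonomial shSig)
    (op : ShOp → V →ₗ[𝕜] V →ₗ[𝕜] V) (ρ : Colour → ℕ → V) :
    evalLin op ρ (linComb 𝕜 shSig l) = (l.map fun p => (p.1 : 𝕜) • p.2.eval op ρ).sum := by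
  rw [linComb, map_list_sum, List.map_map]
  congr 1
  refine List.map_congr_left fun p hp => ?_
  rw [Function.comp_apply, map_smul, ofTree_of_isMonomial (hm p hp), evalLin,
    Finsupp.linearCombination_single, one_smul]
  rfl

theorem IsDerComAlgebra.relations_subset (h : IsDerComAlgebra op) :
    derComRelations 𝕜 ⊆ vanishing (shuffleOp op) shSig := by
  intro x hx
  obtain ⟨r, hr, σ, hσ, rfl⟩ := mem_shuffleRelations.mp hx
  have hl := isRelationTerms_shuffleTerms r (derComSymRelations_subset r hr) σ hσ
  constructor
  · intro s hs t ht
    obtain ⟨p, hp, hps⟩ := List.mem_map.mp (mem_of_mem_support_linComb hl.isMonomial hs)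
    obtain ⟨q, hq, hqt⟩ := List.mem_map.mp (mem_of_mem_support_linComb hl.isMonomial ht)
    rw [← hps, ← hqt]
    exact ⟨hl.leaves p hp q hq, hl.outColour p hp q hq⟩
  · intro ρ
    rw [evalLin_linComb hl.isMonomial, shuffleTerms, List.map_map]
    have e : ((fun p : ℤ × Tree Colour ShOp => (p.1 : 𝕜) • p.2.eval (shuffleOp op) ρ) ∘
        fun p : ℤ × Tree Colour SymOp =>
          (p.1 * (planarize (p.2.relabel σ)).1, (planarize (p.2.relabel σ)).2)) =
        fun p => (p.1 : 𝕜) • p.2.eval op fun a i => ρ a (σ i) := by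
      funext p
      simp only [Function.comp_apply, Int.cast_mul, mul_smul]
      rw [h.eval_planarize, Tree.eval_relabel]
    rw [e]
    simp only [derComSymRelations, List.mem_cons, List.not_mem_nil, or_false] at hr
    rcases hr with rfl | rfl | rfl | rfl | rfl <;>
      simp only [List.map_cons, List.map_nil, List.sum_cons, List.sum_nil, leftTree, rightTree,
        Tree.eval, symSig, Int.cast_one, Int.cast_neg, one_smul, neg_smul, add_zero]
    · rw [h.alpha_assoc]; abel
    · rw [h.jacobi]; abel
    · rw [h.leibniz]; abel
    · rw [h.action]; abel
    · rw [h.module]; abel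

end Algebras

/-! ### A large algebra over `DerCom` -/

namespace Model

/-- Keys by which the basis elements of the model are compared. -/
abbrev Key : Type := Lex (ℕ∞ →₀ ℕ)

/-- The free generators of the Lie algebra of the model: a code, a lowest label and a key. -/
abbrev Letter : Type := ℕ × ℕ∞ × (ℕ∞ →₀ ℕ)

/-- The basis elements of the Lie algebra of the model. -/
abbrev Word : Type := List Letter

/-- The free generators of the commutative algebra of the model. -/
abbrev Atom : Type := Word × ℕ

/-- The basis elements of the commutative algebra of the model. -/
abbrev Mon : Type := Atom →₀ ℕ

/-- The lowest label of a letter. -/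
def Letter.low (x : Letter) : ℕ∞ := x.2.1

/-- The key of a letter. -/
def Letter.key (x : Letter) : Key := toLex x.2.2

/-- The lowest labels of the letters of a word. -/
def profile (w : Word) : Multiset ℕ∞ := (w.map Letter.low : List ℕ∞)

/-- The inversions between two parts of a word. -/
noncomputable def cross (A B : Multiset ℕ∞) : Key :=
  -- An inversion is recorded at its smaller label. In the lexicographic order on keys the smallest
  -- label weighs most, so it outweighs any number of inversions at larger labels.
  (A.map fun x => (B.map fun y => if y < x then toLex (Finsupp.single y 1) else (0 : Key)).sum).sum

/-- The key of a word. -/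
noncomputable def wordKey : Word → Key
  | [] => 0
  | x :: w => Letter.key x + wordKey w + cross {Letter.low x} (profile w)

/-- The lowest label of an atom. -/
noncomputable def atomLow (T : Atom) : ℕ∞ := min (profile T.1).inf T.2

/-- The lowest label of a monomial. -/
noncomputable def monLow (f : Mon) : ℕ∞ := f.support.inf atomLow

/-- The key of a monomial. -/
noncomputable def monKey (f : Mon) : Key := f.sum fun T n => n • wordKey T.1

/-- An injective numbering. -/
noncomputable def letterCode : (Mon × Word) ⊕ ℕ → ℕ := (exists_injective_nat _).choose

theorem letterCode_injective : Function.Injective letterCode :=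
  (exists_injective_nat ((Mon × Word) ⊕ ℕ)).choose_spec

/-- The letter for the generator with label `i`. -/
noncomputable def genLetter (i : ℕ) : Letter := (letterCode (.inr i), i, 0)

/-- The letter for the product of a monomial and a word in the module structure. -/
noncomputable def modLetter (f : Mon) (w : Word) : Letter :=
  -- Monomials and words in letters form countable sets, so the pair `(f, w)` can be coded by a
  -- number; this avoids a recursive type of letters. The stored label and key let profiles and keys
  -- of words be computed without decoding.
  (letterCode (.inl (f, w)), min (monLow f) (profile w).inf, ofLex (monKey f + wordKey w))

theorem genLetter_injective : Function.Injective genLetter := fun i j h => by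
  simpa using letterCode_injective (congrArg Prod.fst h)

theorem modLetter_inj {f g : Mon} {v w : Word} :
    modLetter f v = modLetter g w ↔ f = g ∧ v = w := by
  constructor
  · intro h
    simpa using letterCode_injective (congrArg Prod.fst h)
  · rintro ⟨rfl, rfl⟩; rfl

theorem genLetter_ne_modLetter {i : ℕ} {f : Mon} {w : Word} : genLetter i ≠ modLetter f w :=
  fun h => by simpa using letterCode_injective (congrArg Prod.fst h)

/-- A word of the form `f • w` for a nontrivial monomial `f`. -/
def IsModuleWord (w : Word) : Prop := ∃ p : Mon × Word, p.1 ≠ 0 ∧ w = [modLetter p.1 p.2]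

open Classical in
/-- Write a word as `f • w`. -/
noncomputable def splitWord (w : Word) : Mon × Word :=
  if h : IsModuleWord w then h.choose else (0, w)

theorem splitWord_of_not {w : Word} (h : ¬ IsModuleWord w) : splitWord w = (0, w) := dif_neg h

theorem splitWord_modLetter {f : Mon} (hf : f ≠ 0) (w : Word) :
    splitWord [modLetter f w] = (f, w) := by
  have h : IsModuleWord [modLetter f w] := ⟨(f, w), hf, rfl⟩
  rw [splitWord, dif_pos h]
  have := h.choose_spec.2
  rw [List.cons.injEq, modLetter_inj] at this
  exact Prod.ext this.1.1.symm this.1.2.symm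

open Classical in
/-- The action of monomials on words. -/
noncomputable def monAct (f : Mon) (w : Word) : Word :=
  if f + (splitWord w).1 = 0 then w else [modLetter (f + (splitWord w).1) (splitWord w).2]

theorem monAct_of_not {f : Mon} (hf : f ≠ 0) {w : Word} (hw : ¬ IsModuleWord w) :
    monAct f w = [modLetter f w] := by
  simp [monAct, splitWord_of_not hw, hf]

theorem monAct_zero (w : Word) : monAct 0 w = w := by
  by_cases h : IsModuleWord w
  · obtain ⟨⟨f, v⟩, hf, rfl⟩ := h
    simp [monAct, splitWord_modLetter hf]
  · simp [monAct, splitWord_of_not h]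

/-- `splitWord` strips the outer module letter, whose monomial absorbs `g` and then `f`. The letter
is written down again only if the total monomial is nontrivial, so 1 acts as the identity. -/
theorem monAct_add (f g : Mon) (w : Word) : monAct (f + g) w = monAct f (monAct g w) := by
  by_cases h : g + (splitWord w).1 = 0
  · have hg : g = 0 := (add_eq_zero.mp h).1
    rw [hg, add_zero, monAct_zero]
  · have e : monAct g w = [modLetter (g + (splitWord w).1) (splitWord w).2] := if_neg h
    have h' : f + (g + (splitWord w).1) ≠ 0 := fun hh => h (add_eq_zero.mp hh).2
    rw [e, monAct, monAct, splitWord_modLetter h, add_assoc, if_neg h', if_neg h']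

variable (𝕜 : Type*) [Field 𝕜]

/-- The commutative algebra of the model. -/
abbrev Com : Type _ := MvPolynomial Atom 𝕜

/-- The Lie algebra of the model: a free associative algebra with its commutator. -/
abbrev Lie : Type _ := MonoidAlgebra 𝕜 (FreeMonoid Letter)

variable {𝕜} in
/-- The basis element of the Lie algebra given by a word. -/
noncomputable def ofWord (w : Word) : Lie 𝕜 := MonoidAlgebra.single (FreeMonoid.ofList w) 1

variable {𝕜} in
/-- The basis element of the commutative algebra given by a monomial. -/
noncomputable def ofMon (f : Mon) : Com 𝕜 := MvPolynomial.monomial f 1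

variable {𝕜}

theorem ofWord_mul (v w : Word) : (ofWord v * ofWord w : Lie 𝕜) = ofWord (v ++ w) := by
  simp [ofWord, MonoidAlgebra.single_mul_single]

theorem ofMon_mul (f g : Mon) : (ofMon f * ofMon g : Com 𝕜) = ofMon (f + g) := by
  simp [ofMon, MvPolynomial.monomial_mul]

theorem lie_induction {P : Lie 𝕜 → Prop} (x : Lie 𝕜) (h0 : P 0)
    (hadd : ∀ x y, P x → P y → P (x + y)) (hw : ∀ (a : 𝕜) w, P (a • ofWord w)) : P x := by
  induction x using MonoidAlgebra.induction_linear with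
  | zero => exact h0
  | add x y hx hy => exact hadd x y hx hy
  | single m a =>
    have := hw a (FreeMonoid.toList m)
    rwa [ofWord, MonoidAlgebra.smul_single, smul_eq_mul, mul_one] at this

/-- The linear extension of a function on words. -/
noncomputable def liftWord {M : Type*} [AddCommGroup M] [Module 𝕜 M] (F : Word → M) :
    Lie 𝕜 →ₗ[𝕜] M :=
  (Finsupp.linearCombination 𝕜 fun w : FreeMonoid Letter => F (FreeMonoid.toList w)).comp
    (MonoidAlgebra.coeffLinearEquiv 𝕜).toLinearMap

theorem liftWord_ofWord {M : Type*} [AddCommGroup M] [Module 𝕜 M] (F : Word → M) (w : Word) :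
    liftWord (𝕜 := 𝕜) F (ofWord w) = F w := by
  simp [liftWord, ofWord]

/-- The values of the derivation given by an element of the Lie algebra on the generators. -/
noncomputable def generatorAct (T : Atom) : Lie 𝕜 →ₗ[𝕜] Com 𝕜 :=
  liftWord fun w => MvPolynomial.X (w ++ T.1, T.2)

theorem generatorAct_ofWord (T : Atom) (w : Word) :
    generatorAct T (ofWord w : Lie 𝕜) = MvPolynomial.X (w ++ T.1, T.2) :=
  liftWord_ofWord _ _

/-- The derivation given by an element of the Lie algebra. -/
noncomputable def derivation : Lie 𝕜 →ₗ[𝕜] Derivation 𝕜 (Com 𝕜) (Com 𝕜) where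
  toFun X := MvPolynomial.mkDerivation 𝕜 fun T => generatorAct T X
  map_add' X Y := MvPolynomial.derivation_ext fun T => by simp
  map_smul' a X := MvPolynomial.derivation_ext fun T => by simp

theorem derivation_X (X : Lie 𝕜) (T : Atom) :
    derivation X (MvPolynomial.X T) = generatorAct T X := by
  simp [derivation]

/-- The elements `generatorAct T Y` are linear in the generators, where the derivation prepends
words. Prepending twice is multiplication in the free associative algebra. -/
theorem derivation_generatorAct (X Y : Lie 𝕜) (T : Atom) :
    derivation X (generatorAct T Y) = generatorAct T (X * Y) := by
  induction Y using lie_induction with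
  | h0 => simp
  | hadd Y Y' h h' => simp only [mul_add, map_add, h, h']
  | hw a w =>
    rw [mul_smul_comm, LinearMap.map_smul, LinearMap.map_smul, Derivation.map_smul,
      generatorAct_ofWord, derivation_X]
    congr 1
    induction X using lie_induction with
    | h0 => simp
    | hadd X X' h h' => simp only [add_mul, map_add, h, h']
    | hw b v =>
      simp only [map_smul, smul_mul_assoc, ofWord_mul, generatorAct_ofWord, List.append_assoc]

theorem derivation_commutator (X Y : Lie 𝕜) (f : Com 𝕜) :
    derivation (X * Y - Y * X) f = derivation X (derivation Y f) -
      derivation Y (derivation X f) := by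
  have : derivation (X * Y - Y * X) = ⁅derivation X, derivation Y⁆ := by
    -- The commutator of derivations is a derivation, so comparison on generators suffices; there
    -- both sides are given by associative products.
    refine MvPolynomial.derivation_ext fun T => ?_
    rw [Derivation.commutator_apply]
    simp only [derivation_X, derivation_generatorAct, map_sub, Derivation.sub_apply]
  rw [this, Derivation.commutator_apply]

/-- The action of the commutative algebra on the Lie algebra. -/
noncomputable def moduleAct : Com 𝕜 →ₐ[𝕜] Module.End 𝕜 (Lie 𝕜) :=
  AddMonoidAlgebra.lift 𝕜 (Module.End 𝕜 (Lie 𝕜)) Mon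
    { toFun := fun f => liftWord fun w => ofWord (monAct f.toAdd w)
      map_one' := by
        refine LinearMap.ext fun x => ?_
        induction x using lie_induction with
        | h0 => simp
        | hadd x y h h' => simp only [map_add, h, h']
        | hw a w => simp [liftWord_ofWord, monAct_zero]
      map_mul' := fun f g => by
        refine LinearMap.ext fun x => ?_
        induction x using lie_induction with
        | h0 => simp
        | hadd x y h h' => simp only [map_add, h, h']
        | hw a w => simp [liftWord_ofWord, monAct_add] }

theorem moduleAct_ofMon_ofWord (f : Mon) (w : Word) :
    moduleAct (ofMon f : Com 𝕜) (ofWord w) = ofWord (monAct f w) := by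
  have : moduleAct (ofMon f : Com 𝕜) = liftWord fun w => ofWord (monAct f w) := by
    refine (AddMonoidAlgebra.lift_single _ f (1 : 𝕜)).trans ?_
    simp
  rw [this, liftWord_ofWord]

/-- The operations of the model. -/
noncomputable def op : SymOp → Com 𝕜 × Lie 𝕜 →ₗ[𝕜] Com 𝕜 × Lie 𝕜 →ₗ[𝕜] Com 𝕜 × Lie 𝕜
  | .alpha => ((LinearMap.mul 𝕜 (Com 𝕜)).compl₁₂ (.fst 𝕜 _ _) (.fst 𝕜 _ _)).compr₂ (.inl 𝕜 _ _)
  | .beta => ((LinearMap.mul 𝕜 (Lie 𝕜) - (LinearMap.mul 𝕜 (Lie 𝕜)).flip).compl₁₂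
      (.snd 𝕜 _ _) (.snd 𝕜 _ _)).compr₂ (.inr 𝕜 _ _)
  | .d => (LinearMap.mk₂ 𝕜 (fun (x : Com 𝕜 × Lie 𝕜) (y : Com 𝕜 × Lie 𝕜) => derivation y.2 x.1)
      (by simp) (by simp) (by simp) (by simp)).compr₂ (.inl 𝕜 _ _)
  | .m => (moduleAct.toLinearMap.compl₁₂ (.fst 𝕜 _ _) (.snd 𝕜 _ _)).compr₂ (.inr 𝕜 _ _)

theorem op_alpha (x y : Com 𝕜 × Lie 𝕜) : op .alpha x y = (x.1 * y.1, 0) := rfl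

theorem op_beta (x y : Com 𝕜 × Lie 𝕜) : op .beta x y = (0, x.2 * y.2 - y.2 * x.2) := rfl

theorem op_d (x y : Com 𝕜 × Lie 𝕜) : op .d x y = (derivation y.2 x.1, 0) := rfl

theorem op_m (x y : Com 𝕜 × Lie 𝕜) : op .m x y = (0, moduleAct x.1 y.2) := rfl

/-- No compatibility between the module structure and the bracket or the action is required in
`DerCom`. This is why the module structure can be chosen independently of both. -/
theorem isDerComAlgebra_op : IsDerComAlgebra (op : SymOp → Com 𝕜 × Lie 𝕜 →ₗ[𝕜] _) where
  alpha_comm x y := by rw [op_alpha, op_alpha, mul_comm]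
  beta_neg x y := by rw [op_beta, op_beta, Prod.neg_mk, neg_sub, neg_zero]
  alpha_assoc x y z := by simp only [op_alpha, mul_assoc]
  jacobi x y z := by
    simp only [op_beta, Prod.mk_add_mk, add_zero]
    congr 1
    noncomm_ring
  leibniz x y z := by
    simp only [op_alpha, op_d, Prod.mk_add_mk, add_zero, Derivation.leibniz, smul_eq_mul]
    congr 2
    ring
  action x y z := by
    simp only [op_beta, op_d, derivation_commutator, Prod.mk_sub_mk, sub_zero]
  module x y z := by
    simp only [op_alpha, op_m, map_mul, Module.End.mul_apply]

end Model

namespace Model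

/-! ### Keys of words -/

theorem cross_add_left (A B C : Multiset ℕ∞) : cross (A + B) C = cross A C + cross B C := by
  simp [cross]

theorem cross_add_right (A B C : Multiset ℕ∞) : cross A (B + C) = cross A B + cross A C := by
  simp [cross, Multiset.sum_map_add]

@[simp]
theorem cross_zero_right (A : Multiset ℕ∞) : cross A 0 = 0 := by simp [cross]

@[simp]
theorem cross_zero_left (A : Multiset ℕ∞) : cross 0 A = 0 := by simp [cross]

@[simp]
theorem profile_nil : profile [] = 0 := rfl

theorem profile_cons (x : Letter) (w : Word) : profile (x :: w) = {x.low} + profile w := by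
  simp [profile, ← Multiset.cons_coe]

theorem profile_append (v w : Word) : profile (v ++ w) = profile v + profile w := by
  simp [profile, ← Multiset.coe_add]

theorem card_profile (w : Word) : (profile w).card = w.length := by
  simp [profile]

/-- Inversions lie inside one factor or between the two. The mixed term depends only on the
profiles; for words of fixed profiles concatenation therefore adds keys up to a constant. -/
theorem wordKey_append (v w : Word) :
    wordKey (v ++ w) = wordKey v + wordKey w + cross (profile v) (profile w) := by
  induction v with
  | nil => simp [wordKey]
  | cons x v ih =>
    rw [List.cons_append, wordKey, wordKey, ih, profile_append, cross_add_right, profile_cons,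
      cross_add_left]
    abel

theorem cross_apply_of_notMem {A B : Multiset ℕ∞} {j : ℕ∞} (h : j ∉ B) :
    ofLex (cross A B) j = 0 := by
  induction A using Multiset.induction with
  | empty => simp
  | cons x A ih =>
    rw [← Multiset.singleton_add, cross_add_left, ofLex_add, Finsupp.add_apply, ih, add_zero]
    induction B using Multiset.induction with
    | empty => simp
    | cons y B ih' =>
      rw [Multiset.mem_cons, not_or] at h
      rw [← Multiset.singleton_add, cross_add_right, ofLex_add, Finsupp.add_apply, ih' h.2 _,
        add_zero]
      · simp only [cross, Multiset.map_singleton, Multiset.sum_singleton]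
        split
        · simp [h.1]
        · rfl
      · have := ih
        rw [← Multiset.singleton_add, cross_add_right, ofLex_add, Finsupp.add_apply] at this
        omega

theorem cross_apply_pos {A B : Multiset ℕ∞} {p b : ℕ∞} (hp : p ∈ A) (hb : b ∈ B) (h : p < b) :
    0 < ofLex (cross B A) p := by
  obtain ⟨A, rfl⟩ := Multiset.exists_cons_of_mem hp
  obtain ⟨B, rfl⟩ := Multiset.exists_cons_of_mem hb
  have e : ofLex (cross {b} {p}) p = 1 := by
    simp [cross, h]
  rw [← Multiset.singleton_add, ← Multiset.singleton_add, cross_add_left, cross_add_right,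
    ofLex_add, ofLex_add, Finsupp.add_apply, Finsupp.add_apply, e]
  omega

/-- Putting the part with the smallest label first gives the smaller key. -/
theorem cross_lt_cross {A B : Multiset ℕ∞} {p b : ℕ∞} (hp : p ∈ A) (hA : ∀ a ∈ A, p ≤ a)
    (hb : b ∈ B) (hB : ∀ b ∈ B, p < b) : cross A B < cross B A := by
  -- Below the smallest label `p` neither order has inversions, and at `p` inversions arise only
  -- when `B` comes first.
  refine Finsupp.Lex.lt_iff.mpr ⟨p, fun j hj => ?_, ?_⟩
  · rw [cross_apply_of_notMem fun h => (hj.trans (hB j h)).false,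
      cross_apply_of_notMem fun h => (hj.trans_le (hA j h)).false]
  · rw [cross_apply_of_notMem fun h => (hB p h).false]
    exact cross_apply_pos hp hb (hB b hb)

theorem monKey_add (f g : Mon) : monKey (f + g) = monKey f + monKey g :=
  Finsupp.sum_add_index' (fun _ => zero_smul _ _) fun _ _ _ => add_smul _ _ _

theorem monKey_single (T : Atom) : monKey (Finsupp.single T 1) = wordKey T.1 := by
  simp [monKey]

theorem monLow_single (T : Atom) : monLow (Finsupp.single T 1) = atomLow T := by
  rw [monLow, Finsupp.support_single _ one_ne_zero, Finset.inf_singleton]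

theorem monLow_add (f g : Mon) : monLow (f + g) = min (monLow f) (monLow g) := by
  classical
  have : (f + g).support = f.support ∪ g.support := by
    ext T
    simp only [Finsupp.mem_support_iff, Finset.mem_union, Finsupp.add_apply]
    omega
  rw [monLow, this, Finset.inf_union]
  rfl

theorem wordKey_modLetter (f : Mon) (w : Word) :
    wordKey [modLetter f w] = monKey f + wordKey w := by
  simp [wordKey, Letter.key, modLetter]

theorem profile_modLetter (f : Mon) (w : Word) :
    profile [modLetter f w] = {min (monLow f) (profile w).inf} := rfl

/-! ### Leading basis elements -/

section Lead

variable {𝕜 : Type*} [Field 𝕜] {ι ι' ι'' V V' V'' : Type*} [AddCommGroup V] [Module 𝕜 V]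
  [AddCommGroup V'] [Module 𝕜 V'] [AddCommGroup V''] [Module 𝕜 V'']

variable (𝕜) in
/-- The element `x` is `e i` plus a combination of elements `e j` with `j ∈ S` of larger key. -/
def IsLead (e : ι → V) (key : ι → Key) (S : Set ι) (x : V) (i : ι) : Prop :=
  i ∈ S ∧ x - e i ∈ Submodule.span 𝕜 (e '' {j ∈ S | key i < key j})

variable {e : ι → V} {key : ι → Key} {S : Set ι} {x : V} {i : ι}
  {e' : ι' → V'} {key' : ι' → Key} {S' : Set ι'} {x' : V'} {i' : ι'}
  {e'' : ι'' → V''} {key'' : ι'' → Key} {S'' : Set ι''}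

theorem isLead_self (hi : i ∈ S) : IsLead 𝕜 e key S (e i) i :=
  ⟨hi, by rw [sub_self]; exact zero_mem _⟩

theorem IsLead.mem_span (h : IsLead 𝕜 e key S x i) :
    x ∈ Submodule.span 𝕜 (e '' {j ∈ S | key i ≤ key j}) := by
  have h1 : e i ∈ Submodule.span 𝕜 (e '' {j ∈ S | key i ≤ key j}) :=
    Submodule.subset_span ⟨i, ⟨h.1, le_rfl⟩, rfl⟩
  have hs : {j ∈ S | key i < key j} ⊆ {j ∈ S | key i ≤ key j} := fun j hj => ⟨hj.1, hj.2.le⟩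
  have h2 : x - e i ∈ Submodule.span 𝕜 (e '' {j ∈ S | key i ≤ key j}) :=
    Submodule.span_mono (Set.image_mono hs) h.2
  simpa using add_mem h2 h1

theorem IsLead.map (h : IsLead 𝕜 e key S x i) (B : V →ₗ[𝕜] V') (o : ι → ι')
    (he : ∀ a ∈ S, B (e a) = e' (o a)) (hS : ∀ a ∈ S, o a ∈ S')
    (hk : ∀ a ∈ S, key' (o a) = key a) : IsLead 𝕜 e' key' S' (B x) (o i) := by
  refine ⟨hS i h.1, ?_⟩
  rw [← he i h.1, ← map_sub]
  have := Submodule.mem_map_of_mem (f := B) h.2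
  rw [Submodule.map_span] at this
  refine Submodule.span_mono ?_ this
  rintro _ ⟨_, ⟨a, ⟨ha, hia⟩, rfl⟩, rfl⟩
  exact ⟨o a, ⟨hS a ha, by rwa [hk i h.1, hk a ha]⟩, (he a ha).symm⟩

theorem mem_span_map₂ {T : Set ι} {T' : Set ι'} {T'' : Set ι''} {x : V} {x' : V'}
    (hx : x ∈ Submodule.span 𝕜 (e '' T)) (hx' : x' ∈ Submodule.span 𝕜 (e' '' T'))
    (B : V →ₗ[𝕜] V' →ₗ[𝕜] V'') (o : ι → ι' → ι'')
    (he : ∀ a ∈ T, ∀ b ∈ T', B (e a) (e' b) = e'' (o a b))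
    (hT : ∀ a ∈ T, ∀ b ∈ T', o a b ∈ T'') :
    B x x' ∈ Submodule.span 𝕜 (e'' '' T'') := by
  have := Submodule.apply_mem_map₂ B hx hx'
  rw [Submodule.map₂_span_span] at this
  refine Submodule.span_mono ?_ this
  rintro _ ⟨_, ⟨a, ha, rfl⟩, _, ⟨b, hb, rfl⟩, rfl⟩
  exact ⟨o a b, hT a ha b hb, (he a ha b hb).symm⟩

/-- If keys add up to a constant `κ`, every product other than that of the two leading elements has
a strictly larger key. The map `o` on indices need not be injective. -/
theorem IsLead.map₂ (h : IsLead 𝕜 e key S x i) (h' : IsLead 𝕜 e' key' S' x' i')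
    (B : V →ₗ[𝕜] V' →ₗ[𝕜] V'') (o : ι → ι' → ι'') (κ : Key)
    (he : ∀ a ∈ S, ∀ b ∈ S', B (e a) (e' b) = e'' (o a b))
    (hS : ∀ a ∈ S, ∀ b ∈ S', o a b ∈ S'')
    (hk : ∀ a ∈ S, ∀ b ∈ S', key'' (o a b) = key a + key' b + κ) :
    IsLead 𝕜 e'' key'' S'' (B x x') (o i i') := by
  refine ⟨hS i h.1 i' h'.1, ?_⟩
  -- Each summand contains one remainder, which makes the key inequality strict.
  have e1 : B x x' - e'' (o i i') = B x (x' - e' i') + B (x - e i) (e' i') := by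
    rw [← he i h.1 i' h'.1]
    simp
  rw [e1]
  refine add_mem ?_ ?_
  · refine mem_span_map₂ h.mem_span h'.2 B o (fun a ha b hb => he a ha.1 b hb.1)
      fun a ha b hb => ⟨hS a ha.1 b hb.1, ?_⟩
    rw [hk i h.1 i' h'.1, hk a ha.1 b hb.1]
    exact add_lt_add_left (add_lt_add_of_le_of_lt ha.2 hb.2) κ
  · refine mem_span_map₂ (T' := {i'}) h.2 (Submodule.subset_span (Set.mem_image_of_mem e' rfl)) B o
      (fun a ha b hb => he a ha.1 b (hb ▸ h'.1)) fun a ha b hb => ?_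
    obtain rfl : b = i' := hb
    refine ⟨hS a ha.1 b h'.1, ?_⟩
    rw [hk i h.1 b h'.1, hk a ha.1 b h'.1]
    exact add_lt_add_left (add_lt_add_left ha.2 _) κ

end Lead

end Model

/-! ### Normal trees -/

/-- `g(h(a, b), t)` is divisible by a leading term; `lt` tells whether the smallest label of `b` is
smaller than that of `t`. -/
def LeftReducible : ShOp → ShOp → Bool → Bool
  | .alpha, .alpha, lt => !lt
  | .beta, .beta, lt => lt
  | .d, .alpha, _ => true
  | .n, .m, _ => true
  | .n, .n, _ => true
  | .e, .beta, _ => true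
  | _, _, _ => false

/-- `g(s, h(a, b))` is divisible by a leading term. -/
def RightReducible : ShOp → ShOp → Bool
  | .alpha, .alpha => true
  | .e, .alpha => true
  | .m, .m => true
  | .m, .n => true
  | .d, .beta => true
  | _, _ => false

/-- A leading term occurs at the root. -/
def RootReducible : Tree Colour ShOp → Prop
  | .leaf _ _ => False
  | .node g s t =>
    (∃ h a b, s = .node h a b ∧ LeftReducible g h (decide (b.minLabel < t.minLabel)) = true) ∨
      ∃ h a b, t = .node h a b ∧ RightReducible g h = true

/-- No leading term occurs anywhere. -/
def IsNormal : Tree Colour ShOp → Prop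
  | .leaf _ _ => True
  | .node g s t => ¬ RootReducible (.node g s t) ∧ IsNormal s ∧ IsNormal t

/-- The operation at the root. -/
def rootOp : Tree Colour ShOp → Option ShOp
  | .leaf _ _ => none
  | .node g _ _ => some g

theorem IsNormal.left {g h : ShOp} {s t : Tree Colour ShOp} (hn : IsNormal (.node g s t))
    (hg : ∀ lt, LeftReducible g h lt = true) : rootOp s ≠ some h := by
  rintro hs
  cases s with
  | leaf a i => simp [rootOp] at hs
  | node k a b =>
    simp only [rootOp, Option.some.injEq] at hs
    subst hs
    exact hn.1 (Or.inl ⟨k, a, b, rfl, hg _⟩)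

theorem IsNormal.right {g h : ShOp} {s t : Tree Colour ShOp} (hn : IsNormal (.node g s t))
    (hg : RightReducible g h = true) : rootOp t ≠ some h := by
  rintro hs
  cases t with
  | leaf a i => simp [rootOp] at hs
  | node k a b =>
    simp only [rootOp, Option.some.injEq] at hs
    subst hs
    exact hn.1 (Or.inr ⟨k, a, b, rfl, hg⟩)

namespace Model

/-- The leading basis elements of the value of a tree, as a word, a monomial and an atom. -/
noncomputable def leadTerm : Tree Colour ShOp → Word × Mon × Atom
  | .leaf .c i => ([], Finsupp.single ([], i) 1, ([], i))
  | .leaf .l i => ([genLetter i], 0, ([], 0))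
  | .node .alpha s t => ([], (leadTerm s).2.1 + (leadTerm t).2.1, ([], 0))
  | .node .beta s t => ((leadTerm s).1 ++ (leadTerm t).1, 0, ([], 0))
  | .node .d s t =>
    ([], Finsupp.single ((leadTerm t).1 ++ (leadTerm s).2.2.1, (leadTerm s).2.2.2) 1,
      ((leadTerm t).1 ++ (leadTerm s).2.2.1, (leadTerm s).2.2.2))
  | .node .e s t =>
    ([], Finsupp.single ((leadTerm s).1 ++ (leadTerm t).2.2.1, (leadTerm t).2.2.2) 1,
      ((leadTerm s).1 ++ (leadTerm t).2.2.1, (leadTerm t).2.2.2))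
  | .node .m s t => ([modLetter (leadTerm s).2.1 (leadTerm t).1], 0, ([], 0))
  | .node .n s t => ([modLetter (leadTerm t).2.1 (leadTerm s).1], 0, ([], 0))

/-- The leading word of a tree with output `l`. -/
noncomputable def leadWord (t : Tree Colour ShOp) : Word := (leadTerm t).1

/-- The leading monomial of a tree with output `c`. -/
noncomputable def leadMon (t : Tree Colour ShOp) : Mon := (leadTerm t).2.1

/-- The leading atom of a tree with output `c` whose root is not `α`. -/
noncomputable def leadAtom (t : Tree Colour ShOp) : Atom := (leadTerm t).2.2

section
variable (s t : Tree Colour ShOp) (i : ℕ)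

theorem leadWord_leaf : leadWord (.leaf .l i) = [genLetter i] := rfl
theorem leadWord_beta : leadWord (.node .beta s t) = leadWord s ++ leadWord t := rfl
theorem leadWord_m : leadWord (.node .m s t) = [modLetter (leadMon s) (leadWord t)] := rfl
theorem leadWord_n : leadWord (.node .n s t) = [modLetter (leadMon t) (leadWord s)] := rfl
theorem leadMon_alpha : leadMon (.node .alpha s t) = leadMon s + leadMon t := rfl
theorem leadAtom_leaf : leadAtom (.leaf .c i) = ([], i) := rfl
theorem leadAtom_d :
    leadAtom (.node .d s t) = (leadWord t ++ (leadAtom s).1, (leadAtom s).2) := rfl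
theorem leadAtom_e :
    leadAtom (.node .e s t) = (leadWord s ++ (leadAtom t).1, (leadAtom t).2) := rfl

end

theorem leadMon_eq_single {t : Tree Colour ShOp} (ho : t.outColour shSig = .c)
    (hr : rootOp t ≠ some .alpha) : leadMon t = Finsupp.single (leadAtom t) 1 := by
  cases t with
  | leaf a i => cases a <;> first | rfl | cases ho
  | node g s t => cases g <;> first | exact absurd rfl hr | rfl | cases ho

theorem leadWord_ne_nil {t : Tree Colour ShOp} (ho : t.outColour shSig = .l)
    (hw : t.WellColoured shSig) : leadWord t ≠ [] := by
  induction t with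
  | leaf a i =>
    cases a with
    | c => cases ho
    | l => rw [leadWord_leaf]; simp
  | node g s t hs ht =>
    obtain ⟨h1, h2, h3, h4⟩ := hw
    cases g with
    | beta => rw [leadWord_beta]; simp [hs h1 h3]
    | m => rw [leadWord_m]; simp
    | n => rw [leadWord_n]; simp
    | _ => cases ho

/-- The lowest labels of the leading basis elements. -/
theorem low_leadTerm {t : Tree Colour ShOp} (hw : t.WellColoured shSig) (hn : IsNormal t) :
    (t.outColour shSig = .l → (profile (leadWord t)).inf = t.minLabel ∧
      (t.minLabel : ℕ∞) ∈ profile (leadWord t)) ∧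
    (t.outColour shSig = .c → monLow (leadMon t) = t.minLabel) ∧
    (t.outColour shSig = .c → rootOp t ≠ some .alpha → atomLow (leadAtom t) = t.minLabel) := by
  have mon : (t.outColour shSig = .c → rootOp t ≠ some .alpha →
      atomLow (leadAtom t) = t.minLabel) → t.outColour shSig = .c → rootOp t ≠ some .alpha →
      monLow (leadMon t) = t.minLabel := by
    intro h ho hr
    rw [leadMon_eq_single ho hr, monLow_single, h ho hr]
  induction t with
  | leaf a i =>
    cases a with
    | c =>
      have h : atomLow (leadAtom (.leaf .c i)) = i := by
        simp [leadAtom_leaf, atomLow]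
      exact ⟨fun ho => (by cases ho), fun ho => mon (fun _ _ => h) ho (by simp [rootOp]),
        fun _ _ => h⟩
    | l =>
      refine ⟨fun _ => ?_, fun ho => (by cases ho), fun ho => (by cases ho)⟩
      simp [leadWord_leaf, profile_cons, genLetter, Letter.low, Tree.minLabel]
  | node g s t hs ht =>
    obtain ⟨h1, h2, h3, h4⟩ := hw
    have ms := fun h : s.outColour shSig = .c → rootOp s ≠ some .alpha →
      atomLow (leadAtom s) = s.minLabel => fun ho hr =>
        (by rw [leadMon_eq_single ho hr, monLow_single, h ho hr] :
          monLow (leadMon s) = s.minLabel)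
    have mt := fun h : t.outColour shSig = .c → rootOp t ≠ some .alpha →
      atomLow (leadAtom t) = t.minLabel => fun ho hr =>
        (by rw [leadMon_eq_single ho hr, monLow_single, h ho hr] :
          monLow (leadMon t) = t.minLabel)
    replace hs := hs h3 hn.2.1 ms
    replace ht := ht h4 hn.2.2 mt
    have hmin : ((Tree.node g s t).minLabel : ℕ∞) = min (s.minLabel : ℕ∞) t.minLabel :=
      (Nat.mono_cast (α := ℕ∞)).map_min
    cases g with
    | alpha =>
      refine ⟨fun ho => (by cases ho), fun _ => ?_, fun _ hr => absurd rfl hr⟩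
      rw [leadMon_alpha, monLow_add, hs.2.1 h1, ht.2.1 h2, hmin]
    | beta =>
      refine ⟨fun _ => ?_, fun ho => (by cases ho), fun ho => (by cases ho)⟩
      rw [leadWord_beta, profile_append, Multiset.inf_add, (hs.1 h1).1, (ht.1 h2).1, hmin]
      refine ⟨rfl, ?_⟩
      rw [Multiset.mem_add]
      rcases min_choice (s.minLabel : ℕ∞) t.minLabel with h | h <;> rw [h]
      exacts [Or.inl (hs.1 h1).2, Or.inr (ht.1 h2).2]
    | d =>
      -- Normality forbids a product as the argument of an action, so the leading term of `s` is a
      -- single atom.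
      have hr := hn.left (h := .alpha) (fun _ => rfl)
      have h : atomLow (leadAtom (.node .d s t)) = (Tree.node .d s t).minLabel := by
        have := hs.2.2 h1 hr
        rw [atomLow] at this
        rw [leadAtom_d, atomLow, profile_append, Multiset.inf_add, (ht.1 h2).1, hmin, ← this]
        simp only [inf_assoc]
        exact inf_comm _ _ |>.trans (by simp only [inf_assoc, inf_comm, inf_left_comm])
      exact ⟨fun ho => (by cases ho), fun ho => mon (fun _ _ => h) ho (by simp [rootOp]),
        fun _ _ => h⟩
    | e =>
      have hr := hn.right (h := .alpha) rfl
      have h : atomLow (leadAtom (.node .e s t)) = (Tree.node .e s t).minLabel := by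
        have := ht.2.2 h2 hr
        rw [atomLow] at this
        rw [leadAtom_e, atomLow, profile_append, Multiset.inf_add, (hs.1 h1).1, hmin, ← this]
        simp only [inf_assoc]
      exact ⟨fun ho => (by cases ho), fun ho => mon (fun _ _ => h) ho (by simp [rootOp]),
        fun _ _ => h⟩
    | m =>
      refine ⟨fun _ => ?_, fun ho => (by cases ho), fun ho => (by cases ho)⟩
      rw [leadWord_m, profile_modLetter, hs.2.1 h1, (ht.1 h2).1, hmin]
      simp
    | n =>
      refine ⟨fun _ => ?_, fun ho => (by cases ho), fun ho => (by cases ho)⟩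
      rw [leadWord_n, profile_modLetter, ht.2.1 h2, (hs.1 h1).1, hmin, min_comm]
      simp

/-! ### Values of normal trees -/

variable {𝕜 : Type*} [Field 𝕜]

/-- The generic values of the leaves. -/
noncomputable def generic : Colour → ℕ → Com 𝕜 × Lie 𝕜
  | .c, i => (MvPolynomial.X ([], i), 0)
  | .l, i => (0, ofWord [genLetter i])

variable (𝕜) in
/-- The value of a tree in the model. -/
noncomputable def value (t : Tree Colour ShOp) : Com 𝕜 × Lie 𝕜 := t.eval (shuffleOp op) generic

variable (s t : Tree Colour ShOp)

theorem value_beta : value 𝕜 (.node .beta s t) =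
    (0, (value 𝕜 s).2 * (value 𝕜 t).2 - (value 𝕜 t).2 * (value 𝕜 s).2) := rfl

/-- The words that may occur in the value of a tree. -/
def wordSupport : Set Word :=
  {w | profile w = profile (leadWord t) ∧
    (rootOp t ≠ some .m → rootOp t ≠ some .n → ¬ IsModuleWord w)}

/-- The monomials that may occur in the value of a tree. -/
def monSupport : Set Mon := {f | f ≠ 0 ∧ monLow f = monLow (leadMon t)}

/-- The atoms that may occur in the value of a tree. -/
def atomSupport : Set Atom :=
  {T | profile T.1 = profile (leadAtom t).1 ∧ T.2 = (leadAtom t).2}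

variable (𝕜) in
/-- The value of `t` has the expected leading word. -/
def HasLeadWord : Prop :=
  IsLead 𝕜 ofWord wordKey (wordSupport t) (value 𝕜 t).2 (leadWord t)

variable (𝕜) in
/-- The value of `t` has the expected leading monomial. -/
def HasLeadMon : Prop :=
  IsLead 𝕜 ofMon monKey (monSupport t) (value 𝕜 t).1 (leadMon t)

variable (𝕜) in
/-- The value of `t` has the expected leading atom. -/
def HasLeadAtom : Prop :=
  IsLead 𝕜 MvPolynomial.X (fun T => wordKey T.1) (atomSupport t) (value 𝕜 t).1 (leadAtom t)

variable {s t}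

theorem not_isModuleWord_of_length {w : Word} (h : 2 ≤ w.length) : ¬ IsModuleWord w := by
  rintro ⟨p, -, rfl⟩
  simp at h

theorem HasLeadAtom.hasLeadMon (h : HasLeadAtom 𝕜 t) (ho : t.outColour shSig = .c)
    (hr : rootOp t ≠ some .alpha) : HasLeadMon 𝕜 t := by
  have hm := leadMon_eq_single ho hr
  rw [HasLeadMon, hm]
  refine IsLead.map h LinearMap.id (fun T => Finsupp.single T 1) (fun _ _ => rfl)
    (fun T hT => ?_) fun T _ => monKey_single T
  refine ⟨by simp, ?_⟩
  rw [hm, monLow_single, monLow_single, atomLow, atomLow, hT.1, hT.2]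

theorem hasLeadMon_alpha (hs : HasLeadMon 𝕜 s) (ht : HasLeadMon 𝕜 t) :
    HasLeadMon 𝕜 (.node .alpha s t) := by
  refine IsLead.map₂ hs ht (LinearMap.mul 𝕜 (Com 𝕜)) (· + ·) 0 (fun a _ b _ => ofMon_mul a b)
    (fun a ha b hb => ⟨fun h => ha.1 (add_eq_zero.mp h).1, ?_⟩)
    fun a _ b _ => by rw [monKey_add, add_zero]
  rw [leadMon_alpha, monLow_add, monLow_add, ha.2, hb.2]

/-- On atoms the action is concatenation of words, and the inversions it creates are the same for
all words and atoms of the fixed profiles. -/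
theorem isLead_derivation {u v : Tree Colour ShOp} {A : Set Atom}
    (hA : ∀ T : Atom, profile T.1 = profile (leadWord v) + profile (leadAtom u).1 →
      T.2 = (leadAtom u).2 → T ∈ A)
    (hu : HasLeadAtom 𝕜 u) (hv : HasLeadWord 𝕜 v) :
    IsLead 𝕜 MvPolynomial.X (fun T => wordKey T.1) A (derivation (value 𝕜 v).2 (value 𝕜 u).1)
      (leadWord v ++ (leadAtom u).1, (leadAtom u).2) := by
  let B : Lie 𝕜 →ₗ[𝕜] Com 𝕜 →ₗ[𝕜] Com 𝕜 :=
    LinearMap.mk₂ 𝕜 (fun X f => derivation X f) (by simp) (by simp) (by simp) (by simp)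
  refine IsLead.map₂ (B := B) hv hu (fun w T => (w ++ T.1, T.2))
    (cross (profile (leadWord v)) (profile (leadAtom u).1)) (fun w _ T _ => ?_)
    (fun w hw T hT => hA _ ?_ hT.2) fun w hw T hT => ?_
  · exact (derivation_X _ _).trans (generatorAct_ofWord T w)
  · rw [profile_append, hw.1, hT.1]
  · rw [wordKey_append, hw.1, hT.1]

theorem hasLeadAtom_d (hs : HasLeadAtom 𝕜 s) (ht : HasLeadWord 𝕜 t) :
    HasLeadAtom 𝕜 (.node .d s t) :=
  isLead_derivation (fun T h1 h2 => ⟨by rw [h1, leadAtom_d, profile_append], h2⟩) hs ht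

theorem hasLeadAtom_e (hs : HasLeadWord 𝕜 s) (ht : HasLeadAtom 𝕜 t) :
    HasLeadAtom 𝕜 (.node .e s t) :=
  isLead_derivation (fun T h1 h2 => ⟨by rw [h1, leadAtom_e, profile_append], h2⟩) ht hs

/-- As `m` and `n` do not occur at the root of `v`, no word in its value is a module word. Monomials
then act by creating new letters, and no two module letters have to be merged. -/
theorem isLead_moduleAct {u v : Tree Colour ShOp} {A : Set Word}
    (hA : ∀ w : Word, profile w = {min (monLow (leadMon u)) (profile (leadWord v)).inf} → w ∈ A)
    (hm : rootOp v ≠ some .m) (hn : rootOp v ≠ some .n)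
    (hu : HasLeadMon 𝕜 u) (hv : HasLeadWord 𝕜 v) :
    IsLead 𝕜 ofWord wordKey A (moduleAct (value 𝕜 u).1 (value 𝕜 v).2)
      [modLetter (leadMon u) (leadWord v)] := by
  refine IsLead.map₂ (B := moduleAct.toLinearMap) hu hv (fun f w => [modLetter f w]) 0
    (fun f hf w hw => ?_) (fun f hf w hw => hA _ ?_) fun f hf w hw => ?_
  · exact (moduleAct_ofMon_ofWord f w).trans (by rw [monAct_of_not hf.1 (hw.2 hm hn)])
  · rw [profile_modLetter, hf.2, hw.1]
  · rw [wordKey_modLetter, add_zero]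

theorem hasLeadWord_m (hm : rootOp t ≠ some .m) (hn : rootOp t ≠ some .n)
    (hs : HasLeadMon 𝕜 s) (ht : HasLeadWord 𝕜 t) : HasLeadWord 𝕜 (.node .m s t) :=
  isLead_moduleAct (fun w h => ⟨by rw [h, leadWord_m, profile_modLetter],
    fun h => absurd rfl h⟩) hm hn hs ht

theorem hasLeadWord_n (hm : rootOp s ≠ some .m) (hn : rootOp s ≠ some .n)
    (hs : HasLeadWord 𝕜 s) (ht : HasLeadMon 𝕜 t) : HasLeadWord 𝕜 (.node .n s t) :=
  isLead_moduleAct (fun w h => ⟨by rw [h, leadWord_n, profile_modLetter],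
    fun _ h => absurd rfl h⟩) hm hn ht hs

/-- The product in the given order has the expected leading word, and every word of the reversed
product has a larger key because of the inequality `hc` between the mixed inversions. -/
theorem hasLeadWord_beta (hs : HasLeadWord 𝕜 s) (ht : HasLeadWord 𝕜 t)
    (ns : leadWord s ≠ []) (nt : leadWord t ≠ [])
    (hc : cross (profile (leadWord s)) (profile (leadWord t)) <
      cross (profile (leadWord t)) (profile (leadWord s))) :
    HasLeadWord 𝕜 (.node .beta s t) := by
  -- The length of a word is the size of its profile, so all words in the value have length at least
  -- 2 and cannot be module words.
  have hl : 2 ≤ (leadWord s ++ leadWord t).length := by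
    have := List.length_pos_iff.mpr ns
    have := List.length_pos_iff.mpr nt
    rw [List.length_append]; omega
  have hS : ∀ w : Word, profile w = profile (leadWord s) + profile (leadWord t) →
      w ∈ wordSupport (.node .beta s t) := by
    intro w hw
    have hw' : profile w = profile (leadWord (.node .beta s t)) := by
      rw [hw, leadWord_beta, profile_append]
    refine ⟨hw', fun _ _ => not_isModuleWord_of_length ?_⟩
    rwa [← card_profile, hw', card_profile, leadWord_beta]
  have h1 : IsLead 𝕜 ofWord wordKey (wordSupport (.node .beta s t))
      ((value 𝕜 s).2 * (value 𝕜 t).2) (leadWord s ++ leadWord t) := by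
    refine IsLead.map₂ (B := LinearMap.mul 𝕜 (Lie 𝕜)) hs ht (· ++ ·)
      (cross (profile (leadWord s)) (profile (leadWord t))) (fun v _ w _ => ofWord_mul v w)
      (fun v hv w hw => hS _ ?_) fun v hv w hw => ?_
    · rw [profile_append, hv.1, hw.1]
    · rw [wordKey_append, hv.1, hw.1]
  refine ⟨h1.1, ?_⟩
  rw [value_beta, leadWord_beta]
  change _ - _ - _ ∈ _
  rw [sub_right_comm]
  refine sub_mem h1.2 ?_
  refine mem_span_map₂ ht.mem_span hs.mem_span (LinearMap.mul 𝕜 (Lie 𝕜)) (fun v w => v ++ w)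
    (fun v _ w _ => ofWord_mul v w) fun v hv w hw => ⟨hS _ ?_, ?_⟩
  · rw [profile_append, hv.1.1, hw.1.1, add_comm]
  · rw [wordKey_append, wordKey_append, hv.1.1, hw.1.1, add_comm (wordKey (leadWord s))]
    exact add_lt_add_of_le_of_lt (add_le_add hv.2 hw.2) hc

/-- The leading basis elements of the values of normal shuffle trees. -/
theorem hasLead (𝕜 : Type*) [Field 𝕜] {t : Tree Colour ShOp} (hw : t.WellColoured shSig)
    (hsh : t.IsShuffle) (hn : IsNormal t) :
    (t.outColour shSig = .l → HasLeadWord 𝕜 t) ∧ (t.outColour shSig = .c → HasLeadMon 𝕜 t) ∧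
    (t.outColour shSig = .c → rootOp t ≠ some .alpha → HasLeadAtom 𝕜 t) := by
  induction t with
  | leaf a i =>
    cases a with
    | c =>
      have h : HasLeadAtom 𝕜 (.leaf .c i) := isLead_self ⟨rfl, rfl⟩
      exact ⟨fun ho => (by cases ho), fun ho => h.hasLeadMon ho (by simp [rootOp]), fun _ _ => h⟩
    | l =>
      refine ⟨fun _ => isLead_self ⟨rfl, fun _ _ => ?_⟩, fun ho => (by cases ho),
        fun ho => (by cases ho)⟩
      rintro ⟨p, -, hp⟩
      exact genLetter_ne_modLetter (List.cons.inj hp).1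
  | node g s t hs ht =>
    obtain ⟨h1, h2, h3, h4⟩ := hw
    obtain ⟨k1, k2, k3⟩ := hsh
    replace hs := hs h3 k2 hn.2.1
    replace ht := ht h4 k3 hn.2.2
    cases g with
    | alpha =>
      exact ⟨fun ho => (by cases ho), fun _ => hasLeadMon_alpha (hs.2.1 h1) (ht.2.1 h2),
        fun _ hr => absurd rfl hr⟩
    | beta =>
      refine ⟨fun _ => ?_, fun ho => (by cases ho), fun ho => (by cases ho)⟩
      have ls := (low_leadTerm h3 hn.2.1).1 h1
      have lt := (low_leadTerm h4 hn.2.2).1 h2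
      -- The inequality of mixed inversions comes from the shuffle condition: the smallest label of
      -- `s` lies below all labels of `t`.
      refine hasLeadWord_beta (hs.1 h1) (ht.1 h2) (leadWord_ne_nil h1 h3) (leadWord_ne_nil h2 h4)
        (cross_lt_cross ls.2 (fun a ha => ?_) lt.2 fun b hb => ?_)
      · rw [← ls.1]; exact Multiset.inf_le ha
      · have : (t.minLabel : ℕ∞) ≤ b := by rw [← lt.1]; exact Multiset.inf_le hb
        exact lt_of_lt_of_le (by exact_mod_cast k1) this
    | d =>
      have h := hasLeadAtom_d (hs.2.2 h1 (hn.left fun _ => rfl)) (ht.1 h2)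
      exact ⟨fun ho => (by cases ho), fun ho => h.hasLeadMon ho (by simp [rootOp]), fun _ _ => h⟩
    | e =>
      have h := hasLeadAtom_e (hs.1 h1) (ht.2.2 h2 (hn.right rfl))
      exact ⟨fun ho => (by cases ho), fun ho => h.hasLeadMon ho (by simp [rootOp]), fun _ _ => h⟩
    | m =>
      exact ⟨fun _ => hasLeadWord_m (hn.right rfl) (hn.right rfl) (hs.2.1 h1) (ht.1 h2),
        fun ho => (by cases ho), fun ho => (by cases ho)⟩
    | n =>
      exact ⟨fun _ => hasLeadWord_n (hn.left fun _ => rfl) (hn.left fun _ => rfl) (hs.1 h1)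
        (ht.2.1 h2), fun ho => (by cases ho), fun ho => (by cases ho)⟩

end Model

/-- Normal shuffle trees with distinct labels. -/
structure IsGood (t : Tree Colour ShOp) : Prop where
  wellColoured : t.WellColoured shSig
  isShuffle : t.IsShuffle
  nodup : t.labels.Nodup
  isNormal : IsNormal t

namespace IsGood

variable {g : ShOp} {s t : Tree Colour ShOp}

theorem left (h : IsGood (.node g s t)) : IsGood s :=
  ⟨h.1.2.2.1, h.2.2.1, (Tree.labels_node_nodup.mp h.3).1, h.4.2.1⟩

theorem right (h : IsGood (.node g s t)) : IsGood t :=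
  ⟨h.1.2.2.2, h.2.2.2, (Tree.labels_node_nodup.mp h.3).2.1, h.4.2.2⟩

theorem minLabel_lt (h : IsGood (.node g s t)) : s.minLabel < t.minLabel := h.2.1

theorem left_outColour (h : IsGood (.node g s t)) : s.outColour shSig = shSig.in₁ g := h.1.1

theorem right_outColour (h : IsGood (.node g s t)) : t.outColour shSig = shSig.in₂ g := h.1.2.1

end IsGood

/-! ### Recovering a normal tree from its leading basis element -/

namespace Model

variable {s t : Tree Colour ShOp}

theorem exists_leadWord_eq_singleton (ho : t.outColour shSig = .l)
    (hr : rootOp t ≠ some .beta) : ∃ x, leadWord t = [x] := by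
  cases t with
  | leaf a i => cases a <;> first | exact ⟨_, rfl⟩ | cases ho
  | node g s t => cases g <;> first | exact absurd rfl hr | exact ⟨_, rfl⟩ | cases ho

theorem le_low (h : IsGood t) (ho : t.outColour shSig = .l) {x : Letter} (hx : x ∈ leadWord t) :
    (t.minLabel : ℕ∞) ≤ x.low := by
  rw [← ((low_leadTerm h.1 h.4).1 ho).1]
  exact Multiset.inf_le (List.mem_map_of_mem (f := Letter.low) hx)

theorem exists_low_eq (h : IsGood t) (ho : t.outColour shSig = .l) :
    ∃ x ∈ leadWord t, x.low = t.minLabel :=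
  List.mem_map.mp ((low_leadTerm h.1 h.4).1 ho).2

/-- The first letter of the leading word has the smallest label. -/
theorem lt_low_of_mem_tail (h : IsGood t) (ho : t.outColour shSig = .l) {x : Letter} {w : Word}
    (hw : leadWord t = x :: w) : ∀ y ∈ w, (t.minLabel : ℕ∞) < y.low := by
  induction t generalizing x w with
  | leaf a i =>
    obtain ⟨x', hx⟩ := exists_leadWord_eq_singleton ho (by simp [rootOp])
    rw [hx] at hw
    obtain ⟨-, rfl⟩ := List.cons.inj hw
    simp
  | node g s t hs ht =>
    by_cases hr : rootOp (.node g s t) = some .beta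
    · obtain rfl : g = .beta := by simpa [rootOp] using hr
      obtain ⟨x', w', hs'⟩ := List.exists_cons_of_ne_nil
        (leadWord_ne_nil h.left_outColour h.left.1)
      rw [leadWord_beta, hs', List.cons_append] at hw
      obtain ⟨-, rfl⟩ := List.cons.inj hw
      have hm : (Tree.node ShOp.beta s t).minLabel = s.minLabel := min_eq_left h.minLabel_lt.le
      intro y hy
      rw [hm]
      rcases List.mem_append.mp hy with hy | hy
      · exact hs h.left h.left_outColour hs' y hy
      · exact lt_of_lt_of_le (by exact_mod_cast h.minLabel_lt) (le_low h.right h.right_outColour hy)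
    · obtain ⟨x', hx⟩ := exists_leadWord_eq_singleton ho hr
      rw [hx] at hw
      obtain ⟨-, rfl⟩ := List.cons.inj hw
      simp

theorem head_low (h : IsGood t) (ho : t.outColour shSig = .l) {x : Letter} {w : Word}
    (hw : leadWord t = x :: w) : x.low = t.minLabel := by
  obtain ⟨y, hy, hyl⟩ := exists_low_eq h ho
  rw [hw] at hy
  rcases List.mem_cons.mp hy with rfl | hy
  · exact hyl
  · have := lt_low_of_mem_tail h ho hw y hy
    rw [hyl] at this
    exact absurd this (lt_irrefl _)

/-- The right factor of a bracket starts at the smallest label after the first letter. -/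
theorem lt_low_of_mem_tail_left (h : IsGood (.node .beta s t)) {x : Letter} {w : Word}
    (hw : leadWord s = x :: w) : ∀ y ∈ w, (t.minLabel : ℕ∞) < y.low := by
  induction s generalizing x w t with
  | leaf a i =>
    obtain ⟨x', hx⟩ := exists_leadWord_eq_singleton h.left_outColour (by simp [rootOp])
    rw [hx] at hw
    obtain ⟨-, rfl⟩ := List.cons.inj hw
    simp
  | node g s₁ s₂ hs _ =>
    by_cases hr : rootOp (.node g s₁ s₂) = some .beta
    · obtain rfl : g = .beta := by simpa [rootOp] using hr
      obtain ⟨x', w', hs'⟩ := List.exists_cons_of_ne_nil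
        (leadWord_ne_nil h.left.left_outColour h.left.left.1)
      rw [leadWord_beta, hs', List.cons_append] at hw
      obtain ⟨-, rfl⟩ := List.cons.inj hw
      -- The leading term `β(β(1,2),3)` is forbidden, so nested brackets on the left have decreasing
      -- smallest labels in their right factors.
      have h1 : ¬ s₂.minLabel < t.minLabel := fun hlt =>
        h.4.1 (Or.inl ⟨.beta, s₁, s₂, rfl, by simp [LeftReducible, hlt]⟩)
      have h2 : s₂.minLabel ≠ t.minLabel := fun he =>
        (Tree.labels_node_nodup.mp h.3).2.2 s₂.minLabel
          (by rw [Tree.labels_node]; exact List.mem_append_right _ (Tree.minLabel_mem s₂))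
          (he ▸ Tree.minLabel_mem t)
      have h3 : (t.minLabel : ℕ∞) < s₂.minLabel := by
        exact_mod_cast (by omega : t.minLabel < s₂.minLabel)
      intro y hy
      rcases List.mem_append.mp hy with hy | hy
      · exact h3.trans (hs h.left hs' y hy)
      · exact h3.trans_le (le_low h.left.right h.left.right_outColour hy)
    · obtain ⟨x', hx⟩ := exists_leadWord_eq_singleton h.left_outColour hr
      rw [hx] at hw
      obtain ⟨-, rfl⟩ := List.cons.inj hw
      simp

/-- The boundary between the two factors can be recognised: after the first letter of the whole
word, the letter with the smallest label begins the right factor. -/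
theorem append_leadWord_cancel {s' t' : Tree Colour ShOp} (h : IsGood (.node .beta s t))
    (h' : IsGood (.node .beta s' t'))
    (he : leadWord s ++ leadWord t = leadWord s' ++ leadWord t') :
    leadWord s = leadWord s' ∧ leadWord t = leadWord t' := by
  -- Suppose `s'` were longer by a word starting with `y`. As a later letter of `s'`, `y` has a
  -- label above the smallest label of `t'`. As the first letter of `t` it has the smallest label of
  -- `t`, hence at most that of `t'`.
  have key : ∀ {s t s' t' : Tree Colour ShOp}, IsGood (.node .beta s t) →
      IsGood (.node .beta s' t') → ∀ a : Word, leadWord s' = leadWord s ++ a →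
      leadWord t = a ++ leadWord t' → a = [] := by
    intro s t s' t' h h' a h1 h2
    by_contra ha
    obtain ⟨y, a, rfl⟩ := List.exists_cons_of_ne_nil ha
    obtain ⟨x, w, hx⟩ := List.exists_cons_of_ne_nil (leadWord_ne_nil h.left_outColour h.left.1)
    rw [hx, List.cons_append] at h1
    have l1 := lt_low_of_mem_tail_left h' h1 y (by simp)
    rw [head_low h.right h.right_outColour h2] at l1
    obtain ⟨z, hz, hzl⟩ := exists_low_eq h'.right h'.right_outColour
    have l2 := le_low h.right h.right_outColour (x := z) (by rw [h2]; simp [hz])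
    rw [hzl] at l2
    exact (l1.trans_le l2).false
  rcases List.append_eq_append_iff.mp he with ⟨a, h1, h2⟩ | ⟨a, h1, h2⟩
  · have ha := key h h' a h1 h2
    subst ha
    exact ⟨by simpa using h1.symm, by simpa using h2⟩
  · have ha := key h' h a h1 h2
    subst ha
    exact ⟨by simpa using h1, by simpa using h2.symm⟩

theorem leadMon_ne_zero (h : t.WellColoured shSig) (ho : t.outColour shSig = .c) :
    leadMon t ≠ 0 := by
  induction t with
  | leaf a i => rw [leadMon_eq_single ho (by simp [rootOp])]; simp
  | node g s t hs ht =>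
    by_cases hr : rootOp (.node g s t) = some .alpha
    · obtain rfl : g = .alpha := by simpa [rootOp] using hr
      rw [leadMon_alpha]
      exact fun h0 => hs h.2.2.1 h.1 (add_eq_zero.mp h0).1
    · rw [leadMon_eq_single ho hr]; simp

/-- The last factor of a product has the largest lowest label. -/
theorem atomLow_lt (h : IsGood (.node .alpha s t)) {T : Atom} (hT : T ∈ (leadMon s).support) :
    atomLow T < t.minLabel := by
  classical
  have hlt := h.minLabel_lt
  induction s generalizing t with
  | leaf a i =>
    have hr : rootOp (.leaf a i) ≠ some .alpha := by simp [rootOp]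
    rw [leadMon_eq_single h.left_outColour hr] at hT
    rw [Finset.mem_singleton.mp (Finsupp.support_single_subset hT),
      (low_leadTerm h.left.1 h.left.4).2.2 h.left_outColour hr]
    exact_mod_cast hlt
  | node g s₁ s₂ hs _ =>
    by_cases hr : rootOp (.node g s₁ s₂) = some .alpha
    · obtain rfl : g = .alpha := by simpa [rootOp] using hr
      have h1 : s₂.minLabel < t.minLabel := by
        by_contra hlt
        exact h.4.1 (Or.inl ⟨.alpha, s₁, s₂, rfl, by simp [LeftReducible, hlt]⟩)
      have h1' : (s₂.minLabel : ℕ∞) < t.minLabel := by exact_mod_cast h1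
      have hr2 : rootOp s₂ ≠ some .alpha := h.left.4.right rfl
      rw [leadMon_alpha] at hT
      rcases Finset.mem_union.mp (Finsupp.support_add hT) with hT | hT
      · exact (hs h.left hT h.left.minLabel_lt).trans h1'
      · rw [leadMon_eq_single h.left.right_outColour hr2] at hT
        rwa [Finset.mem_singleton.mp (Finsupp.support_single_subset hT),
          (low_leadTerm h.left.right.1 h.left.right.4).2.2 h.left.right_outColour hr2]
    · rw [leadMon_eq_single h.left_outColour hr] at hT
      rw [Finset.mem_singleton.mp (Finsupp.support_single_subset hT),
        (low_leadTerm h.left.1 h.left.4).2.2 h.left_outColour hr]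
      exact_mod_cast hlt

/-- The last factor has the largest lowest label. If the last atoms differed, each would occur in
the other left factor, and each of the two labels would be smaller than the other. -/
theorem add_leadMon_cancel {s' t' : Tree Colour ShOp} (h : IsGood (.node .alpha s t))
    (h' : IsGood (.node .alpha s' t')) (he : leadMon s + leadMon t = leadMon s' + leadMon t') :
    leadMon s = leadMon s' ∧ leadAtom t = leadAtom t' := by
  have hr : rootOp t ≠ some .alpha := h.4.right rfl
  have hr' : rootOp t' ≠ some .alpha := h'.4.right rfl
  rw [leadMon_eq_single h.right_outColour hr, leadMon_eq_single h'.right_outColour hr'] at he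
  have low := (low_leadTerm h.right.1 h.right.4).2.2 h.right_outColour hr
  have low' := (low_leadTerm h'.right.1 h'.right.4).2.2 h'.right_outColour hr'
  have ha : leadAtom t = leadAtom t' := by
    by_contra hne
    have e1 := DFunLike.congr_fun he (leadAtom t)
    have e2 := DFunLike.congr_fun he (leadAtom t')
    rw [Finsupp.add_apply, Finsupp.add_apply, Finsupp.single_eq_same,
      Finsupp.single_eq_of_ne hne] at e1
    rw [Finsupp.add_apply, Finsupp.add_apply, Finsupp.single_eq_same,
      Finsupp.single_eq_of_ne (Ne.symm hne)] at e2
    have l1 := atomLow_lt h' (T := leadAtom t) (Finsupp.mem_support_iff.mpr (by omega))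
    have l2 := atomLow_lt h (T := leadAtom t') (Finsupp.mem_support_iff.mpr (by omega))
    rw [low] at l1
    rw [low'] at l2
    exact (l1.trans l2).false
  rw [ha] at he
  exact ⟨add_right_cancel he, ha⟩

theorem leadWord_beta_ne_singleton (h : IsGood (.node .beta s t)) {x : Letter} :
    leadWord (.node .beta s t) ≠ [x] := by
  intro he
  have := congrArg List.length he
  rw [leadWord_beta, List.length_append, List.length_singleton] at this
  have := List.length_pos_iff.mpr (leadWord_ne_nil h.left_outColour h.left.1)
  have := List.length_pos_iff.mpr (leadWord_ne_nil h.right_outColour h.right.1)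
  omega

theorem leadMon_alpha_ne_single (h : IsGood (.node .alpha s t)) {T : Atom} :
    leadMon (.node .alpha s t) ≠ Finsupp.single T 1 := by
  intro he
  rw [leadMon_alpha, leadMon_eq_single h.right_outColour (h.4.right rfl)] at he
  by_cases hab : leadAtom t = T
  · rw [hab] at he
    exact leadMon_ne_zero h.left.1 h.left_outColour (add_eq_right.mp he)
  · have := DFunLike.congr_fun he (leadAtom t)
    rw [Finsupp.add_apply, Finsupp.single_eq_same, Finsupp.single_eq_of_ne hab] at this
    omega

/-- An operation and its flip (`d` and `e`, or `m` and `n`) give equal leading elements only when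
their inputs are exchanged, and this contradicts the shuffle condition. -/
theorem not_minLabel_lt_swap {g g' : ShOp} (h : IsGood (.node g s t))
    (h' : IsGood (.node g' t s)) : False :=
  (h.minLabel_lt.trans h'.minLabel_lt).false

/-- Normal trees are determined by the leading basis elements of their values. -/
theorem leadTerm_injective {t t' : Tree Colour ShOp} (h : IsGood t) (h' : IsGood t') :
    (t.outColour shSig = .l → t'.outColour shSig = .l → leadWord t = leadWord t' → t = t') ∧
    (t.outColour shSig = .c → t'.outColour shSig = .c → leadMon t = leadMon t' → t = t') ∧
    (t.outColour shSig = .c → t'.outColour shSig = .c → rootOp t ≠ some .alpha →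
      rootOp t' ≠ some .alpha → leadAtom t = leadAtom t' → t = t') := by
  induction t generalizing t' with
  | leaf a i =>
    have atoms : (Tree.leaf a i : Tree Colour ShOp).outColour shSig = .c →
        t'.outColour shSig = .c → rootOp t' ≠ some .alpha →
        leadAtom (.leaf a i) = leadAtom t' → Tree.leaf a i = t' := by
      intro ho ho' hr' he
      obtain rfl : a = .c := ho
      cases t' with
      | leaf b j =>
        obtain rfl : b = .c := ho'
        rw [leadAtom_leaf, leadAtom_leaf, Prod.mk.injEq] at he
        rw [he.2]
      | node g u v =>
        exfalso
        cases g with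
        | alpha => exact hr' rfl
        | d =>
          rw [leadAtom_leaf, leadAtom_d, Prod.mk.injEq] at he
          exact leadWord_ne_nil h'.right_outColour h'.right.1
            (List.append_eq_nil_iff.mp he.1.symm).1
        | e =>
          rw [leadAtom_leaf, leadAtom_e, Prod.mk.injEq] at he
          exact leadWord_ne_nil h'.left_outColour h'.left.1
            (List.append_eq_nil_iff.mp he.1.symm).1
        | _ => cases ho'
    refine ⟨fun ho ho' he => ?_, fun ho ho' he => ?_, fun ho ho' _ hr' he => atoms ho ho' hr' he⟩
    · obtain rfl : a = .l := ho
      cases t' with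
      | leaf b j =>
        obtain rfl : b = .l := ho'
        rw [leadWord_leaf, leadWord_leaf] at he
        rw [genLetter_injective (List.cons.inj he).1]
      | node g u v =>
        exfalso
        cases g with
        | beta =>
          exact leadWord_beta_ne_singleton h' he.symm
        | m => exact genLetter_ne_modLetter (List.cons.inj he).1
        | n => exact genLetter_ne_modLetter (List.cons.inj he).1
        | _ => cases ho'
    · have hr : rootOp (.leaf a i) ≠ some .alpha := by simp [rootOp]
      rw [leadMon_eq_single ho hr] at he
      by_cases hr' : rootOp t' = some .alpha
      · exfalso
        cases t' with
        | leaf b j => simp [rootOp] at hr'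
        | node g u v =>
          obtain rfl : g = .alpha := by simpa [rootOp] using hr'
          exact leadMon_alpha_ne_single h' he.symm
      · rw [leadMon_eq_single ho' hr'] at he
        exact atoms ho ho' hr' (Finsupp.single_left_injective one_ne_zero he)
  | node g s t hs ht =>
    have atoms : (Tree.node g s t).outColour shSig = .c →
        t'.outColour shSig = .c → rootOp (.node g s t) ≠ some .alpha → rootOp t' ≠ some .alpha →
        leadAtom (.node g s t) = leadAtom t' → Tree.node g s t = t' := by
      intro ho ho' hr hr' he
      cases t' with
      | leaf b j =>
        exfalso
        obtain rfl : b = .c := ho'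
        cases g with
        | alpha => exact hr rfl
        | d =>
          rw [leadAtom_leaf, leadAtom_d, Prod.mk.injEq] at he
          exact leadWord_ne_nil h.right_outColour h.right.1
            (List.append_eq_nil_iff.mp he.1).1
        | e =>
          rw [leadAtom_leaf, leadAtom_e, Prod.mk.injEq] at he
          exact leadWord_ne_nil h.left_outColour h.left.1
            (List.append_eq_nil_iff.mp he.1).1
        | _ => cases ho
      | node g' s' t' =>
        cases g with
        | alpha => exact absurd rfl hr
        | d =>
          -- Normality forbids a bracket as the acting element, so the outermost action contributes
          -- exactly one letter, the first letter of the atom.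
          obtain ⟨x, hx⟩ := exists_leadWord_eq_singleton h.right_outColour (h.4.right rfl)
          have hsr : rootOp s ≠ some .alpha := h.4.left fun _ => rfl
          cases g' with
          | alpha => exact absurd rfl hr'
          | d =>
            obtain ⟨x', hx'⟩ := exists_leadWord_eq_singleton h'.right_outColour (h'.4.right rfl)
            have hsr' : rootOp s' ≠ some .alpha := h'.4.left fun _ => rfl
            rw [leadAtom_d, leadAtom_d, Prod.mk.injEq, hx, hx'] at he
            obtain ⟨e1, e2⟩ := List.cons.inj he.1
            rw [(hs h.left h'.left).2.2 h.left_outColour h'.left_outColour hsr hsr'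
                (Prod.ext e2 he.2),
              (ht h.right h'.right).1 h.right_outColour h'.right_outColour (by rw [hx, hx', e1])]
          | e =>
            obtain ⟨x', hx'⟩ := exists_leadWord_eq_singleton h'.left_outColour
              (h'.4.left fun _ => rfl)
            have htr' : rootOp t' ≠ some .alpha := h'.4.right rfl
            rw [leadAtom_d, leadAtom_e, Prod.mk.injEq, hx, hx'] at he
            obtain ⟨e1, e2⟩ := List.cons.inj he.1
            obtain rfl := (hs h.left h'.right).2.2 h.left_outColour h'.right_outColour hsr htr'
                (Prod.ext e2 he.2)
            obtain rfl := (ht h.right h'.left).1 h.right_outColour h'.left_outColour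
              (by rw [hx, hx', e1])
            exact (not_minLabel_lt_swap h h').elim
          | _ => cases ho'
        | e =>
          obtain ⟨x, hx⟩ := exists_leadWord_eq_singleton h.left_outColour (h.4.left fun _ => rfl)
          have htr : rootOp t ≠ some .alpha := h.4.right rfl
          cases g' with
          | alpha => exact absurd rfl hr'
          | d =>
            obtain ⟨x', hx'⟩ := exists_leadWord_eq_singleton h'.right_outColour (h'.4.right rfl)
            have hsr' : rootOp s' ≠ some .alpha := h'.4.left fun _ => rfl
            rw [leadAtom_e, leadAtom_d, Prod.mk.injEq, hx, hx'] at he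
            obtain ⟨e1, e2⟩ := List.cons.inj he.1
            obtain rfl := (ht h.right h'.left).2.2 h.right_outColour h'.left_outColour htr hsr'
                (Prod.ext e2 he.2)
            obtain rfl := (hs h.left h'.right).1 h.left_outColour h'.right_outColour
              (by rw [hx, hx', e1])
            exact (not_minLabel_lt_swap h h').elim
          | e =>
            obtain ⟨x', hx'⟩ := exists_leadWord_eq_singleton h'.left_outColour
              (h'.4.left fun _ => rfl)
            have htr' : rootOp t' ≠ some .alpha := h'.4.right rfl
            rw [leadAtom_e, leadAtom_e, Prod.mk.injEq, hx, hx'] at he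
            obtain ⟨e1, e2⟩ := List.cons.inj he.1
            rw [(ht h.right h'.right).2.2 h.right_outColour h'.right_outColour htr htr'
                (Prod.ext e2 he.2),
              (hs h.left h'.left).1 h.left_outColour h'.left_outColour (by rw [hx, hx', e1])]
          | _ => cases ho'
        | _ => cases ho
    refine ⟨fun ho ho' he => ?_, fun ho ho' he => ?_, atoms⟩
    · cases t' with
      | leaf b j =>
        exfalso
        obtain rfl : b = .l := ho'
        cases g with
        | beta =>
          exact leadWord_beta_ne_singleton h he
        | m => exact genLetter_ne_modLetter (List.cons.inj he).1.symm
        | n => exact genLetter_ne_modLetter (List.cons.inj he).1.symm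
        | _ => cases ho
      | node g' s' t' =>
        cases g with
        | beta =>
          cases g' with
          | beta =>
            obtain ⟨e1, e2⟩ := append_leadWord_cancel h h' he
            rw [(hs h.left h'.left).1 h.left_outColour h'.left_outColour e1,
              (ht h.right h'.right).1 h.right_outColour h'.right_outColour e2]
          | m => exact absurd he (leadWord_beta_ne_singleton h)
          | n => exact absurd he (leadWord_beta_ne_singleton h)
          | _ => cases ho'
        | m =>
          cases g' with
          | beta => exact absurd he.symm (leadWord_beta_ne_singleton h')
          | m =>
            obtain ⟨e1, e2⟩ := modLetter_inj.mp (List.cons.inj he).1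
            rw [(hs h.left h'.left).2.1 h.left_outColour h'.left_outColour e1,
              (ht h.right h'.right).1 h.right_outColour h'.right_outColour e2]
          | n =>
            obtain ⟨e1, e2⟩ := modLetter_inj.mp (List.cons.inj he).1
            obtain rfl := (hs h.left h'.right).2.1 h.left_outColour h'.right_outColour e1
            obtain rfl := (ht h.right h'.left).1 h.right_outColour h'.left_outColour e2
            exact (not_minLabel_lt_swap h h').elim
          | _ => cases ho'
        | n =>
          cases g' with
          | beta => exact absurd he.symm (leadWord_beta_ne_singleton h')
          | m =>
            obtain ⟨e1, e2⟩ := modLetter_inj.mp (List.cons.inj he).1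
            obtain rfl := (ht h.right h'.left).2.1 h.right_outColour h'.left_outColour e1
            obtain rfl := (hs h.left h'.right).1 h.left_outColour h'.right_outColour e2
            exact (not_minLabel_lt_swap h h').elim
          | n =>
            obtain ⟨e1, e2⟩ := modLetter_inj.mp (List.cons.inj he).1
            rw [(ht h.right h'.right).2.1 h.right_outColour h'.right_outColour e1,
              (hs h.left h'.left).1 h.left_outColour h'.left_outColour e2]
          | _ => cases ho'
        | _ => cases ho
    · by_cases hr : rootOp (.node g s t) = some .alpha
      · obtain rfl : g = .alpha := by simpa [rootOp] using hr
        by_cases hr' : rootOp t' = some .alpha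
        · cases t' with
          | leaf b j => simp [rootOp] at hr'
          | node g' s' t' =>
            obtain rfl : g' = .alpha := by simpa [rootOp] using hr'
            obtain ⟨e1, e2⟩ := add_leadMon_cancel h h' he
            rw [(hs h.left h'.left).2.1 h.left_outColour h'.left_outColour e1,
              (ht h.right h'.right).2.2 h.right_outColour h'.right_outColour (h.4.right rfl)
                (h'.4.right rfl) e2]
        · rw [leadMon_eq_single ho' hr'] at he
          exact absurd he (leadMon_alpha_ne_single h)
      · rw [leadMon_eq_single ho hr] at he
        by_cases hr' : rootOp t' = some .alpha
        · cases t' with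
          | leaf b j => simp [rootOp] at hr'
          | node g' s' t' =>
            obtain rfl : g' = .alpha := by simpa [rootOp] using hr'
            exact absurd he.symm (leadMon_alpha_ne_single h')
        · rw [leadMon_eq_single ho' hr'] at he
          exact atoms ho ho' hr hr' (Finsupp.single_left_injective one_ne_zero he)

end Model

namespace Model

/-! ### Independence of normal monomials -/

section Independence

variable {𝕜 : Type*} [Field 𝕜] {t : Tree Colour ShOp}

/-- The index of the leading basis element of the value of a tree. -/
noncomputable def leadIndex (t : Tree Colour ShOp) : Mon ⊕ Word :=
  if t.outColour shSig = .c then .inl (leadMon t) else .inr (leadWord t)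

variable (𝕜) in
/-- The basis of the model. -/
noncomputable def basisVec : Mon ⊕ Word → Com 𝕜 × Lie 𝕜 :=
  Sum.elim (fun f => (ofMon f, 0)) fun w => (0, ofWord w)

/-- The keys of the basis elements of the model. -/
noncomputable def basisKey : Mon ⊕ Word → Key := Sum.elim monKey wordKey

variable (𝕜) in
/-- The coordinates with respect to the basis of the model. -/
noncomputable def coord : Mon ⊕ Word → Com 𝕜 × Lie 𝕜 →ₗ[𝕜] 𝕜 :=
  Sum.elim (fun f => (MvPolynomial.lcoeff 𝕜 f).comp (.fst 𝕜 _ _)) fun w =>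
    ((Finsupp.lapply (FreeMonoid.ofList w)).comp
      (MonoidAlgebra.coeffLinearEquiv 𝕜).toLinearMap).comp (.snd 𝕜 _ _)

open Classical in
theorem coord_basisVec (i j : Mon ⊕ Word) : coord 𝕜 i (basisVec 𝕜 j) = if i = j then 1 else 0 := by
  rcases i with f | v <;> rcases j with g | w
  · simp [coord, basisVec, ofMon, MvPolynomial.coeff_monomial, eq_comm]
  · simp [coord, basisVec]
  · simp [coord, basisVec]
  · simp [coord, basisVec, ofWord, Finsupp.single_apply, eq_comm]

theorem value_snd (h : t.outColour shSig = .c) : (value 𝕜 t).2 = 0 := by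
  cases t with
  | leaf a i => cases a <;> first | rfl | cases h
  | node g s t => cases g <;> first | rfl | cases h

theorem value_fst (h : t.outColour shSig = .l) : (value 𝕜 t).1 = 0 := by
  cases t with
  | leaf a i => cases a <;> first | cases h; done | rfl
  | node g s t => cases g <;> first | cases h; done | rfl

theorem isLead_value (h : IsGood t) :
    IsLead 𝕜 (basisVec 𝕜) basisKey Set.univ (value 𝕜 t) (leadIndex t) := by
  have hl := hasLead 𝕜 h.1 h.2 h.4
  cases ho : t.outColour shSig with
  | c =>
    have e : value 𝕜 t = LinearMap.inl 𝕜 (Com 𝕜) (Lie 𝕜) (value 𝕜 t).1 :=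
      Prod.ext rfl (value_snd ho)
    rw [e, leadIndex, if_pos ho]
    exact IsLead.map (hl.2.1 ho) _ Sum.inl (fun _ _ => rfl) (fun _ _ => trivial) fun _ _ => rfl
  | l =>
    have e : value 𝕜 t = LinearMap.inr 𝕜 (Com 𝕜) (Lie 𝕜) (value 𝕜 t).2 :=
      Prod.ext (value_fst ho) rfl
    rw [e, leadIndex, if_neg (by rw [ho]; simp)]
    exact IsLead.map (hl.1 ho) _ Sum.inr (fun _ _ => rfl) (fun _ _ => trivial) fun _ _ => rfl

theorem leadIndex_injective {s t : Tree Colour ShOp} (hs : IsGood s) (ht : IsGood t)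
    (h : leadIndex s = leadIndex t) : s = t := by
  have hi := leadTerm_injective hs ht
  have two : ∀ a : Colour, a ≠ .c → a = .l := by intro a; cases a <;> simp
  unfold leadIndex at h
  split at h <;> rename_i h1 <;> split at h <;> rename_i h2
  · exact hi.2.1 h1 h2 (Sum.inl_injective h)
  · cases h
  · cases h
  · exact hi.1 (two _ h1) (two _ h2) (Sum.inr_injective h)

/-- A combination of normal monomials that vanishes in the model is zero. -/
theorem eq_zero_of_evalLin_eq_zero {x : Free 𝕜 shSig} (hx : ∀ t ∈ x.support, IsNormal t.1)
    (h : evalLin (shuffleOp op) generic x = 0) : x = 0 := by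
  classical
  by_contra hne
  -- Choose a monomial whose leading key is minimal. The remainders of all values have keys strictly
  -- above this minimum, so the coordinate at its leading element sees only leading elements, which
  -- are distinct.
  obtain ⟨t₀, ht₀, hmin⟩ := Finset.exists_min_image x.support
    (fun t => basisKey (leadIndex t.1)) (Finsupp.support_nonempty_iff.mpr hne)
  have good : ∀ t ∈ x.support, IsGood t.1 := fun t ht =>
    ⟨t.2.wellColoured, t.2.isShuffle, t.2.nodup, hx t ht⟩
  have key : ∀ t ∈ x.support, coord 𝕜 (leadIndex t₀.1) (value 𝕜 t.1) =
      if t = t₀ then 1 else 0 := by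
    intro t ht
    have hl := isLead_value (𝕜 := 𝕜) (good t ht)
    have h0 : coord 𝕜 (leadIndex t₀.1) (value 𝕜 t.1 - basisVec 𝕜 (leadIndex t.1)) = 0 := by
      have : Submodule.span 𝕜 (basisVec 𝕜 '' {j ∈ Set.univ |
          basisKey (leadIndex t.1) < basisKey j}) ≤ LinearMap.ker (coord 𝕜 (leadIndex t₀.1)) := by
        rw [Submodule.span_le]
        rintro _ ⟨j, hj, rfl⟩
        rw [SetLike.mem_coe, LinearMap.mem_ker, coord_basisVec, if_neg]
        rintro rfl
        exact (hj.2.trans_le (hmin t ht)).false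
      exact this hl.2
    rw [map_sub, sub_eq_zero, coord_basisVec] at h0
    rw [h0]
    congr 1
    rw [eq_iff_iff]
    constructor
    · exact fun he => Subtype.ext (leadIndex_injective (good t₀ ht₀) (good t ht) he).symm
    · rintro rfl; rfl
  have hc := congrArg (coord 𝕜 (leadIndex t₀.1)) h
  rw [evalLin_apply, Finsupp.sum, map_sum, map_zero,
    Finset.sum_eq_single_of_mem t₀ ht₀ fun t ht hne => ?_] at hc
  · rw [map_smul] at hc
    have := key t₀ ht₀
    rw [value] at this
    rw [this, if_pos rfl, smul_eq_mul, mul_one] at hc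
    exact Finsupp.mem_support_iff.mp ht₀ hc
  · have := key t ht
    rw [value] at this
    rw [map_smul, this, if_neg hne, smul_zero]

end Independence

end Model

/-! ### Splitting monomials into shuffle compositions -/

/-- Well-coloured shuffle trees with distinct labels. -/
structure IsValid {I O : Type} (S : Signature I O) (t : Tree I O) : Prop where
  wellColoured : t.WellColoured S
  isShuffle : t.IsShuffle
  nodup : t.labels.Nodup

section Splitting

variable {I O : Type} {S : Signature I O}

theorem IsValid.left {g : O} {s t : Tree I O} (h : IsValid S (.node g s t)) : IsValid S s :=
  ⟨h.1.2.2.1, h.2.2.1, (Tree.labels_node_nodup.mp h.3).1⟩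

theorem IsValid.right {g : O} {s t : Tree I O} (h : IsValid S (.node g s t)) : IsValid S t :=
  ⟨h.1.2.2.2, h.2.2.2, (Tree.labels_node_nodup.mp h.3).2.1⟩

theorem Tree.IsMonomial.isValid {t : Tree I O} (h : t.IsMonomial S) : IsValid S t :=
  ⟨h.wellColoured, h.isShuffle, h.nodup⟩

theorem IsValid.relabel {f : ℕ → ℕ} {t : Tree I O} (h : IsValid S t)
    (hf : StrictMonoOn f {i | i ∈ t.labels}) : IsValid S (t.relabel f) :=
  ⟨Tree.wellColoured_relabel f h.1, Tree.isShuffle_relabel hf h.2, by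
    rw [Tree.labels_relabel]
    exact List.Nodup.map_on (fun x hx y hy => hf.injOn hx hy) h.3⟩

theorem IsValid.of_isSubtree {r t : Tree I O} (hr : r.IsSubtree t) (h : IsValid S t) :
    IsValid S r := by
  induction hr with
  | refl t => exact h
  | left g t _ ih => exact ih h.left
  | right g s _ ih => exact ih h.right

theorem Tree.relabel_relabel (f g : ℕ → ℕ) (t : Tree I O) :
    (t.relabel f).relabel g = t.relabel (g ∘ f) := by
  induction t with
  | leaf c i => rfl
  | node g s t hs ht => simp [relabel, hs, ht]

theorem Tree.relabel_eq_self {f : ℕ → ℕ} {t : Tree I O} (h : ∀ i ∈ t.labels, f i = i) :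
    t.relabel f = t := by
  induction t with
  | leaf c i => simp [relabel, h i (by simp [labels_leaf])]
  | node g s t hs ht =>
    rw [relabel, hs fun i hi => h i (by rw [labels_node]; simp [hi]),
      ht fun i hi => h i (by rw [labels_node]; simp [hi])]

theorem Tree.relabel_graft {f : ℕ → ℕ} {i : ℕ} (u : Tree I O) {t : Tree I O}
    (h : ∀ j ∈ t.labels, f j = f i → j = i) :
    (graft i u t).relabel f = graft (f i) (u.relabel f) (t.relabel f) := by
  induction t with
  | leaf c j =>
    by_cases hj : j = i
    · simp [graft, relabel, hj]
    · have : f j ≠ f i := fun he => hj (h j (by simp [labels_leaf]) he)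
      simp [graft, relabel, hj, this]
  | node g s t hs ht =>
    rw [graft, relabel, hs fun j hj => h j (by rw [labels_node]; simp [hj]),
      ht fun j hj => h j (by rw [labels_node]; simp [hj])]
    rfl

/-- Every valid tree is a monotone relabelling of a tree monomial. -/
theorem exists_standardization {q : Tree I O} (hq : IsValid S q) : ∃ (s : Monomial S) (f : ℕ → ℕ),
    StrictMonoOn f (Set.Icc 1 s.1.arity) ∧ s.1.relabel f = q := by
  classical
  let p : ℕ → Prop := fun i => i ∈ q.labels
  let g : ℕ → ℕ := fun a => Nat.count p a + 1
  -- `f` lists the labels in increasing order and `g` is the rank of a label; the shift by one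
  -- occurs because `Nat.nth` counts from 0 and labels of monomials from 1.
  let f : ℕ → ℕ := fun i => Nat.nth p (i - 1)
  have hfin : (Set.ofPred p).Finite := q.labels.finite_toSet
  have hcard : hfin.toFinset.card = q.arity := by
    rw [← Tree.length_labels, ← List.toFinset_card_of_nodup hq.3]
    congr 1
    ext i; simp [p]
  have hgf : ∀ a ∈ q.labels, f (g a) = a := fun a ha => by
    simp only [f, g, Nat.add_sub_cancel]
    exact Nat.nth_count ha
  have hg : StrictMonoOn g {i | i ∈ q.labels} := fun a ha b _ hab => by
    have := Nat.count_strict_mono (p := p) ha hab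
    simp only [g]; omega
  have hgn : ∀ a ∈ q.labels, g a ≤ q.arity := fun a ha => by
    have h1 : Nat.count p (a + 1) = Nat.count p a + 1 := by
      rw [Nat.count_succ, if_pos ha]
    have h2 : Nat.count p (a + 1) ≤ hfin.toFinset.card := by
      rw [Nat.count_eq_card_filter_range]
      exact Finset.card_le_card fun i hi => by
        simpa using (Finset.mem_filter.mp hi).2
    simp only [g]; omega
  have hv := hq.relabel hg
  refine ⟨Monomial.of (q.relabel g) ⟨hv.1, hv.2, ?_⟩, f, ?_, ?_⟩
  · apply List.Subperm.perm_of_length_le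
    · refine List.Nodup.subperm hv.3 fun i hi => ?_
      rw [Tree.labels_relabel, List.mem_map] at hi
      obtain ⟨a, ha, rfl⟩ := hi
      rw [List.mem_range'_1, Tree.arity_relabel]
      have := hgn a ha
      simp only [g] at this ⊢; omega
    · rw [List.length_range', Tree.length_labels]
  · rw [Monomial.val_of, Tree.arity_relabel]
    intro i hi j hj hij
    refine Nat.nth_strictMonoOn hfin ?_ ?_ ?_
    · rw [Set.mem_Iio, hcard]; have := hi.1; have := hi.2; omega
    · rw [Set.mem_Iio, hcard]; have := hj.1; have := hj.2; omega
    · have := hi.1; omega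
  · rw [Monomial.val_of, Tree.relabel_relabel]
    exact Tree.relabel_eq_self hgf

/-- A monomial obtained by grafting is a shuffle composition. -/
theorem exists_comp_eq_of_graft {U : Monomial S} {q r : Tree I O}
    (hU : U.1 = Tree.graft r.minLabel r q) (hq : IsValid S q) (hr : IsValid S r)
    (hc : (r.outColour S, r.minLabel) ∈ q.leaves) :
    ∃ (n m : ℕ) (ω : ShuffleDatum n m) (s t : Monomial S) (h : Composable ω s t),
      U = Monomial.comp ω s t h ∧ s.1.relabel ω.outer = q ∧ t.1.relabel ω.inner = r := by
  obtain ⟨s, f, hf, rfl⟩ := exists_standardization hq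
  obtain ⟨t, g, hg, rfl⟩ := exists_standardization hr
  have hg' : StrictMonoOn g {i | i ∈ t.1.labels} := by rwa [IsMonomial_labels_set t.2]
  have hmin : (t.1.relabel g).minLabel = g 1 := by
    rw [Tree.minLabel_relabel _ hg', t.2.minLabel_eq]
  rw [hmin] at hU hc
  rw [Tree.outColour_relabel, Tree.leaves_relabel, List.mem_map] at hc
  obtain ⟨⟨c, k⟩, hk, hkc⟩ := hc
  simp only [Prod.mk.injEq] at hkc
  obtain ⟨rfl, hkg⟩ := hkc
  have hks : k ∈ s.1.labels := List.mem_map_of_mem (f := Prod.snd) hk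
  have hg1 : g 1 ∈ (s.1.relabel f).labels := by
    rw [Tree.labels_relabel, ← hkg]; exact List.mem_map_of_mem hks
  have har := Tree.arity_graft_add (g 1) (t.1.relabel g) (s.1.relabel f)
  rw [List.count_eq_one_of_mem hq.3 hg1, ← hU, Tree.arity_relabel, Tree.arity_relabel,
    one_mul] at har
  have hone : 1 ∈ t.1.labels := t.2.mem_labels.mpr ⟨le_rfl, Tree.arity_pos _⟩
  refine ⟨s.1.arity, t.1.arity, ⟨k, f, g, s.2.mem_labels.mp hks, hf, hg, hkg, ?_⟩, s, t,
    ⟨rfl, rfl, hk⟩, ?_, rfl, rfl⟩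
  · ext j
    have h1 : j ∈ U.1.labels ↔ j ∈ Set.Icc 1 (s.1.arity + t.1.arity - 1) := by
      rw [U.2.mem_labels, show U.1.arity = s.1.arity + t.1.arity - 1 by omega]
    rw [← h1, hU, Tree.mem_labels_graft, Tree.labels_relabel, Tree.labels_relabel, List.mem_map,
      List.mem_map, List.mem_map, ← IsMonomial_labels_set s.2, ← IsMonomial_labels_set t.2]
    simp only [Set.mem_union, Set.mem_image, Set.mem_ofPred_eq]
    constructor
    · rintro (⟨i, hi, rfl⟩ | h)
      · by_cases hij : f i = g 1
        · exact Or.inr ⟨⟨k, hks, hkg⟩, 1, hone, hij.symm⟩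
        · exact Or.inl ⟨⟨i, hi, rfl⟩, hij⟩
      · exact Or.inr ⟨⟨k, hks, hkg⟩, h⟩
    · rintro (⟨h, -⟩ | ⟨-, h⟩)
      exacts [Or.inl h, Or.inr h]
  · refine Subtype.ext (hU.trans ?_)
    exact congrArg (fun a => Tree.graft a (t.1.relabel g) (s.1.relabel f)) hkg.symm

/-- A monotone relabelling of a monomial that is obtained by grafting comes from a shuffle
composition. -/
theorem exists_comp_of_relabel_eq_graft {U : Monomial S} {f : ℕ → ℕ}
    (hf : StrictMonoOn f (Set.Icc 1 U.1.arity)) {q r : Tree I O}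
    (hU : U.1.relabel f = Tree.graft r.minLabel r q) (hq : IsValid S q) (hr : IsValid S r)
    (hc : (r.outColour S, r.minLabel) ∈ q.leaves) :
    ∃ (n m : ℕ) (ω : ShuffleDatum n m) (s t : Monomial S) (h : Composable ω s t),
      U = Monomial.comp ω s t h ∧
      (StrictMonoOn (f ∘ ω.outer) (Set.Icc 1 s.1.arity) ∧ s.1.relabel (f ∘ ω.outer) = q) ∧
      StrictMonoOn (f ∘ ω.inner) (Set.Icc 1 t.1.arity) ∧ t.1.relabel (f ∘ ω.inner) = r := by
  have hi : r.minLabel ∈ q.labels := List.mem_map_of_mem (f := Prod.snd) hc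
  have hlab : ∀ j, j ∈ (Tree.graft r.minLabel r q).labels ↔ j ∈ f '' Set.Icc 1 U.1.arity := by
    intro j
    rw [← hU, Tree.labels_relabel, List.mem_map, ← IsMonomial_labels_set U.2]
    rfl
  have hr' : ∀ j ∈ r.labels, j ∈ f '' Set.Icc 1 U.1.arity := fun j hj =>
    (hlab j).mp (Tree.mem_labels_graft.mpr (Or.inr ⟨hi, hj⟩))
  have hq' : ∀ j ∈ q.labels, j ∈ f '' Set.Icc 1 U.1.arity := fun j hj => by
    by_cases hji : j = r.minLabel
    · exact hji ▸ hr' _ (Tree.minLabel_mem r)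
    · exact (hlab j).mp (Tree.mem_labels_graft.mpr (Or.inl ⟨hj, hji⟩))
  -- Undoing the relabelling `f` reduces the claim to the monomial `U` itself; the inverse is
  -- increasing on the labels that occur.
  let g := Function.invFunOn f (Set.Icc 1 U.1.arity)
  have hgf : ∀ i ∈ Set.Icc 1 U.1.arity, g (f i) = i := fun i hi =>
    hf.injOn.leftInvOn_invFunOn hi
  have hfg : ∀ j ∈ f '' Set.Icc 1 U.1.arity, f (g j) = j := by
    rintro _ ⟨i, hi, rfl⟩
    rw [hgf i hi]
  have hg : StrictMonoOn g (f '' Set.Icc 1 U.1.arity) := by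
    rintro _ ⟨i, hi, rfl⟩ _ ⟨j, hj, rfl⟩ hij
    rw [hgf i hi, hgf j hj]
    exact (hf.lt_iff_lt hi hj).mp hij
  have gq := hq.relabel (hg.mono hq')
  have gr := hr.relabel (hg.mono hr')
  have hmin : (r.relabel g).minLabel = g r.minLabel := Tree.minLabel_relabel r (hg.mono hr')
  have hU' : U.1 = Tree.graft (r.relabel g).minLabel (r.relabel g) (q.relabel g) := by
    rw [hmin, ← Tree.relabel_graft r fun j hj he =>
      hg.injOn (hq' j hj) (hq' _ hi) he, ← hU, Tree.relabel_relabel]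
    refine (Tree.relabel_eq_self fun i hi => hgf i ?_).symm
    rwa [← U.2.mem_labels]
  obtain ⟨n, m, ω, s, t, h, hcomp, hs, ht⟩ := exists_comp_eq_of_graft hU' gq gr (by
    rw [Tree.outColour_relabel, hmin, Tree.leaves_relabel]
    exact List.mem_map_of_mem hc)
  have har : U.1.arity = n + m - 1 := by
    have := arity_comp h
    rw [hcomp, Monomial.comp]
    change (compTree ω s.1 t.1).arity = _
    omega
  refine ⟨n, m, ω, s, t, h, hcomp, ⟨?_, ?_⟩, ?_, ?_⟩
  · rw [h.1]
    refine hf.comp ω.outer_mono fun i hi => ?_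
    rw [har, ← ω.cover]; exact Or.inl ⟨i, hi, rfl⟩
  · rw [← Tree.relabel_relabel, hs, Tree.relabel_relabel]
    exact Tree.relabel_eq_self fun j hj => hfg j (hq' j hj)
  · rw [h.2.1]
    refine hf.comp ω.inner_mono fun i hi => ?_
    rw [har, ← ω.cover]; exact Or.inr ⟨i, hi, rfl⟩
  · rw [← Tree.relabel_relabel, ht, Tree.relabel_relabel]
    exact Tree.relabel_eq_self fun j hj => hfg j (hr' j hj)

end Splitting

/-! ### Leading terms of ideals -/

section LeadingTerms

variable {S : Signature Colour ShOp} {n m : ℕ} {ω : ShuffleDatum n m}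

/-- All paths of `s` are visible in the composite; at the grafting input, the known path to leaf 1
of `t` is removed from the end. Together with the output colour they determine `s`. -/
theorem comp_left_cancel {s s' t : Monomial S} (h : Composable ω s t) (h' : Composable ω s' t)
    (he : Monomial.comp ω s t h = Monomial.comp ω s' t h') : s = s' := by
  have he' : compTree ω s.1 t.1 = compTree ω s'.1 t.1 := congrArg Subtype.val he
  refine Subtype.ext (Tree.eq_of_path_eq s.2.wellColoured s'.2.wellColoured s.2.nodup s'.2.nodup
    (fun i => by rw [h.mem_left, h'.mem_left]) (fun i => ?_) ?_)
  · by_cases hi : i ∈ Set.Icc 1 n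
    · by_cases hp : i = ω.pos
      · have h1 : 1 ∈ Set.Icc 1 m := ⟨le_rfl, h.one_le⟩
        have := congrArg (Tree.path (ω.inner 1)) he'
        rw [path_comp_inner h h1, path_comp_inner h' h1] at this
        rw [hp]
        exact List.append_cancel_right this
      · have := congrArg (Tree.path (ω.outer i)) he'
        rwa [path_comp_outer h hi hp, path_comp_outer h' hi hp] at this
    · rw [Tree.path_of_notMem fun hh => hi (h.mem_left.mp hh),
        Tree.path_of_notMem fun hh => hi (h'.mem_left.mp hh)]
  · rw [← outColour_comp h, ← outColour_comp h', he']

theorem comp_right_cancel {s t t' : Monomial S} (h : Composable ω s t) (h' : Composable ω s t')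
    (he : Monomial.comp ω s t h = Monomial.comp ω s t' h') : t = t' := by
  have he' : compTree ω s.1 t.1 = compTree ω s.1 t'.1 := congrArg Subtype.val he
  refine Subtype.ext (Tree.eq_of_path_eq t.2.wellColoured t'.2.wellColoured t.2.nodup t'.2.nodup
    (fun i => by rw [h.mem_right, h'.mem_right]) (fun i => ?_) ?_)
  · by_cases hi : i ∈ Set.Icc 1 m
    · have := congrArg (Tree.path (ω.inner i)) he'
      rw [path_comp_inner h hi, path_comp_inner h' hi] at this
      exact List.append_cancel_left this
    · rw [Tree.path_of_notMem fun hh => hi (h.mem_right.mp hh),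
        Tree.path_of_notMem fun hh => hi (h'.mem_right.mp hh)]
  · exact congrArg Prod.fst (List.inj_on_of_nodup_map s.2.nodup h.2.2 h'.2.2 rfl)

variable {𝕜 : Type*} [Field 𝕜] {le : Monomial S → Monomial S → Prop}
  {M : Submodule 𝕜 (Free 𝕜 S)}

/-- `s` is the leading term of a homogeneous element of `M`. -/
def HasLead (le : Monomial S → Monomial S → Prop) (M : Submodule 𝕜 (Free 𝕜 S))
    (s : Monomial S) : Prop :=
  ∃ x ∈ M, IsHomogeneous x ∧ IsLeadingTerm le x s

/-- Admissibility keeps the composite of the leading monomial on top. Cancellation ensures that no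
other term of `x` gives the same composite, so its coefficient survives. -/
theorem HasLead.comp_left (hle : IsAdmissible le) (hM : IsOperadicIdeal M) {s t : Monomial S}
    (hs : HasLead le M s) (h : Composable ω s t) : HasLead le M (Monomial.comp ω s t h) := by
  classical
  obtain ⟨x, hx, hh, hl⟩ := hs
  have hall : ∀ u ∈ x.support, Composable ω u t := fun u hu =>
    composable_congr_left (hh s hl.1 u hu).1 h
  refine ⟨_, (hM n m ω x (Finsupp.single t 1)).1 hx, hh.comp_left ω t 1, ?_, fun u hu => ?_⟩
  · rw [Finsupp.mem_support_iff, comp_left_of_composable 1 hall, Finsupp.finsetSum_apply,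
      Finset.sum_eq_single_of_mem ⟨s, hl.1⟩ (Finset.mem_attach _ _), Finsupp.single_eq_same,
      mul_one]
    · exact Finsupp.mem_support_iff.mp hl.1
    · intro u _ hu
      refine Finsupp.single_eq_of_ne fun he => hu (Subtype.ext ?_)
      exact (comp_left_cancel _ _ he).symm
  · obtain ⟨v, hv, rfl⟩ := mem_support_comp_left hall hu
    exact hle.comp n m ω v s t t _ h (hl.2 v hv) (hle.refl t)

theorem HasLead.comp_right (hle : IsAdmissible le) (hM : IsOperadicIdeal M) {s t : Monomial S}
    (ht : HasLead le M t) (h : Composable ω s t) : HasLead le M (Monomial.comp ω s t h) := by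
  classical
  obtain ⟨x, hx, hh, hl⟩ := ht
  have hall : ∀ u ∈ x.support, Composable ω s u := fun u hu =>
    composable_congr_right (hh t hl.1 u hu).1 (hh t hl.1 u hu).2 h
  refine ⟨_, (hM n m ω (Finsupp.single s 1) x).2 hx, hh.comp_right ω s 1, ?_, fun u hu => ?_⟩
  · rw [Finsupp.mem_support_iff, comp_right_of_composable 1 hall, Finsupp.finsetSum_apply,
      Finset.sum_eq_single_of_mem ⟨t, hl.1⟩ (Finset.mem_attach _ _), Finsupp.single_eq_same,
      one_mul]
    · exact Finsupp.mem_support_iff.mp hl.1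
    · intro u _ hu
      refine Finsupp.single_eq_of_ne fun he => hu (Subtype.ext ?_)
      exact (comp_right_cancel _ _ he).symm
  · obtain ⟨v, hv, rfl⟩ := mem_support_comp_right hall hu
    exact hle.comp n m ω s s v t _ h (hle.refl s) (hl.2 v hv)

/-- The standardizations of `q` are leading terms of homogeneous elements of `M`. -/
def HasLeadUpTo (le : Monomial S → Monomial S → Prop) (M : Submodule 𝕜 (Free 𝕜 S))
    (q : Tree Colour ShOp) : Prop :=
  ∀ (U : Monomial S) (f : ℕ → ℕ), StrictMonoOn f (Set.Icc 1 U.1.arity) → U.1.relabel f = q →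
    HasLead le M U

variable {q r t : Tree Colour ShOp}

/-- After standardization a graft at the smallest label of the upper tree is a shuffle composition,
and either of its two factors may provide the leading term. -/
theorem HasLeadUpTo.graft (hle : IsAdmissible le) (hM : IsOperadicIdeal M)
    (h : HasLeadUpTo le M q ∨ HasLeadUpTo le M r) (hq : IsValid S q) (hr : IsValid S r)
    (hc : (r.outColour S, r.minLabel) ∈ q.leaves) :
    HasLeadUpTo le M (Tree.graft r.minLabel r q) := by
  intro U f hf hU
  obtain ⟨n, m, ω, s, t, hst, rfl, ⟨h1, h2⟩, h3, h4⟩ :=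
    exists_comp_of_relabel_eq_graft hf hU hq hr hc
  rcases h with h | h
  · exact (h s _ h1 h2).comp_left hle hM hst
  · exact (h t _ h3 h4).comp_right hle hM hst

/-- Each step towards the root grafts the tree obtained so far onto a vertex whose corresponding
input has been cut to a leaf. -/
theorem HasLeadUpTo.of_isSubtree (hle : IsAdmissible le) (hM : IsOperadicIdeal M)
    (h : HasLeadUpTo le M r) (hr : r.IsSubtree t) (ht : IsValid S t) : HasLeadUpTo le M t := by
  induction hr with
  | refl t => exact h
  | @left g r s t hr ih =>
    obtain ⟨n1, n2, n3⟩ := Tree.labels_node_nodup.mp ht.3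
    have hn : s.minLabel ∉ t.labels := n3 _ (Tree.minLabel_mem s)
    have := HasLeadUpTo.graft (q := .node g (.leaf (s.outColour S) s.minLabel) t) hle hM
      (Or.inr (ih h ht.left))
      ⟨⟨ht.1.1, ht.1.2.1, trivial, ht.1.2.2.2⟩, ⟨ht.2.1, trivial, ht.2.2.2⟩,
        Tree.labels_node_nodup.mpr ⟨List.nodup_singleton _, n2, by simpa [Tree.labels_leaf]⟩⟩
      ht.left (by simp [Tree.leaves])
    simpa [Tree.graft, Tree.graft_of_notMem hn] using this
  | @right g r t s hr ih =>
    obtain ⟨n1, n2, n3⟩ := Tree.labels_node_nodup.mp ht.3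
    have hn : t.minLabel ∉ s.labels := fun hh => n3 _ hh (Tree.minLabel_mem t)
    have := HasLeadUpTo.graft (q := .node g s (.leaf (t.outColour S) t.minLabel)) hle hM
      (Or.inr (ih h ht.right))
      ⟨⟨ht.1.1, ht.1.2.1, ht.1.2.2.1, trivial⟩, ⟨ht.2.1, ht.2.2.1, trivial⟩,
        Tree.labels_node_nodup.mpr ⟨n1, List.nodup_singleton _, fun i hi hi' => hn (by
          rw [Tree.labels_leaf, List.mem_singleton] at hi'
          exact hi' ▸ hi)⟩⟩
      ht.right (by simp [Tree.leaves])
    simpa [Tree.graft, Tree.graft_of_notMem hn] using this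

end LeadingTerms

/-! ### Truncations -/

section Truncations

variable {I O : Type} {S : Signature I O}

theorem Tree.IsTruncation.refl (t : Tree I O) : IsTruncation S t t := by
  induction t with
  | leaf c i => exact .cut (.leaf c i)
  | node g s t hs ht => exact .node g hs ht

theorem Tree.IsTruncation.exists_eq_node {g : O} {u v t : Tree I O}
    (h : (Tree.node g u v).IsTruncation S t) :
    ∃ s t', t = Tree.node g s t' ∧ u.IsTruncation S s ∧ v.IsTruncation S t' := by
  cases h with
  | node _ hu hv => exact ⟨_, _, rfl, hu, hv⟩

theorem Tree.IsTruncation.leaf_eq {c : I} {i : ℕ} {t : Tree I O}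
    (h : (leaf c i).IsTruncation S t) :
    (leaf c i : Tree I O) = leaf (t.outColour S) t.minLabel := by
  cases h
  rfl

theorem Tree.IsTruncation.outColour {u t : Tree I O} (h : IsTruncation S u t) :
    u.outColour S = t.outColour S := by
  cases h <;> rfl

theorem Tree.IsTruncation.minLabel {u t : Tree I O} (h : IsTruncation S u t) :
    u.minLabel = t.minLabel := by
  induction h with
  | cut t => rfl
  | node g _ _ hs ht => simp [Tree.minLabel, hs, ht]

theorem Tree.IsTruncation.labels_subset {u t : Tree I O} (h : IsTruncation S u t) :
    ∀ i ∈ u.labels, i ∈ t.labels := by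
  induction h with
  | cut t =>
    intro i hi
    rw [labels_leaf, List.mem_singleton] at hi
    exact hi ▸ minLabel_mem t
  | node g _ _ hs ht =>
    intro i hi
    rw [labels_node, List.mem_append] at hi ⊢
    exact hi.imp (hs i) (ht i)

theorem IsValid.of_isTruncation {u t : Tree I O} (h : u.IsTruncation S t) (ht : IsValid S t) :
    IsValid S u := by
  induction h with
  | cut t => exact ⟨trivial, trivial, List.nodup_singleton _⟩
  | node g hu hv hs ht' =>
    have h1 := hs ht.left
    have h2 := ht' ht.right
    refine ⟨⟨hu.outColour.trans ht.1.1, hv.outColour.trans ht.1.2.1, h1.1, h2.1⟩,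
      ⟨?_, h1.2, h2.2⟩, Tree.labels_node_nodup.mpr ⟨h1.3, h2.3, fun i hi hi' => ?_⟩⟩
    · rw [hu.minLabel, hv.minLabel]; exact ht.2.1
    · exact (Tree.labels_node_nodup.mp ht.3).2.2 i (hu.labels_subset i hi) (hv.labels_subset i hi')

/-- Ternary monomials are determined by their monotone relabellings. -/
theorem Tree.IsMonomial.eq_of_relabel_eq {s t : Tree I O} (hs : s.IsMonomial S)
    (ht : t.IsMonomial S) (h3 : t.arity = 3) {f g : ℕ → ℕ} (hf : StrictMonoOn f (Set.Icc 1 s.arity))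
    (hg : StrictMonoOn g (Set.Icc 1 t.arity)) (h : s.relabel f = t.relabel g) : s = t := by
  have ha : s.arity = 3 := by rw [← arity_relabel f, h, arity_relabel, h3]
  have key : ∀ i ∈ Set.Icc 1 3, ∃ j ∈ Set.Icc 1 3, g j = f i := by
    intro i hi
    have : f i ∈ (s.relabel f).labels := by
      rw [labels_relabel]
      exact List.mem_map_of_mem (hs.mem_labels.mpr (ha.symm ▸ hi))
    rw [h, labels_relabel, List.mem_map] at this
    obtain ⟨j, hj, he⟩ := this
    exact ⟨j, h3 ▸ ht.mem_labels.mp hj, he⟩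
  rw [ha] at hf
  rw [h3] at hg
  have hfg : ∀ i ∈ Set.Icc 1 3, g i = f i := by
    obtain ⟨j1, m1, e1⟩ := key 1 (by simp)
    obtain ⟨j2, m2, e2⟩ := key 2 (by simp)
    obtain ⟨j3, m3, e3⟩ := key 3 (by simp)
    have l1 : j1 < j2 := (hg.lt_iff_lt m1 m2).mp (by
      rw [e1, e2]; exact hf (by simp) (by simp) (by norm_num))
    have l2 : j2 < j3 := (hg.lt_iff_lt m2 m3).mp (by
      rw [e2, e3]; exact hf (by simp) (by simp) (by norm_num))
    rw [Set.mem_Icc] at m1 m3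
    obtain rfl : j1 = 1 := by omega
    obtain rfl : j2 = 2 := by omega
    obtain rfl : j3 = 3 := by omega
    rintro i ⟨hi1, hi2⟩
    interval_cases i <;> assumption
  have hinv : ∀ i ∈ Set.Icc 1 3, Function.invFunOn g (Set.Icc 1 3) (g i) = i := fun i hi =>
    hg.injOn.leftInvOn_invFunOn hi
  calc s = (s.relabel f).relabel (Function.invFunOn g (Set.Icc 1 3)) := by
        rw [relabel_relabel]
        refine (relabel_eq_self fun i hi => ?_).symm
        have hi' := hs.mem_labels.mp hi
        rw [ha] at hi'
        rw [Function.comp_apply, ← hfg i hi', hinv i hi']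
    _ = t := by
        rw [h, relabel_relabel]
        refine relabel_eq_self fun i hi => hinv i ?_
        rw [← h3]; exact ht.mem_labels.mp hi

end Truncations

/-! ### Occurrences of leading terms -/

theorem exists_rootReducible_of_not_isNormal {t : Tree Colour ShOp} (h : ¬ IsNormal t) :
    ∃ r, r.IsSubtree t ∧ RootReducible r := by
  induction t with
  | leaf _ i => exact absurd trivial h
  | node g s t hs ht =>
    by_cases h0 : RootReducible (.node g s t)
    · exact ⟨_, .refl _, h0⟩
    by_cases h1 : IsNormal s
    · by_cases h2 : IsNormal t
      · exact absurd ⟨h0, h1, h2⟩ h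
      · obtain ⟨r, hr, hr'⟩ := ht h2
        exact ⟨r, .right g s hr, hr'⟩
    · obtain ⟨r, hr, hr'⟩ := hs h1
      exact ⟨r, .left g t hr, hr'⟩

theorem leftTree_mem_of_leftReducible {g h : ShOp} {lt : Bool} (hr : LeftReducible g h lt = true) :
    (if lt then leftTree shSig g h 1 2 3 else leftTree shSig g h 1 3 2) ∈ derComLeadingTrees := by
  revert hr
  cases g <;> cases h <;> cases lt <;> decide

theorem rightTree_mem_of_rightReducible {g h : ShOp} (hr : RightReducible g h = true) :
    rightTree shSig g h 1 2 3 ∈ derComLeadingTrees := by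
  revert hr
  cases g <;> cases h <;> decide

theorem isMonomial_derComLeadingTrees :
    ∀ t ∈ derComLeadingTrees, t.IsMonomial shSig ∧ t.arity = 3 := by
  decide +kernel

/-- The increasing map with values `a`, `b`, `c` at `1`, `2`, `3`. -/
def threeValues (a b c : ℕ) (i : ℕ) : ℕ := if i ≤ 1 then a else if i ≤ 2 then b else c

theorem strictMonoOn_threeValues {a b c : ℕ} (hab : a < b) (hbc : b < c) :
    StrictMonoOn (threeValues a b c) (Set.Icc 1 3) := by
  rintro i ⟨hi1, hi2⟩ j ⟨hj1, hj2⟩ hij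
  unfold threeValues
  split_ifs <;> omega

/-- Cut all edges entering the two-vertex pattern from above. The three remaining leaves carry
smallest labels, and the increasing list of these gives `f`. For a left comb their order decides
between the labellings `1 2 3` and `1 3 2`. -/
theorem RootReducible.exists_isTruncation {r : Tree Colour ShOp} (h : RootReducible r)
    (hv : IsValid shSig r) : ∃ l ∈ derComLeadingTrees, ∃ f : ℕ → ℕ, StrictMonoOn f (Set.Icc 1 3) ∧
      (l.relabel f).IsTruncation shSig r := by
  cases r with
  | leaf _ i => exact h.elim
  | node g s t =>
    rcases h with ⟨h, a, b, rfl, hr⟩ | ⟨h, a, b, rfl, hr⟩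
    · have hab : a.minLabel < b.minLabel := hv.2.2.1.1
      have hat : a.minLabel < t.minLabel := by
        have := hv.2.1
        simp only [Tree.minLabel] at this
        omega
      have hbt : b.minLabel ≠ t.minLabel := fun he =>
        (Tree.labels_node_nodup.mp hv.3).2.2 b.minLabel (by
          rw [Tree.labels_node, List.mem_append]; exact Or.inr (Tree.minLabel_mem b))
          (he ▸ Tree.minLabel_mem t)
      have hT := Tree.IsTruncation.node (S := shSig) g
        (.node h (.cut a) (.cut b)) (.cut t)
      rw [hv.1.2.1, hv.1.2.2.1.1, hv.1.2.2.1.2.1] at hT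
      have hm := leftTree_mem_of_leftReducible hr
      by_cases hlt : b.minLabel < t.minLabel
      · rw [decide_eq_true hlt, if_pos rfl] at hm
        exact ⟨_, hm, _, strictMonoOn_threeValues hab hlt, hT⟩
      · rw [decide_eq_false hlt, if_neg Bool.false_ne_true] at hm
        exact ⟨_, hm, _, strictMonoOn_threeValues hat (by omega : t.minLabel < b.minLabel), hT⟩
    · have hab : a.minLabel < b.minLabel := hv.2.2.2.1
      have hsa : s.minLabel < a.minLabel := by
        have := hv.2.1
        simp only [Tree.minLabel] at this
        omega
      have hT := Tree.IsTruncation.node (S := shSig) g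
        (.cut s) (.node h (.cut a) (.cut b))
      rw [hv.1.1, hv.1.2.2.2.1, hv.1.2.2.2.2.1] at hT
      exact ⟨_, rightTree_mem_of_rightReducible hr, _, strictMonoOn_threeValues hsa hab, hT⟩

theorem exists_divisible_of_not_isNormal {t : Monomial shSig} (h : ¬ IsNormal t.1) :
    ∃ l : Monomial shSig, l.1 ∈ derComLeadingTrees ∧ Divisible t l := by
  obtain ⟨r, hr, hred⟩ := exists_rootReducible_of_not_isNormal h
  obtain ⟨l, hl, f, hf, hT⟩ := hred.exists_isTruncation (t.2.isValid.of_isSubtree hr)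
  obtain ⟨hm, h3⟩ := isMonomial_derComLeadingTrees l hl
  exact ⟨Monomial.of l hm, hl, r, f, hr, by rw [Monomial.val_of, h3]; exact hf, hT⟩

/-! ### Passing leading terms from quadratic patterns to larger trees -/

section Ideals

variable {𝕜 : Type*} [Field 𝕜] {le : Monomial shSig → Monomial shSig → Prop}
  {M : Submodule 𝕜 (Free 𝕜 shSig)}

/-- Trees of the shape `g(h(a, b), t)` inherit leading terms from their truncations. -/
theorem HasLeadUpTo.of_left (hle : IsAdmissible le) (hM : IsOperadicIdeal M) {g h : ShOp}
    {a b t : Tree Colour ShOp} (hv : IsValid shSig (.node g (.node h a b) t))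
    (hq : HasLeadUpTo le M (.node g (.node h (.leaf (a.outColour shSig) a.minLabel)
      (.leaf (b.outColour shSig) b.minLabel)) (.leaf (t.outColour shSig) t.minLabel))) :
    HasLeadUpTo le M (.node g (.node h a b) t) := by
  have n1 := (Tree.labels_node_nodup.mp hv.3).2.2
  have n2 := (Tree.labels_node_nodup.mp hv.left.3).2.2
  simp only [Tree.labels_node, List.mem_append] at n1
  have ma := Tree.minLabel_mem a
  have mb := Tree.minLabel_mem b
  have mt := Tree.minLabel_mem t
  have tb : b.minLabel ∉ a.labels := fun h => n2 _ h mb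
  have tta : t.minLabel ∉ a.labels := fun h => n1 _ (Or.inl h) mt
  have ttb : t.minLabel ∉ b.labels := fun h => n1 _ (Or.inr h) mt
  have hba : b.minLabel ≠ a.minLabel := fun h => tb (h ▸ ma)
  have hta : t.minLabel ≠ a.minLabel := fun h => tta (h ▸ ma)
  have htb : t.minLabel ≠ b.minLabel := fun h => ttb (h ▸ mb)
  -- The cut subtrees are grafted back one at a time; as labels are distinct, each graft changes
  -- only its own leaf.
  have s1 := HasLeadUpTo.graft hle hM (r := a) (Or.inl hq)
    (hv.of_isTruncation (.node g (.node h (.cut a) (.cut b)) (.cut t))) hv.left.left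
    (by simp [Tree.leaves])
  simp only [Tree.graft, if_true, if_neg hba, if_neg hta] at s1
  have s2 := HasLeadUpTo.graft hle hM (r := b) (Or.inl s1)
    (hv.of_isTruncation (.node g (.node h (.refl a) (.cut b)) (.cut t))) hv.left.right
    (by simp [Tree.leaves])
  simp only [Tree.graft, if_true, if_neg htb, Tree.graft_of_notMem tb] at s2
  have s3 := HasLeadUpTo.graft hle hM (r := t) (Or.inl s2)
    (hv.of_isTruncation (.node g (.refl _) (.cut t))) hv.right
    (by simp [Tree.leaves])
  simpa only [Tree.graft, if_true, Tree.graft_of_notMem tta, Tree.graft_of_notMem ttb] using s3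

/-- Trees of the shape `g(s, h(a, b))` inherit leading terms from their truncations. -/
theorem HasLeadUpTo.of_right (hle : IsAdmissible le) (hM : IsOperadicIdeal M) {g h : ShOp}
    {s a b : Tree Colour ShOp} (hv : IsValid shSig (.node g s (.node h a b)))
    (hq : HasLeadUpTo le M (.node g (.leaf (s.outColour shSig) s.minLabel)
      (.node h (.leaf (a.outColour shSig) a.minLabel) (.leaf (b.outColour shSig) b.minLabel)))) :
    HasLeadUpTo le M (.node g s (.node h a b)) := by
  have n1 := (Tree.labels_node_nodup.mp hv.3).2.2
  have n2 := (Tree.labels_node_nodup.mp hv.right.3).2.2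
  simp only [Tree.labels_node, List.mem_append, not_or] at n1
  have ms := Tree.minLabel_mem s
  have ma := Tree.minLabel_mem a
  have mb := Tree.minLabel_mem b
  have sa : a.minLabel ∉ s.labels := fun h => (n1 _ h).1 ma
  have sb : b.minLabel ∉ s.labels := fun h => (n1 _ h).2 mb
  have ab : b.minLabel ∉ a.labels := fun h => n2 _ h mb
  have has : a.minLabel ≠ s.minLabel := fun h => sa (h ▸ ms)
  have hbs : b.minLabel ≠ s.minLabel := fun h => sb (h ▸ ms)
  have hba : b.minLabel ≠ a.minLabel := fun h => ab (h ▸ ma)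
  have s1 := HasLeadUpTo.graft hle hM (r := s) (Or.inl hq)
    (hv.of_isTruncation (.node g (.cut s) (.node h (.cut a) (.cut b)))) hv.left
    (by simp [Tree.leaves])
  simp only [Tree.graft, if_true, if_neg has, if_neg hbs] at s1
  have s2 := HasLeadUpTo.graft hle hM (r := a) (Or.inl s1)
    (hv.of_isTruncation (.node g (.refl s) (.node h (.cut a) (.cut b)))) hv.right.left
    (by simp [Tree.leaves])
  simp only [Tree.graft, if_true, if_neg hba, Tree.graft_of_notMem sa] at s2
  have s3 := HasLeadUpTo.graft hle hM (r := b) (Or.inl s2)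
    (hv.of_isTruncation (.node g (.refl s) (.node h (.refl a) (.cut b)))) hv.right.right
    (by simp [Tree.leaves])
  simpa only [Tree.graft, if_true, Tree.graft_of_notMem sb, Tree.graft_of_notMem ab] using s3

theorem exists_shape : ∀ l ∈ derComLeadingTrees,
    (∃ g h i j k, l = leftTree shSig g h i j k) ∨ ∃ g h i j k, l = rightTree shSig g h i j k := by
  intro l hl
  simp only [derComLeadingTrees, List.mem_cons, List.not_mem_nil, or_false] at hl
  rcases hl with h | h | h | h | h | h | h | h | h | h | h | h | h | h | h <;>
    first
    | exact Or.inl ⟨_, _, _, _, _, h⟩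
    | exact Or.inr ⟨_, _, _, _, _, h⟩

theorem HasLeadUpTo.of_isTruncation (hle : IsAdmissible le) (hM : IsOperadicIdeal M)
    {l r : Tree Colour ShOp} (hl : l ∈ derComLeadingTrees) {f : ℕ → ℕ}
    (hT : (l.relabel f).IsTruncation shSig r) (hv : IsValid shSig r)
    (h : HasLeadUpTo le M (l.relabel f)) : HasLeadUpTo le M r := by
  rcases exists_shape l hl with ⟨g, k, i₁, i₂, i₃, rfl⟩ | ⟨g, k, i₁, i₂, i₃, rfl⟩
  · obtain ⟨s, t, rfl, hs, ht⟩ := Tree.IsTruncation.exists_eq_node hT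
    obtain ⟨a, b, rfl, ha, hb⟩ := hs.exists_eq_node
    refine .of_left hle hM hv ?_
    rw [← ha.leaf_eq, ← hb.leaf_eq, ← ht.leaf_eq]
    exact h
  · obtain ⟨s, t, rfl, hs, ht⟩ := Tree.IsTruncation.exists_eq_node hT
    obtain ⟨a, b, rfl, ha, hb⟩ := ht.exists_eq_node
    refine .of_right hle hM hv ?_
    rw [← hs.leaf_eq, ← ha.leaf_eq, ← hb.leaf_eq]
    exact h

/-- If the leading terms of the relations of `DerCom` are leading terms in `M`, then so are all
monomials that are not normal. -/
theorem hasLead_of_not_isNormal (hle : IsAdmissible le) (hM : IsOperadicIdeal M)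
    (hL : ∀ l : Monomial shSig, l.1 ∈ derComLeadingTrees → HasLead le M l) {t : Monomial shSig}
    (h : ¬ IsNormal t.1) : HasLead le M t := by
  obtain ⟨r, hr, hred⟩ := exists_rootReducible_of_not_isNormal h
  have hv := t.2.isValid.of_isSubtree hr
  obtain ⟨l, hl, f, hf, hT⟩ := hred.exists_isTruncation hv
  obtain ⟨hm, h3⟩ := isMonomial_derComLeadingTrees l hl
  -- The standardization of the pattern is unique, so it is the given element of `L` itself.
  have h0 : HasLeadUpTo le M (l.relabel f) := fun U f' hf' hU => hL U (by
    rwa [U.2.eq_of_relabel_eq hm h3 hf' (h3.symm ▸ hf) hU])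
  refine ((h0.of_isTruncation hle hM hl hT hv).of_isSubtree hle hM hr t.2.isValid) t id
    strictMonoOn_id (Tree.relabel_eq_self fun _ _ => rfl)

end Ideals

/-! ### Reduction to normal forms -/

instance : Finite Colour :=
  Finite.of_injective (β := Bool) (fun a => decide (a = .c)) fun x y => by
    cases x <;> cases y <;> simp

instance : Finite ShOp :=
  Finite.of_injective (β := Fin 12) (fun g => ⟨letterIndex (g, true), letterIndex_lt _⟩)
    fun _ _ h => congrArg Prod.fst (letterIndex_injective (Fin.mk.inj h))

/-- Colours and operations are finite in number, and both subtrees of a vertex have smaller arity,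
so induction on the arity applies. -/
theorem finite_setOf_tree (N n : ℕ) :
    {t : Tree Colour ShOp | t.arity ≤ n ∧ ∀ i ∈ t.labels, i ≤ N}.Finite := by
  induction n with
  | zero =>
    refine Set.finite_empty.subset fun t ht => ?_
    have := Tree.arity_pos t
    have := ht.1
    omega
  | succ n ih =>
    refine ((Set.finite_univ.prod (Set.finite_Iic N)).image
      (fun p : Colour × ℕ => Tree.leaf p.1 p.2) |>.union
      ((Set.finite_univ.prod (ih.prod ih)).image
      (fun p : ShOp × Tree Colour ShOp × Tree Colour ShOp => Tree.node p.1 p.2.1 p.2.2))).subset ?_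
    rintro (⟨a, i⟩ | ⟨g, s, t⟩) ⟨h1, h2⟩
    · exact Or.inl ⟨(a, i), ⟨trivial, h2 i (by simp [Tree.labels_leaf])⟩, rfl⟩
    · rw [Tree.arity_node] at h1
      have := Tree.arity_pos s
      have := Tree.arity_pos t
      rw [Tree.labels_node] at h2
      exact Or.inr ⟨(g, s, t), ⟨trivial,
        ⟨(by omega : s.arity ≤ n), fun i hi => h2 i (List.mem_append_left _ hi)⟩,
        ⟨(by omega : t.arity ≤ n), fun i hi => h2 i (List.mem_append_right _ hi)⟩⟩, rfl⟩

section Reduction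

variable {𝕜 : Type*} [Field 𝕜] {le : Monomial shSig → Monomial shSig → Prop}
  {M : Submodule 𝕜 (Free 𝕜 shSig)}

/-- A smaller monomial cannot have larger arity, so only finitely many trees qualify. This makes the
reduction terminate. -/
theorem IsAdmissible.finite_setOf_le (hle : IsAdmissible le) (s : Monomial shSig) :
    {u | le u s}.Finite := by
  refine Set.Finite.of_injOn (f := Subtype.val)
    (t := {t : Tree Colour ShOp | t.arity ≤ s.1.arity ∧ ∀ i ∈ t.labels, i ≤ s.1.arity})
    (fun u hu => ?_) Subtype.val_injective.injOn (finite_setOf_tree _ _)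
  have ha : u.1.arity ≤ s.1.arity := by
    by_contra hlt
    push Not at hlt
    have := hle.antisymm u s hu (hle.arity s u hlt)
    rw [this] at hlt
    exact hlt.false
  exact ⟨ha, fun i hi => ((u.2.mem_labels.mp hi).2).trans ha⟩

theorem exists_reduction_of_support {z : Free 𝕜 shSig}
    (h : ∀ u ∈ z.support, ∃ y ∈ M, ∀ v ∈ (Finsupp.single u 1 - y).support,
      IsNormal v.1 ∧ le v u) :
    ∃ w ∈ M, ∀ v ∈ (z - w).support, IsNormal v.1 ∧ ∃ u ∈ z.support, le v u := by
  classical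
  choose! y hy hy' using h
  refine ⟨∑ u ∈ z.support, z u • y u,
    Submodule.sum_mem _ fun u hu => Submodule.smul_mem _ _ (hy u hu), fun v hv => ?_⟩
  have e : z - ∑ u ∈ z.support, z u • y u =
      ∑ u ∈ z.support, z u • (Finsupp.single u 1 - y u) := by
    simp only [smul_sub, Finset.sum_sub_distrib, Finsupp.smul_single, smul_eq_mul, mul_one]
    congr 1
    exact (Finsupp.sum_single z).symm
  rw [e] at hv
  obtain ⟨u, hu, hv⟩ := Finset.mem_biUnion.mp (Finsupp.support_finsetSum hv)
  have := hy' u hu v (Finsupp.support_smul hv)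
  exact ⟨this.1, u, hu, this.2⟩

/-- A monomial that is not normal is replaced, modulo `M`, by strictly smaller ones. The number of
monomials below it decreases, and induction on this number applies. -/
theorem exists_reduction (hle : IsAdmissible le)
    (hM : ∀ t : Monomial shSig, ¬ IsNormal t.1 → HasLead le M t) (s : Monomial shSig) :
    ∃ y ∈ M, ∀ v ∈ (Finsupp.single s (1 : 𝕜) - y).support, IsNormal v.1 ∧ le v s := by
  classical
  induction hk : {u | le u s}.ncard using Nat.strong_induction_on generalizing s with
  | _ k ih =>
    by_cases hs : IsNormal s.1
    · refine ⟨0, zero_mem _, fun v hv => ?_⟩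
      rw [sub_zero] at hv
      obtain rfl : v = s := by simpa using Finsupp.support_single_subset hv
      exact ⟨hs, hle.refl v⟩
    · obtain ⟨x, hx, -, hl⟩ := hM s hs
      have ha : x s ≠ 0 := Finsupp.mem_support_iff.mp hl.1
      have hz : ∀ u ∈ (Finsupp.single s 1 - (x s)⁻¹ • x).support, le u s ∧ u ≠ s := by
        intro u hu
        have hne : u ≠ s := by
          rintro rfl
          rw [Finsupp.mem_support_iff] at hu
          apply hu
          rw [Finsupp.sub_apply, Finsupp.single_eq_same, Finsupp.smul_apply, smul_eq_mul,
            inv_mul_cancel₀ ha, sub_self]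
        refine ⟨hl.2 u (Finsupp.mem_support_iff.mpr fun h0 =>
          Finsupp.mem_support_iff.mp hu ?_), hne⟩
        rw [Finsupp.sub_apply, Finsupp.single_eq_of_ne hne, Finsupp.smul_apply, h0, smul_zero,
          sub_zero]
      obtain ⟨w, hw, hw'⟩ := exists_reduction_of_support (M := M) (le := le) fun u hu => by
        obtain ⟨h1, h2⟩ := hz u hu
        refine ih _ ?_ u rfl
        rw [← hk]
        refine Set.ncard_lt_ncard ⟨fun v hv => hle.trans v u s hv h1, fun hh => h2 ?_⟩
          (hle.finite_setOf_le s)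
        exact hle.antisymm u s h1 (hh (hle.refl s))
      refine ⟨(x s)⁻¹ • x + w, add_mem (Submodule.smul_mem _ _ hx) hw, fun v hv => ?_⟩
      rw [← sub_sub] at hv
      obtain ⟨h1, u, hu, h2⟩ := hw' v hv
      exact ⟨h1, hle.trans v u s h2 (hz u hu).1⟩

/-- Keep the supposed normal leading term and reduce all smaller terms. The result lies in the ideal
and involves only normal monomials, so it is zero by evaluation in the model; yet it has the same
leading coefficient as `x`. -/
theorem not_isNormal_of_isLeadingTerm [CharZero 𝕜] (hle : IsAdmissible le)
    (hL : leadingTrees le (derComRelations 𝕜) = {t | t ∈ derComLeadingTrees})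
    {x : Free 𝕜 shSig} (hx : x ∈ operadicIdeal (derComRelations 𝕜)) {t : Monomial shSig}
    (ht : IsLeadingTerm le x t) : ¬ IsNormal t.1 := by
  classical
  intro hn
  have hvan := (Model.isDerComAlgebra_op (𝕜 := 𝕜)).relations_subset
  have hM : ∀ s : Monomial shSig, ¬ IsNormal s.1 →
      HasLead le (operadicIdeal (derComRelations 𝕜)) s := fun s hs => by
    refine hasLead_of_not_isNormal hle (isOperadicIdeal_operadicIdeal _) (fun l hl => ?_) hs
    have : l.1 ∈ leadingTrees le (derComRelations 𝕜) := hL ▸ hl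
    obtain ⟨g, hg, u, hu, hul⟩ := this
    obtain rfl : u = l := Subtype.ext hul
    exact ⟨g, subset_operadicIdeal _ hg, (hvan hg).1, hu⟩
  set z := x - Finsupp.single t (x t) with hz
  have hzt : ∀ u ∈ z.support, le u t ∧ u ≠ t := by
    intro u hu
    have hne : u ≠ t := by
      rintro rfl
      rw [Finsupp.mem_support_iff] at hu
      apply hu
      rw [hz, Finsupp.sub_apply, Finsupp.single_eq_same, sub_self]
    refine ⟨ht.2 u (Finsupp.mem_support_iff.mpr fun h0 => Finsupp.mem_support_iff.mp hu ?_), hne⟩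
    rw [hz, Finsupp.sub_apply, Finsupp.single_eq_of_ne hne, h0, sub_zero]
  obtain ⟨w, hw, hw'⟩ := exists_reduction_of_support (z := z)
    fun u _ => exists_reduction hle hM u
  have hsupp : ∀ u ∈ (x - w).support, IsNormal u.1 := by
    intro u hu
    have e : x - w = Finsupp.single t (x t) + (z - w) := by rw [hz]; abel
    rw [e] at hu
    rcases Finset.mem_union.mp (Finsupp.support_add hu) with h | h
    · obtain rfl : u = t := by simpa using Finsupp.support_single_subset h
      exact hn
    · exact (hw' u h).1
  have h0 := Model.eq_zero_of_evalLin_eq_zero hsupp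
    (evalLin_eq_zero_of_mem_operadicIdeal hvan (sub_mem hx hw) _)
  -- Reduction produces only monomials below those of `z`, all of which are strictly below `t`; so
  -- the leading term cannot be cancelled.
  have hwt : (z - w) t = 0 := by
    by_contra hne
    obtain ⟨-, u, hu, htu⟩ := hw' t (Finsupp.mem_support_iff.mpr hne)
    exact (hzt u hu).2 (hle.antisymm u t (hzt u hu).1 htu)
  have : (x - w) t = x t := by
    have e : x - w = Finsupp.single t (x t) + (z - w) := by rw [hz]; abel
    rw [e, Finsupp.add_apply, hwt, Finsupp.single_eq_same, add_zero]
  rw [h0] at this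
  exact Finsupp.mem_support_iff.mp ht.1 this.symm

theorem isGroebnerBasis_derComRelations [CharZero 𝕜] (hle : IsAdmissible le)
    (hL : leadingTrees le (derComRelations 𝕜) = {t | t ∈ derComLeadingTrees}) :
    IsGroebnerBasis le (operadicIdeal (derComRelations 𝕜)) (derComRelations 𝕜) := by
  refine ⟨rfl, fun x hx t ht => ?_⟩
  obtain ⟨l, hl, hd⟩ := exists_divisible_of_not_isNormal
    (not_isNormal_of_isLeadingTerm hle hL hx ht)
  have : l.1 ∈ leadingTrees le (derComRelations 𝕜) := hL ▸ hl
  obtain ⟨g, hg, u, hu, hul⟩ := this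
  obtain rfl : u = l := Subtype.ext hul
  exact ⟨g, hg, u, hu, hd⟩

end Reduction

end ColouredOperad

theorem mainTheorem11 (𝕜 : Type*) [Field 𝕜] [CharZero 𝕜] :
    (∃ le : ColouredOperad.Monomial ColouredOperad.shSig →
        ColouredOperad.Monomial ColouredOperad.shSig → Prop,
      ColouredOperad.IsAdmissible le ∧
      ColouredOperad.leadingTrees le (ColouredOperad.lieRRelations 𝕜) =
        {t | t ∈ ColouredOperad.lieRLeadingTrees} ∧
      ColouredOperad.leadingTrees le (ColouredOperad.derComRelations 𝕜) =
        {t | t ∈ ColouredOperad.derComLeadingTrees}) ∧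
    (∀ g ∈ ColouredOperad.derComRelations 𝕜, g ≠ 0 ∧ ColouredOperad.IsQuadratic g) ∧
    (∀ le : ColouredOperad.Monomial ColouredOperad.shSig →
        ColouredOperad.Monomial ColouredOperad.shSig → Prop,
      ColouredOperad.IsAdmissible le →
      ColouredOperad.leadingTrees le (ColouredOperad.derComRelations 𝕜) =
        {t | t ∈ ColouredOperad.derComLeadingTrees} →
      ColouredOperad.IsGroebnerBasis le
        (ColouredOperad.operadicIdeal (ColouredOperad.derComRelations 𝕜))
        (ColouredOperad.derComRelations 𝕜)) :=
  ⟨⟨ColouredOperad.pathOrder, ColouredOperad.isAdmissible_pathOrder,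
    ColouredOperad.leadingTrees_lieR 𝕜, ColouredOperad.leadingTrees_derCom 𝕜⟩,
    ColouredOperad.derComRelations_ne_zero_and_isQuadratic 𝕜,
    fun _ hle hL => ColouredOperad.isGroebnerBasis_derComRelations hle hL⟩
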